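/- **Setting.** Let $K\ge 2$, let $x_t\in\mathbb R^{d_x}$ be inputs and $z_t\in\{1,\dots,K\}$ labels, $t=1,\dots,T$. A Minimal Gated Unit (MGU) RNN with weights $W_r,W_h\in\mathbb R^{d_h\times d_x}$, $U_r,U_h\in\mathbb R^{d_h\times d_h}$, $V\in\mathbb R^{d_y\times d_h}$, $d_y=K$, computes from $h_0=0$ $$r_t=\sigma(W_rx_t+U_rh_{t-1}),\quad \tilde h_t=\tanh\big(W_hx_t+U_h(r_t\odot h_{t-1})\big),\quad h_t=(1-r_t)\odot h_{t-1}+r_t\odot\tilde h_t,\quad y_t=\sigma_y(Vh_t),$$ where $\sigma(u)=(1+e^{-u})^{-1}$, all activations act entrywise, $\odot$ is the entrywise product, and $\sigma_y:\mathbb R\to\mathbb R$ is a given $\rho_y$-Lipschitz function with $\sigma_y(0)=0$. Let $\mathcal F_{g,t}$ be the class of all such maps $f_t:(x_1,\dots,x_t)\mapsto y_t$ whose weights satisfy the spectral norm bounds $\|W_r\|_2\le B_{W_r}$, $\|W_h\|_2\le B_{W_h}$, $\|U_r\|_2\le B_{U_r}$, $\|U_h\|_2\le B_{U_h}$, $\|V\|_2\le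 B_V$. The predicted label is $\tilde z_t=\arg\max_j[y_t]_j$ (ties broken by any fixed rule). The margin is $\mathcal M(y,z)=[y]_z-\max_{j\ne z}[y]_j$, the ramp loss is $\mathcal L_\gamma(a)=\mathbf 1\{a>0\}+(1+a/\gamma)\mathbf 1\{-\gamma\le a\le 0\}$, and for a sample $S$ of $m\ge 1$ sequences the empirical ramp risk is $\hat{\mathcal R}_\gamma(f_t)=\frac1m\sum_{i=1}^m\mathcal L_\gamma\big(-\mathcal M(f_t(x_{i,1},\dots,x_{i,t}),z_{i,t})\big)$. Put $\frac{a^t-1}{a-1}=t$ for $a=1$. **Theorem.** There is an absolute constant $C>0$ such that the following holds. Let the sequence $(x_t,z_t)_{t=1}^T$ and the sample $S=\{(x_{i,t},z_{i,t})_{t=1}^T: i=1,\dots,m\}$ be drawn i.i.d. from any distribution of sequences in $\mathbb R^{d_x}\times\{1,\dots,K\}$ with $\|x_t\|_2\le B_x$ for all $t\le T$ almost surely, let $0<\delta<1$, and let $1\le t\le T$. Then with probability at least $1-\delta$ over $S$, for every margin value $\gamma>0$ and every $f_t\in\mathcal F_{g,t}$, $$\mathbb P(\tilde z_t\ne z_t)\le\hat{\mathcal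 R}_\gamma(f_t)+3\sqrt{\frac{\log(2/\delta)}{2m}}+C\,\frac{d\,\rho_yB_V\min\Big\{\sqrt d,\;B_{W_h}B_x\frac{\beta^t-1}{\beta-1}\Big\}\sqrt{\log\Big(\frac{\theta^t-1}{\theta-1}\,d\sqrt m\Big)}}{\sqrt m\,\gamma}.$$ Here $d=\max\{d_x,d_y,d_h\}$, $\theta=\beta+2B_{U_r}+B_{U_r}B_{U_h}$, and $\beta$ is the (essential) maximum over input sequences of $\max_{1\le j\le t}\big\{\|1-r_j\|_\infty+B_{U_h}\|r_j\|_\infty^2\big\}$, where $r_j$ are the gates of the network $f_t$; more generally, $\beta$ may be any almost sure upper bound of these quantities. -/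

import Mathlib

open MeasureTheory Matrix
open scoped NNReal ENNReal

noncomputable section

namespace MGU

/-- The ratio `(a ^ t - 1) / (a - 1)`, with the value `t` at `a = 1`. -/
def geomRatio (a : ℝ) (t : ℕ) : ℝ :=
  if a = 1 then (t : ℝ) else (a ^ t - 1) / (a - 1)

section SpectralNorm

open scoped Matrix.Norms.L2Operator

/-- The spectral norm of a real matrix: its operator norm between Euclidean spaces. -/
def specNorm {p q : ℕ} (A : Matrix (Fin p) (Fin q) ℝ) : ℝ := ‖A‖

end SpectralNorm

/-- The weight matrices of a minimal gated unit network. -/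
structure Weights (dx dh dy : ℕ) where
  Wr : Matrix (Fin dh) (Fin dx) ℝ
  Wh : Matrix (Fin dh) (Fin dx) ℝ
  Ur : Matrix (Fin dh) (Fin dh) ℝ
  Uh : Matrix (Fin dh) (Fin dh) ℝ
  V : Matrix (Fin dy) (Fin dh) ℝ

/-- Upper bounds for the spectral norms of the five weight matrices. -/
structure NormBounds where
  Wr : ℝ
  Wh : ℝ
  Ur : ℝ
  Uh : ℝ
  V : ℝ

variable {dx dh dy : ℕ}

/-- All weight matrices obey their spectral norm bounds. -/
structure Weights.BoundedBy (w : Weights dx dh dy) (B : NormBounds) : Prop where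
  Wr_le : specNorm w.Wr ≤ B.Wr
  Wh_le : specNorm w.Wh ≤ B.Wh
  Ur_le : specNorm w.Ur ≤ B.Ur
  Uh_le : specNorm w.Uh ≤ B.Uh
  V_le : specNorm w.V ≤ B.V

/-- The gate `σ (W_r x + U_r h)` (entrywise sigmoid) at input `x` and previous state `h`. -/
def Weights.gateAt (w : Weights dx dh dy) (x : EuclideanSpace ℝ (Fin dx)) (h : Fin dh → ℝ) :
    Fin dh → ℝ :=
  fun i => Real.sigmoid ((w.Wr *ᵥ x.ofLp + w.Ur *ᵥ h) i)

/-- The candidate state `tanh (W_h x + U_h (r ⊙ h))`; the product `r * h` is entrywise. -/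
def Weights.candidateAt (w : Weights dx dh dy) (x : EuclideanSpace ℝ (Fin dx))
    (r h : Fin dh → ℝ) : Fin dh → ℝ :=
  fun i => Real.tanh ((w.Wh *ᵥ x.ofLp + w.Uh *ᵥ (r * h)) i)

/-- The new state `(1 - r) ⊙ h + r ⊙ h̃`. -/
def Weights.step (w : Weights dx dh dy) (x : EuclideanSpace ℝ (Fin dx)) (h : Fin dh → ℝ) :
    Fin dh → ℝ :=
  (1 - w.gateAt x h) * h + w.gateAt x h * w.candidateAt x (w.gateAt x h) h

/-- The hidden state `h_t` computed from `h_0 = 0` and the first `t` inputs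
`x 0, …, x (t - 1)`. -/
def Weights.hidden (w : Weights dx dh dy) (x : ℕ → EuclideanSpace ℝ (Fin dx)) :
    ℕ → Fin dh → ℝ
  | 0 => 0
  | t + 1 => w.step (x t) (w.hidden x t)

/-- The gate `r_{j+1}`, computed from the input `x j` and the hidden state `h_j`. -/
def Weights.gate (w : Weights dx dh dy) (x : ℕ → EuclideanSpace ℝ (Fin dx)) (j : ℕ) :
    Fin dh → ℝ :=
  w.gateAt (x j) (w.hidden x j)

/-- The `t`-th output `y_t = σ_y (V h_t)`, with `σ_y` applied entrywise. -/
def Weights.output (w : Weights dx dh dy) (σy : ℝ → ℝ) (x : ℕ → EuclideanSpace ℝ (Fin dx))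
    (t : ℕ) : Fin dy → ℝ :=
  fun i => σy ((w.V *ᵥ w.hidden x t) i)

/-- A sequence of `T` pairs (input, label), with labels in `Fin K`. -/
abbrev Sequence (dx K T : ℕ) : Type := Fin T → EuclideanSpace ℝ (Fin dx) × Fin K

variable {K T : ℕ}

/-- The inputs of a sequence, padded by `0` after the last one; the padding is never read by
outputs up to time `T`. -/
def inputs (s : Sequence dx K T) : ℕ → EuclideanSpace ℝ (Fin dx) :=
  fun j => if h : j < T then (s ⟨j, h⟩).1 else 0

/-- The functional margin `y_z - max_{j ≠ z} y_j`. -/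
def margin (y : Fin K → ℝ) (z : Fin K) : ℝ := y z - ⨆ j : {j : Fin K // j ≠ z}, y j

/-- The ramp loss `𝟙{a > 0} + (1 + a / γ) 𝟙{-γ ≤ a ≤ 0}`. -/
def rampLoss (γ a : ℝ) : ℝ :=
  (if 0 < a then 1 else 0) + (if -γ ≤ a ∧ a ≤ 0 then 1 + a / γ else 0)

/-- The empirical ramp risk, over the sample `S`, of the output at the time `τ + 1`. -/
def empRisk {m : ℕ} (w : Weights dx dh K) (σy : ℝ → ℝ) (γ : ℝ) (τ : Fin T)
    (S : Fin m → Sequence dx K T) : ℝ :=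
  (1 / (m : ℝ)) * ∑ i, rampLoss γ (-margin (w.output σy (inputs (S i)) (τ + 1)) (S i τ).2)

/-- The probability, under the law `μ` of a new sequence, that the label predicted at the time
`τ + 1` by the decision rule `φ` is not the true one. -/
def errProb (μ : Measure (Sequence dx K T)) (φ : (Fin K → ℝ) → Fin K) (w : Weights dx dh K)
    (σy : ℝ → ℝ) (τ : Fin T) : ℝ :=
  μ.real {s | φ (w.output σy (inputs s) (τ + 1)) ≠ (s τ).2}

/-- `β` bounds `‖1 - r_j‖_∞ + B_{U_h} ‖r_j‖_∞ ^ 2` for the gates `r_1, …, r_t` of the network, for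
almost every input sequence. The norm on `Fin dh → ℝ` is the sup norm. -/
def GateBound (μ : Measure (Sequence dx K T)) (w : Weights dx dh K) (BUh : ℝ) (t : ℕ)
    (β : ℝ) : Prop :=
  ∀ᵐ s ∂μ, ∀ j < t, ‖1 - w.gate (inputs s) j‖ + BUh * ‖w.gate (inputs s) j‖ ^ 2 ≤ β

/-- The expression inside `O(·)`, with `d = max {d_x, d_y, d_h}` and
`θ = β + 2 B_{U_r} + B_{U_r} B_{U_h}`. -/
def complexity (d : ℕ) (ρ : ℝ) (B : NormBounds) (Bx β γ : ℝ) (t m : ℕ) : ℝ :=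
  (d * ρ * B.V * min (√d) (B.Wh * Bx * geomRatio β t) *
      √(Real.log (geomRatio (β + 2 * B.Ur + B.Ur * B.Uh) t * d * √m))) / (√m * γ)

end MGU

end

/-!
The proof replaces Rademacher complexities and chaining by a finite count. It rests on the ghost
sample: by Chebyshev an independent second sample of size `m` has, with probability at least
`1 / 2`, an empirical mean that is at most `1 / √m` below the expectation; and the difference of
two samples, after random exchanges of their members, is a Rademacher sum with Gaussian tails. So
`uniform_deviation` holds for every class of functions with values in `[0, 1]` which, on any
`2 * m` points, is divided into at most `N` patterns, such that functions with the same pattern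
differ by `O(1 / √m)` on these points; the deviation is of the order of
`√((log N + log (1 / δ)) / m)`.

The pattern of a network (`weightPattern`) is chosen such that `log N` is of the order of `d ^ 2`
times the logarithm of `(θ ^ t - 1) / (θ - 1) * d * m`. It does not depend on the norms of `W_r`
and `W_h`, on `Bx`, or otherwise on `t`:

* For `W_r` and `W_h` it records on which side of the thresholds of a grid the coordinates of
  `W_r x` and `W_h x` lie. For each row these are traces of half-spaces, which are counted by
  Sauer-Shelah (`rangeCardLE_halfPattern`) whatever the norm of the row. Inputs beyond the ends of
  the grid do no harm: there the sigmoid and the hyperbolic tangent are saturated.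
* The sigmoid is Lipschitz in the multiplicative sense, and `σ (log κ + u) ≤ κ * exp u`. Hence,
  with the grid for `W_r x` centred at `log κ`, gates in the same cell differ by at most a
  multiple of `κ` times the mesh, where `κ` is a cap of the gates with `B.Uh * κ ^ 2 ≤ β`
  (`exists_gate_cap`, `abs_gate_sub_le`).
* The entries of `U_r`, `U_h` and `V` are rounded relative to `B.Ur`, `B.Uh` and `B.V`.

One step of the recursion multiplies the distance of two networks with the same pattern by at most
`θ`, and adds an error proportional to the radius `min √d (B.Wh * Bx * (β ^ t - 1) / (β - 1))` of
the hidden states (`l2_step_sub_step_le`). The cells need be recorded for the last `L` steps only,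
where `θ ^ L ≤ 1 / m` or `L = t`; then `L` is at most `m` times the `θ`-geometric sum
(`exists_window`), which is why no `log t` appears.

Uniformity in the margin `γ` and in the gate bound `β` comes next. Let `D` be twice the bound of
the outputs, and hence a bound of the margins. The ramp losses at the margins `γ = D / q` with
`1 ≤ q ≤ √m` form a single class, whose patterns include `q`, rounded. For `q < 1` the ramp loss
is affine on the range of the margins, so `q = 1` suffices; for `q > √m` the bound exceeds `1`.
The bounds `β` are sorted by the integers `(p, n)` above the logarithms of their two geometric
sums. A class of bounds is represented by its greatest member, which changes the geometric sums by
a factor of at most `exp 1`, and receives the confidence `δ * 2 ^ (-(p + n + 2))`; the cost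
`p + n + 2` is of the order of the logarithm in the complexity term. Almost sure bounds on the
gates become bounds on the support of `μ`, since gates are continuous in the inputs
(`goodSequences`). If the outputs vanish identically, the empirical risk is `1` and there is
nothing to prove.
-/

namespace MGU

/-! ### Uniform deviation by symmetrization -/

/-- The Rademacher sign attached to a Boolean. -/
def boolSign (b : Bool) : ℝ := if b then -1 else 1

/-- Hoeffding's inequality for Rademacher sums, in counting form. -/
theorem card_rademacher_tail {m : ℕ} (a : Fin m → ℝ) (ha : ∀ i, |a i| ≤ 1) (v : ℝ) (hv : 0 ≤ v) :
    ((Finset.univ.filter fun ε : Fin m → Bool =>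
      m * v < ∑ i, boolSign (ε i) * a i).card : ℝ) ≤ 2 ^ m * Real.exp (-(m * v ^ 2 / 2)) := by
  have h1 : ((Finset.univ.filter fun ε : Fin m → Bool =>
      m * v < ∑ i, boolSign (ε i) * a i).card : ℝ) ≤
      ∑ ε : Fin m → Bool, Real.exp (v * (∑ i, boolSign (ε i) * a i) - m * v ^ 2) := by
    rw [Finset.card_eq_sum_ones, Nat.cast_sum, Finset.sum_filter]
    refine Finset.sum_le_sum fun ε _ => ?_
    split_ifs with h
    · simp only [Nat.cast_one]
      apply Real.one_le_exp
      nlinarith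
    · exact (Real.exp_pos _).le
  refine h1.trans ?_
  have h2 : ∑ ε : Fin m → Bool, Real.exp (v * (∑ i, boolSign (ε i) * a i) - m * v ^ 2) =
      Real.exp (-(m * v ^ 2)) * ∏ i, ∑ b : Bool, Real.exp (v * (boolSign b * a i)) := by
    rw [Finset.prod_univ_sum, Fintype.piFinset_univ, Finset.mul_sum]
    refine Finset.sum_congr rfl fun ε _ => ?_
    rw [← Real.exp_sum, ← Real.exp_add, Finset.mul_sum]
    congr 1
    ring
  have h3 : ∏ i, ∑ b : Bool, Real.exp (v * (boolSign b * a i)) ≤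
      ∏ _i : Fin m, 2 * Real.exp (v ^ 2 / 2) := by
    refine Finset.prod_le_prod (fun i _ => Finset.sum_nonneg fun b _ => (Real.exp_pos _).le)
      fun i _ => ?_
    have h4 : ∑ b : Bool, Real.exp (v * (boolSign b * a i)) = 2 * Real.cosh (v * a i) := by
      rw [Fintype.sum_bool, Real.cosh_eq]
      simp only [boolSign]
      norm_num
      ring
    rw [h4]
    refine mul_le_mul_of_nonneg_left ((Real.cosh_le_exp_half_sq _).trans ?_) (by norm_num)
    apply Real.exp_le_exp.2
    have : a i ^ 2 ≤ 1 := by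
      rw [← sq_abs]
      exact pow_le_one₀ (abs_nonneg _) (ha i)
    nlinarith [sq_nonneg v]
  rw [h2]
  refine (mul_le_mul_of_nonneg_left h3 (Real.exp_pos _).le).trans (le_of_eq ?_)
  rw [Finset.prod_const, Finset.card_univ, Fintype.card_fin, mul_pow, ← Real.exp_nat_mul,
    mul_left_comm, ← Real.exp_add]
  congr 2
  ring

/-- The map that exchanges the two members of a pair when `b` is true. -/
def swapIf {Z : Type*} (b : Bool) (p : Z × Z) : Z × Z := if b then p.swap else p

theorem measurePreserving_swapIf {Z : Type*} [MeasurableSpace Z] (μ : Measure Z) [SFinite μ]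
    (b : Bool) : MeasurePreserving (swapIf b) (μ.prod μ) (μ.prod μ) := by
  cases b
  · exact MeasurePreserving.id _
  · exact Measure.measurePreserving_swap

theorem sub_swapIf {Z : Type*} (g : Z → ℝ) (b : Bool) (p : Z × Z) :
    g (swapIf b p).2 - g (swapIf b p).1 = boolSign b * (g p.2 - g p.1) := by
  cases b <;> simp [swapIf, boolSign]

section Deviation

variable {Z Θ : Type*}

/-- A family of functions on `Z` has at most `N` patterns at scale `ε` on `m` pairs of points of
`Z₀`: on these points its members are, up to `ε`, functions of a parameter that takes at most `N`
values. -/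
def HasPatterns (f : Θ → Z → ℝ) (Z₀ : Set Z) (m N : ℕ) (ε : ℝ) : Prop :=
  ∀ ω : Fin m → Z × Z, (∀ i, (ω i).1 ∈ Z₀ ∧ (ω i).2 ∈ Z₀) →
    ∃ (α : Type) (π : Θ → α) (F : Finset α), F.card ≤ N ∧ (∀ θ, π θ ∈ F) ∧
      ∀ θ θ', π θ = π θ' → ∀ i, |f θ (ω i).1 - f θ' (ω i).1| ≤ ε ∧
        |f θ (ω i).2 - f θ' (ω i).2| ≤ ε

theorem card_bad_swaps {f : Θ → Z → ℝ} {Z₀ : Set Z} {m N : ℕ} {ε : ℝ}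
    (hcov : HasPatterns f Z₀ m N ε) (h01 : ∀ θ z, f θ z ∈ Set.Icc (0 : ℝ) 1) (v : ℝ) (hv : 0 ≤ v)
    (ω : Fin m → Z × Z) (hω : ∀ i, (ω i).1 ∈ Z₀ ∧ (ω i).2 ∈ Z₀) :
    (Nat.card {s : Fin m → Bool // ∃ θ, m * (v + 2 * ε) <
      ∑ i, boolSign (s i) * (f θ (ω i).2 - f θ (ω i).1)} : ℝ) ≤
      N * (2 ^ m * Real.exp (-(m * v ^ 2 / 2))) := by
  classical
  obtain ⟨α, π, F, hF, hπ, hclose⟩ := hcov ω hω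
  let T : α → Finset (Fin m → Bool) := fun a =>
    if h : ∃ θ, π θ = a then
      Finset.univ.filter fun s => m * v <
        ∑ i, boolSign (s i) * (f h.choose (ω i).2 - f h.choose (ω i).1)
    else ∅
  have hT : ∀ a, ((T a).card : ℝ) ≤ 2 ^ m * Real.exp (-(m * v ^ 2 / 2)) := by
    intro a
    by_cases h : ∃ θ, π θ = a
    · simp only [T, h, dif_pos]
      refine card_rademacher_tail (fun i => f h.choose (ω i).2 - f h.choose (ω i).1)
        (fun i => ?_) v hv
      have h1 := h01 h.choose (ω i).1
      have h2 := h01 h.choose (ω i).2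
      rw [abs_le]
      constructor <;> linarith [h1.1, h1.2, h2.1, h2.2]
    · simp only [T, h, dif_neg, not_false_eq_true, Finset.card_empty, Nat.cast_zero]
      positivity
  rw [Nat.card_eq_fintype_card, Fintype.card_subtype]
  have hsub : (Finset.univ.filter fun s : Fin m → Bool => ∃ θ, m * (v + 2 * ε) <
      ∑ i, boolSign (s i) * (f θ (ω i).2 - f θ (ω i).1)) ⊆ F.biUnion T := by
    intro s hs
    obtain ⟨θ, hθ⟩ := (Finset.mem_filter.1 hs).2
    refine Finset.mem_biUnion.2 ⟨π θ, hπ θ, ?_⟩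
    have h : ∃ θ', π θ' = π θ := ⟨θ, rfl⟩
    simp only [T, h, dif_pos]
    refine Finset.mem_filter.2 ⟨Finset.mem_univ _, ?_⟩
    have hc := hclose _ _ h.choose_spec
    have : ∑ i, boolSign (s i) * (f θ (ω i).2 - f θ (ω i).1) ≤
        ∑ i, (boolSign (s i) * (f h.choose (ω i).2 - f h.choose (ω i).1) + 2 * ε) := by
      refine Finset.sum_le_sum fun i _ => ?_
      have h1 := abs_le.1 (hc i).1
      have h2 := abs_le.1 (hc i).2
      cases s i <;> simp only [boolSign] <;> norm_num <;> linarith [h1.1, h1.2, h2.1, h2.2]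
    rw [Finset.sum_add_distrib, Finset.sum_const, Finset.card_univ, Fintype.card_fin,
      nsmul_eq_mul] at this
    linarith
  calc ((Finset.univ.filter fun s : Fin m → Bool => ∃ θ, m * (v + 2 * ε) <
      ∑ i, boolSign (s i) * (f θ (ω i).2 - f θ (ω i).1)).card : ℝ)
      ≤ (F.biUnion T).card := by exact_mod_cast Finset.card_le_card hsub
    _ ≤ ∑ a ∈ F, ((T a).card : ℝ) := by exact_mod_cast Finset.card_biUnion_le
    _ ≤ ∑ _a ∈ F, (2 ^ m * Real.exp (-(m * v ^ 2 / 2))) := Finset.sum_le_sum fun a _ => hT a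
    _ = F.card * (2 ^ m * Real.exp (-(m * v ^ 2 / 2))) := by rw [Finset.sum_const, nsmul_eq_mul]
    _ ≤ _ := by gcongr

variable [MeasurableSpace Z] [TopologicalSpace Θ]
  [TopologicalSpace.SeparableSpace Θ]

/-- An event of the form "some `θ` exceeds a fixed threshold" is measurable, since by continuity
in `θ` the union may be taken over a countable dense set. -/
theorem measurableSet_exists_lt {Ω : Type*} [MeasurableSpace Ω] (F : Θ → Ω → ℝ)
    (hmeas : ∀ θ, Measurable (F θ)) (hcont : ∀ ω, Continuous fun θ => F θ ω) (c : ℝ) :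
    MeasurableSet {ω | ∃ θ, c < F θ ω} := by
  obtain ⟨D, hDc, hD⟩ := TopologicalSpace.exists_countable_dense Θ
  have : {ω | ∃ θ, c < F θ ω} = ⋃ θ ∈ D, {ω | c < F θ ω} := by
    ext ω
    simp only [Set.mem_ofPred_eq, Set.mem_iUnion, exists_prop]
    constructor
    · rintro ⟨θ, hθ⟩
      have hopen : IsOpen {θ | c < F θ ω} := isOpen_lt continuous_const (hcont ω)
      obtain ⟨θ', h1, h2⟩ := hD.exists_mem_open hopen ⟨θ, hθ⟩
      exact ⟨θ', h1, h2⟩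
    · rintro ⟨θ, -, hθ⟩
      exact ⟨θ, hθ⟩
  rw [this]
  exact MeasurableSet.biUnion hDc fun θ _ => measurableSet_lt measurable_const (hmeas θ)

theorem measure_pair_deviation_le {f : Θ → Z → ℝ} {Z₀ : Set Z} {m N : ℕ} {ε : ℝ}
    (μ : Measure Z) [IsProbabilityMeasure μ]
    (hcov : HasPatterns f Z₀ m N ε) (h01 : ∀ θ z, f θ z ∈ Set.Icc (0 : ℝ) 1)
    (hmeas : ∀ θ, Measurable (f θ)) (hcont : ∀ z, Continuous fun θ => f θ z)
    (hZ₀ : ∀ᵐ z ∂μ, z ∈ Z₀) (v : ℝ) (hv : 0 ≤ v) :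
    Measure.pi (fun _ : Fin m => μ.prod μ)
      {ω | ∃ θ, m * (v + 2 * ε) < ∑ i, (f θ (ω i).2 - f θ (ω i).1)} ≤
      ENNReal.ofReal (N * Real.exp (-(m * v ^ 2 / 2))) := by
  classical
  set ν := Measure.pi (fun _ : Fin m => μ.prod μ) with hν
  set B : Set (Fin m → Z × Z) :=
    {ω | ∃ θ, m * (v + 2 * ε) < ∑ i, (f θ (ω i).2 - f θ (ω i).1)} with hB
  have hBm : MeasurableSet B := by
    refine measurableSet_exists_lt (fun θ (ω : Fin m → Z × Z) => ∑ i, (f θ (ω i).2 - f θ (ω i).1))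
      (fun θ => ?_) (fun ω => ?_) _
    · refine Finset.measurable_sum _ fun i _ => ?_
      exact ((hmeas θ).comp (measurable_snd.comp (measurable_pi_apply i))).sub
        ((hmeas θ).comp (measurable_fst.comp (measurable_pi_apply i)))
    · exact continuous_finsetSum _ fun i _ => (hcont _).sub (hcont _)
  let Φ : (Fin m → Bool) → (Fin m → Z × Z) → (Fin m → Z × Z) := fun s ω i => swapIf (s i) (ω i)
  have hΦ : ∀ s, MeasurePreserving (Φ s) ν ν := fun s =>
    measurePreserving_pi _ _ fun i => measurePreserving_swapIf μ (s i)
  have hae : ∀ᵐ ω ∂ν, ∀ i, (ω i).1 ∈ Z₀ ∧ (ω i).2 ∈ Z₀ := by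
    rw [ae_all_iff]
    intro i
    have h1 : ∀ᵐ p ∂(μ.prod μ), p.1 ∈ Z₀ ∧ p.2 ∈ Z₀ :=
      (Measure.quasiMeasurePreserving_fst.ae hZ₀).and (Measure.quasiMeasurePreserving_snd.ae hZ₀)
    exact (measurePreserving_eval (fun _ : Fin m => μ.prod μ) i).quasiMeasurePreserving.ae h1
  have hpt : ∀ᵐ ω ∂ν, ∑ s, B.indicator (1 : (Fin m → Z × Z) → ℝ≥0∞) (Φ s ω) ≤
      ENNReal.ofReal (N * (2 ^ m * Real.exp (-(m * v ^ 2 / 2)))) := by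
    filter_upwards [hae] with ω hω
    have h := card_bad_swaps hcov h01 v hv ω hω
    have heq : ∑ s, B.indicator (1 : (Fin m → Z × Z) → ℝ≥0∞) (Φ s ω) =
        (Nat.card {s : Fin m → Bool // ∃ θ, m * (v + 2 * ε) <
          ∑ i, boolSign (s i) * (f θ (ω i).2 - f θ (ω i).1)} : ℝ≥0∞) := by
      rw [Nat.card_eq_fintype_card, Fintype.card_subtype, Finset.card_eq_sum_ones,
        Finset.sum_filter, Nat.cast_sum]
      refine Finset.sum_congr rfl fun s _ => ?_
      simp only [Set.indicator_apply, hB, Set.mem_ofPred_eq, Φ, sub_swapIf, Pi.one_apply]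
      split_ifs <;> simp
    rw [heq]
    rw [← ENNReal.ofReal_natCast]
    exact ENNReal.ofReal_le_ofReal h
  have hsum : (2 ^ m : ℝ≥0∞) * ν B =
      ∫⁻ ω, ∑ s, B.indicator (1 : (Fin m → Z × Z) → ℝ≥0∞) (Φ s ω) ∂ν := by
    rw [lintegral_finsetSum]
    · have : ∀ s, ∫⁻ ω, B.indicator (1 : (Fin m → Z × Z) → ℝ≥0∞) (Φ s ω) ∂ν = ν B := by
        intro s
        rw [(hΦ s).lintegral_comp (measurable_one.indicator hBm), lintegral_indicator_one hBm]
      simp [this]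
    · intro s _
      exact (measurable_one.indicator hBm).comp (hΦ s).measurable
  have hfin : (2 ^ m : ℝ≥0∞) * ν B ≤
      (2 ^ m : ℝ≥0∞) * ENNReal.ofReal (N * Real.exp (-(m * v ^ 2 / 2))) := by
    rw [hsum]
    refine (lintegral_mono_ae hpt).trans (le_of_eq ?_)
    rw [lintegral_const, measure_univ, mul_one]
    have : (2 ^ m : ℝ≥0∞) = ENNReal.ofReal (2 ^ m) := by
      rw [ENNReal.ofReal_pow (by norm_num)]
      norm_num
    rw [this, ← ENNReal.ofReal_mul (by positivity)]
    congr 1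
    ring
  have h2 : (2 ^ m : ℝ≥0∞) ≠ 0 := by positivity
  have h3 : (2 ^ m : ℝ≥0∞) ≠ ⊤ := by finiteness
  exact (ENNReal.mul_le_mul_iff_right h2 h3).1 hfin

/-- By Chebyshev, the empirical mean of a function with values in `[0, 1]` falls below its
expectation by at most `1 / √m` with probability at least `1 / 2`. -/
theorem half_le_measure_empirical {m : ℕ} (hm : 0 < m) (μ : Measure Z) [IsProbabilityMeasure μ]
    (g : Z → ℝ) (hg : Measurable g) (h01 : ∀ z, g z ∈ Set.Icc (0 : ℝ) 1) :
    1 / 2 ≤ Measure.pi (fun _ : Fin m => μ)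
      {S | m * ∫ z, g z ∂μ - √m ≤ ∑ i, g (S i)} := by
  set ν := Measure.pi (fun _ : Fin m => μ) with hν
  let X : Fin m → (Fin m → Z) → ℝ := fun i S => g (S i)
  have hLp : MemLp g 2 μ := by
    refine MemLp.of_bound hg.aestronglyMeasurable 1 (ae_of_all _ fun z => ?_)
    rw [Real.norm_eq_abs, abs_of_nonneg (h01 z).1]
    exact (h01 z).2
  have hev : ∀ i : Fin m, MeasurePreserving (Function.eval i) ν μ := fun i =>
    measurePreserving_eval (fun _ : Fin m => μ) i
  have hXLp : ∀ i, MemLp (X i) 2 ν := fun i => hLp.comp_measurePreserving (hev i)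
  have hind : ProbabilityTheory.iIndepFun X ν :=
    ProbabilityTheory.iIndepFun_pi (fun i => hg.aemeasurable)
  have hvar : ProbabilityTheory.variance (∑ i, X i) ν ≤ m / 4 := by
    rw [ProbabilityTheory.IndepFun.variance_sum (fun i _ => hXLp i)
      (fun i _ j _ hij => hind.indepFun hij)]
    calc ∑ i, ProbabilityTheory.variance (X i) ν ≤ ∑ _i : Fin m, ((1 - 0) / 2 : ℝ) ^ 2 := by
          refine Finset.sum_le_sum fun i _ => ?_
          exact ProbabilityTheory.variance_le_sq_of_bounded
            (ae_of_all _ fun S => h01 (S i)) (hXLp i).aemeasurable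
      _ = m / 4 := by
          rw [Finset.sum_const, Finset.card_univ, Fintype.card_fin, nsmul_eq_mul]
          ring
  have hmean : ∫ S, (∑ i, X i) S ∂ν = m * ∫ z, g z ∂μ := by
    simp only [Finset.sum_apply]
    rw [integral_finsetSum _ fun i _ => (hXLp i).integrable (by norm_num)]
    have : ∀ i, ∫ S, X i S ∂ν = ∫ z, g z ∂μ := by
      intro i
      have := (hev i).map_eq
      conv_rhs => rw [← this]
      rw [integral_map (hev i).measurable.aemeasurable hg.aestronglyMeasurable]
    simp [this]
  have hsqrt : 0 < √(m : ℝ) := Real.sqrt_pos.2 (by exact_mod_cast hm)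
  have hXs : MemLp (∑ i, X i) 2 ν := memLp_finsetSum' _ fun i _ => hXLp i
  have hcheb := ProbabilityTheory.meas_ge_le_variance_div_sq hXs hsqrt
  have hle : ν {S | √(m : ℝ) ≤ |(∑ i, X i) S - ∫ S, (∑ i, X i) S ∂ν|} ≤ 1 / 2 := by
    refine hcheb.trans ?_
    have : (1 / 2 : ℝ≥0∞) = ENNReal.ofReal (1 / 2) := by
      rw [ENNReal.ofReal_div_of_pos (by norm_num)]
      norm_num
    rw [this]
    apply ENNReal.ofReal_le_ofReal
    rw [Real.sq_sqrt (by positivity), div_le_iff₀ (by exact_mod_cast hm)]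
    have : (0 : ℝ) < m := by exact_mod_cast hm
    linarith
  have hmeasS : Measurable fun S : Fin m → Z => ∑ i, g (S i) :=
    Finset.measurable_sum _ fun i _ => hg.comp (measurable_pi_apply i)
  have hset : MeasurableSet {S : Fin m → Z | m * ∫ z, g z ∂μ - √m ≤ ∑ i, g (S i)} :=
    measurableSet_le measurable_const hmeasS
  have hcompl : ν {S : Fin m → Z | m * ∫ z, g z ∂μ - √m ≤ ∑ i, g (S i)}ᶜ ≤ 1 / 2 := by
    refine (measure_mono fun S hS => ?_).trans hle
    simp only [Set.mem_compl_iff, Set.mem_ofPred_eq, not_le] at hS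
    rw [Set.mem_ofPred_eq, hmean, abs_sub_comm]
    simp only [Finset.sum_apply, X]
    refine le_trans ?_ (le_abs_self _)
    linarith
  rw [prob_compl_eq_one_sub hset] at hcompl
  have h1 := tsub_le_iff_right.1 hcompl
  have h2 : (1 / 2 : ℝ≥0∞) + 1 / 2 ≤
      1 / 2 + ν {S : Fin m → Z | m * ∫ z, g z ∂μ - √m ≤ ∑ i, g (S i)} := by
    rwa [ENNReal.add_halves]
  exact (ENNReal.add_le_add_iff_left (by simp)).1 h2

/-- Uniform one-sided deviation inequality for a class with few patterns. The factor `2` and the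
term `√m` are the price of the ghost sample, the term `2 * ε` that of the patterns. -/
theorem uniform_deviation {f : Θ → Z → ℝ} {Z₀ : Set Z} {m N : ℕ} {ε : ℝ} (hm : 0 < m)
    (μ : Measure Z) [IsProbabilityMeasure μ]
    (hcov : HasPatterns f Z₀ m N ε) (h01 : ∀ θ z, f θ z ∈ Set.Icc (0 : ℝ) 1)
    (hmeas : ∀ θ, Measurable (f θ)) (hcont : ∀ z, Continuous fun θ => f θ z)
    (hZ₀ : ∀ᵐ z ∂μ, z ∈ Z₀) (v : ℝ) (hv : 0 ≤ v) :
    Measure.pi (fun _ : Fin m => μ)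
      {S | ∃ θ, ∑ i, f θ (S i) + (√m + m * (v + 2 * ε)) < m * ∫ z, f θ z ∂μ} ≤
      ENNReal.ofReal (2 * (N * Real.exp (-(m * v ^ 2 / 2)))) := by
  set P := Measure.pi (fun _ : Fin m => μ) with hP
  set B : Set ((Fin m → Z) × (Fin m → Z)) :=
    {ω | ∃ θ, m * (v + 2 * ε) < ∑ i, (f θ (ω.2 i) - f θ (ω.1 i))} with hB
  have hBm : MeasurableSet B := by
    refine measurableSet_exists_lt
      (fun θ (ω : (Fin m → Z) × (Fin m → Z)) => ∑ i, (f θ (ω.2 i) - f θ (ω.1 i)))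
      (fun θ => ?_) (fun ω => ?_) _
    · refine Finset.measurable_sum _ fun i _ => ?_
      exact ((hmeas θ).comp ((measurable_pi_apply i).comp measurable_snd)).sub
        ((hmeas θ).comp ((measurable_pi_apply i).comp measurable_fst))
    · exact continuous_finsetSum _ fun i _ => (hcont _).sub (hcont _)
  have hPB : (P.prod P) B ≤ ENNReal.ofReal (N * Real.exp (-(m * v ^ 2 / 2))) := by
    have hmp := measurePreserving_arrowProdEquivProdArrow Z Z (Fin m)
      (fun _ => μ) (fun _ => μ)
    rw [← hmp.measure_preimage hBm.nullMeasurableSet]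
    exact measure_pair_deviation_le μ hcov h01 hmeas hcont hZ₀ v hv
  have hsub : {S | ∃ θ, ∑ i, f θ (S i) + (√m + m * (v + 2 * ε)) < m * ∫ z, f θ z ∂μ} ⊆
      {S | (1 / 2 : ℝ≥0∞) ≤ P (Prod.mk S ⁻¹' B)} := by
    rintro S ⟨θ, hθ⟩
    refine (half_le_measure_empirical hm μ (f θ) (hmeas θ) (h01 θ)).trans
      (measure_mono fun S' hS' => ⟨θ, ?_⟩)
    simp only [Set.mem_ofPred_eq] at hS'
    rw [Finset.sum_sub_distrib]
    linarith
  refine (measure_mono hsub).trans ?_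
  have hmark := mul_meas_ge_le_lintegral (μ := P) (measurable_measure_prodMk_left (ν := P) hBm)
    (1 / 2)
  rw [← Measure.prod_apply hBm] at hmark
  have : P {S | (1 / 2 : ℝ≥0∞) ≤ P (Prod.mk S ⁻¹' B)} ≤ 2 * (P.prod P) B := by
    calc P {S | (1 / 2 : ℝ≥0∞) ≤ P (Prod.mk S ⁻¹' B)}
        = 2 * (1 / 2 * P {S | (1 / 2 : ℝ≥0∞) ≤ P (Prod.mk S ⁻¹' B)}) := by
          rw [← mul_assoc, one_div, ENNReal.mul_inv_cancel (by norm_num) (by norm_num), one_mul]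
      _ ≤ _ := by gcongr
  refine this.trans ?_
  rw [ENNReal.ofReal_mul (by norm_num)]
  simp only [ENNReal.ofReal_ofNat]
  gcongr

end Deviation

/-! ### Counting half-space patterns -/

/-- The set of those points `x p` that lie in the half-space `{x | c p ≤ ⟨w, x⟩}`. -/
noncomputable def halfPattern {n : ℕ} {ι : Type*} [Fintype ι] (x : ι → Fin n → ℝ) (c : ι → ℝ)
    (w : Fin n → ℝ) : Finset ι := by
  classical exact Finset.univ.filter fun p => c p ≤ w ⬝ᵥ x p

theorem mem_halfPattern {n : ℕ} {ι : Type*} [Fintype ι] {x : ι → Fin n → ℝ} {c : ι → ℝ}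
    {w : Fin n → ℝ} {p : ι} : p ∈ halfPattern x c w ↔ c p ≤ w ⬝ᵥ x p := by
  simp [halfPattern]

theorem sum_choose_le_pow (P D : ℕ) : ∑ k ∈ Finset.Iic D, P.choose k ≤ (P + 1) ^ D := by
  have hI : Finset.Iic D = Finset.range (D + 1) := by
    ext k
    simp
  rw [add_pow, hI]
  refine Finset.sum_le_sum fun k hk => ?_
  rw [one_pow, mul_one]
  have h1 : P.choose k ≤ P ^ k := Nat.choose_le_pow P k
  have h2 : 1 ≤ D.choose k := Nat.choose_pos (Nat.lt_succ_iff.1 (Finset.mem_range.1 hk))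
  calc P.choose k ≤ P ^ k * 1 := by simpa using h1
    _ ≤ P ^ k * D.choose k := Nat.mul_le_mul_left _ h2

/-- Half-spaces with prescribed thresholds shatter no set of more than `n + 1` points: a linear
relation between the vectors `(x p, c p)` excludes one of the traces. -/
theorem card_le_of_shatters_halfPattern {n : ℕ} {ι : Type*} [Fintype ι] [DecidableEq ι]
    (x : ι → Fin n → ℝ) (c : ι → ℝ) (𝒜 : Finset (Finset ι))
    (h𝒜 : ∀ s ∈ 𝒜, ∃ w, halfPattern x c w = s) (s : Finset ι) (hs : 𝒜.Shatters s) :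
    s.card ≤ n + 1 := by
  by_contra hcard
  push Not at hcard
  let y : s → (Fin n → ℝ) × ℝ := fun p => (x p, c p)
  have hdep : ¬ LinearIndependent ℝ y := by
    intro hli
    have := hli.fintype_card_le_finrank
    simp at this
    omega
  obtain ⟨g₀, hg₀, i₀, hi₀⟩ := Fintype.not_linearIndependent_iff.1 hdep
  obtain ⟨g, hg, i, hi⟩ : ∃ g : s → ℝ, ∑ p, g p • y p = 0 ∧ ∃ i, g i < 0 := by
    rcases lt_or_gt_of_ne hi₀ with h | h
    · exact ⟨g₀, hg₀, i₀, h⟩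
    · refine ⟨-g₀, ?_, i₀, by simpa using h⟩
      simpa using hg₀
  let t : Finset ι := (Finset.univ.filter fun p : s => 0 < g p).map (Function.Embedding.subtype _)
  have hts : t ⊆ s := by
    intro p hp
    obtain ⟨q, -, rfl⟩ := Finset.mem_map.1 hp
    exact q.2
  obtain ⟨u, hu, hut⟩ := hs hts
  obtain ⟨w, rfl⟩ := h𝒜 u hu
  have hmem : ∀ p : s, c p ≤ w ⬝ᵥ x p ↔ 0 < g p := by
    intro p
    have h1 : (p : ι) ∈ s ∩ halfPattern x c w ↔ (p : ι) ∈ t := by rw [hut]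
    rw [Finset.mem_inter, mem_halfPattern] at h1
    simp only [p.2, true_and] at h1
    rw [h1]
    simp [t]
  have hrel : ∑ p, g p * (w ⬝ᵥ x p - c p) = 0 := by
    have h1 : ∑ p, g p • x p = 0 := by
      have := congrArg Prod.fst hg
      simpa [Prod.fst_sum, y] using this
    have h2 : ∑ p, g p * c p = 0 := by
      have := congrArg Prod.snd hg
      simpa [Prod.snd_sum, y] using this
    have h3 : ∑ p, g p * (w ⬝ᵥ x p) = 0 := by
      have := congrArg (fun v => w ⬝ᵥ v) h1
      simpa [dotProduct_sum, dotProduct_smul] using this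
    simp only [mul_sub, Finset.sum_sub_distrib, h2, h3, sub_zero]
  have hpos : 0 < ∑ p, g p * (w ⬝ᵥ x p - c p) := by
    refine Finset.sum_pos' (fun p _ => ?_) ⟨i, Finset.mem_univ _, ?_⟩
    · by_cases hp : 0 < g p
      · exact mul_nonneg hp.le (sub_nonneg.2 ((hmem p).2 hp))
      · have := (not_congr (hmem p)).2 hp
        exact mul_nonneg_of_nonpos_of_nonpos (not_lt.1 hp) (by linarith)
    · have := (not_congr (hmem i)).2 hi.not_gt
      exact mul_pos_of_neg_of_neg hi (by linarith)
  linarith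

/-- A map has at most `N` values. -/
def RangeCardLE {Θ α : Type*} (π : Θ → α) (N : ℕ) : Prop :=
  ∃ F : Finset α, F.card ≤ N ∧ ∀ θ, π θ ∈ F

theorem RangeCardLE.comp {Θ Θ' α : Type*} {π : Θ → α} {N : ℕ} (h : RangeCardLE π N)
    (g : Θ' → Θ) : RangeCardLE (fun θ => π (g θ)) N :=
  let ⟨F, hF, hm⟩ := h
  ⟨F, hF, fun θ => hm (g θ)⟩

theorem RangeCardLE.prodMk {Θ α β : Type*} {π : Θ → α} {ρ : Θ → β} {N M : ℕ}
    (h : RangeCardLE π N) (h' : RangeCardLE ρ M) :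
    RangeCardLE (fun θ => (π θ, ρ θ)) (N * M) := by
  obtain ⟨F, hF, hm⟩ := h
  obtain ⟨F', hF', hm'⟩ := h'
  refine ⟨F ×ˢ F', ?_, fun θ => Finset.mk_mem_product (hm θ) (hm' θ)⟩
  rw [Finset.card_product]
  exact Nat.mul_le_mul hF hF'

theorem RangeCardLE.pi {Θ ι α : Type*} [Fintype ι] {π : ι → Θ → α} {N : ℕ}
    (h : ∀ i, RangeCardLE (π i) N) :
    RangeCardLE (fun θ i => π i θ) (N ^ Fintype.card ι) := by
  classical
  choose F hF hm using h
  refine ⟨Fintype.piFinset F, ?_, fun θ => Fintype.mem_piFinset.2 fun i => hm i θ⟩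
  rw [Fintype.card_piFinset]
  exact Finset.prod_le_pow_card _ _ _ fun i _ => hF i

theorem rangeCardLE_halfPattern {n : ℕ} {ι : Type*} [Fintype ι] (x : ι → Fin n → ℝ)
    (c : ι → ℝ) : RangeCardLE (halfPattern x c) ((Fintype.card ι + 1) ^ (n + 1)) := by
  classical
  let 𝒜 : Finset (Finset ι) := Finset.univ.filter fun s => ∃ w, halfPattern x c w = s
  refine ⟨𝒜, ?_, fun w => by simp [𝒜]⟩
  have hvc : 𝒜.vcDim ≤ n + 1 := by
    refine Finset.sup_le fun s hs => ?_
    exact card_le_of_shatters_halfPattern x c 𝒜 (fun s hs => (Finset.mem_filter.1 hs).2) s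
      (Finset.mem_shatterer.1 hs)
  calc 𝒜.card ≤ 𝒜.shatterer.card := 𝒜.card_le_card_shatterer
    _ ≤ ∑ k ∈ Finset.Iic 𝒜.vcDim, (Fintype.card ι).choose k := Finset.card_shatterer_le_sum_vcDim
    _ ≤ (Fintype.card ι + 1) ^ 𝒜.vcDim := sum_choose_le_pow _ _
    _ ≤ _ := Nat.pow_le_pow_right (Nat.succ_pos _) hvc

/-- The numbers of `[-b, b]`, rounded down to multiples of `b / n`, take at most `2 * n + 1`
values. For `b = 0` the quotient is `0`. -/
theorem rangeCardLE_floor {Θ : Type*} (g : Θ → ℝ) (b : ℝ) (n : ℕ) (hg : ∀ θ, |g θ| ≤ b) :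
    RangeCardLE (fun θ => ⌊g θ / b * n⌋) (2 * n + 1) := by
  refine ⟨Finset.Icc (-n : ℤ) n, ?_, fun θ => ?_⟩
  · rw [Int.card_Icc]
    omega
  · have h1 : |g θ / b| ≤ 1 := by
      rw [abs_div]
      exact div_le_one_of_le₀ ((hg θ).trans (le_abs_self b)) (abs_nonneg _)
    rw [abs_le] at h1
    have hn : (0 : ℝ) ≤ n := Nat.cast_nonneg n
    rw [Finset.mem_Icc]
    constructor
    · rw [Int.le_floor]
      push_cast
      nlinarith
    · have : (⌊g θ / b * n⌋ : ℝ) ≤ n := (Int.floor_le _).trans (by nlinarith)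
      exact_mod_cast this

theorem abs_sub_le_of_floor_eq {u u' b : ℝ} {n : ℕ} (hn : 0 < n) (hu : |u| ≤ b) (hu' : |u'| ≤ b)
    (h : ⌊u / b * n⌋ = ⌊u' / b * n⌋) : |u - u'| ≤ b / n := by
  have hb : 0 ≤ b := (abs_nonneg u).trans hu
  have hn' : (0 : ℝ) < n := by exact_mod_cast hn
  rcases hb.eq_or_lt with rfl | hb
  · rw [abs_nonpos_iff.1 hu, abs_nonpos_iff.1 hu']
    simp
  · have h1 := (Int.abs_sub_lt_one_of_floor_eq_floor h).le
    have h2 : u / b * n - u' / b * n = (u - u') * (n / b) := by ring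
    rw [h2, abs_mul, abs_of_pos (by positivity : 0 < (n : ℝ) / b)] at h1
    rw [le_div_iff₀ hn']
    rw [mul_div_assoc', div_le_one hb] at h1
    exact h1

/-! ### Activation functions and threshold cells -/

theorem abs_sigmoid_sub_le (a b : ℝ) : |Real.sigmoid a - Real.sigmoid b| ≤ 1 / 4 * |a - b| := by
  have h := Convex.norm_image_sub_le_of_norm_deriv_le (f := Real.sigmoid) (s := Set.univ)
    (C := 1 / 4) (fun x _ => differentiableAt_sigmoid) (fun x _ => ?_) convex_univ
    (Set.mem_univ b) (Set.mem_univ a)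
  · simpa using h
  · rw [Real.deriv_sigmoid]
    have h0 := Real.sigmoid_pos x
    have h1 := Real.sigmoid_lt_one x
    rw [Real.norm_eq_abs, abs_of_nonneg (mul_nonneg h0.le (by linarith))]
    nlinarith [sq_nonneg (Real.sigmoid x - 1 / 2)]

theorem tanh_eq_sigmoid (x : ℝ) : Real.tanh x = 2 * Real.sigmoid (2 * x) - 1 := by
  rw [Real.tanh_eq, Real.sigmoid_def]
  have h : Real.exp (-(2 * x)) = Real.exp (-x) / Real.exp x := by
    rw [← Real.exp_sub]
    ring_nf
  rw [h]
  have := Real.exp_pos x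
  have := Real.exp_pos (-x)
  field_simp
  ring

theorem abs_tanh_sub_le (a b : ℝ) : |Real.tanh a - Real.tanh b| ≤ |a - b| := by
  rw [tanh_eq_sigmoid, tanh_eq_sigmoid]
  have h := abs_sigmoid_sub_le (2 * a) (2 * b)
  have h1 : 2 * Real.sigmoid (2 * a) - 1 - (2 * Real.sigmoid (2 * b) - 1) =
      2 * (Real.sigmoid (2 * a) - Real.sigmoid (2 * b)) := by ring
  have h2 : 2 * a - 2 * b = 2 * (a - b) := by ring
  rw [h2, abs_mul, abs_two] at h
  rw [h1, abs_mul, abs_two]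
  linarith

theorem abs_tanh_le (a : ℝ) : |Real.tanh a| ≤ |a| := by
  simpa using abs_tanh_sub_le a 0

theorem sigmoid_le_exp (x : ℝ) : Real.sigmoid x ≤ Real.exp x := by
  rw [Real.sigmoid_def, inv_le_comm₀ (by positivity) (Real.exp_pos x), ← Real.exp_neg]
  linarith

theorem one_sub_sigmoid_le_exp (x : ℝ) : 1 - Real.sigmoid x ≤ Real.exp (-x) := by
  rw [← Real.sigmoid_neg]
  exact sigmoid_le_exp _

theorem sigmoid_le_exp_mul (a b : ℝ) :
    Real.sigmoid a ≤ Real.exp |a - b| * Real.sigmoid b := by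
  have h1 : 1 ≤ Real.exp |a - b| := Real.one_le_exp (abs_nonneg _)
  rw [Real.sigmoid_def, Real.sigmoid_def, ← div_eq_mul_inv, le_div_iff₀ (by positivity),
    inv_mul_le_iff₀ (by positivity)]
  have h2 : Real.exp (-b) ≤ Real.exp (-a) * Real.exp |a - b| := by
    rw [← Real.exp_add]
    apply Real.exp_le_exp.2
    linarith [le_abs_self (a - b)]
  linarith

/-- The sigmoid is Lipschitz in the multiplicative sense. -/
theorem abs_sigmoid_sub_le_mul {a b η : ℝ} (hη : η ≤ 1) (hab : |a - b| ≤ η) :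
    |Real.sigmoid a - Real.sigmoid b| ≤ 2 * η * Real.sigmoid a := by
  have h0 : 0 ≤ η := (abs_nonneg _).trans hab
  have ha := Real.sigmoid_pos a
  have hexp : Real.exp η ≤ 1 + 2 * η := by
    have := Real.abs_exp_sub_one_le (x := η) (by rwa [abs_of_nonneg h0])
    rw [abs_of_nonneg h0] at this
    linarith [le_abs_self (Real.exp η - 1)]
  have h1 := sigmoid_le_exp_mul b a
  have h2 := sigmoid_le_exp_mul a b
  rw [abs_sub_comm] at h1
  have h3 : Real.exp |a - b| ≤ 1 + 2 * η := (Real.exp_le_exp.2 hab).trans hexp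
  rw [abs_le]
  constructor
  · nlinarith
  · rcases le_total (Real.sigmoid a) (Real.sigmoid b) with h | h
    · nlinarith
    · nlinarith [Real.sigmoid_pos b]

/-- Two numbers that lie on the same side of each threshold of the grid `c + (k - n) * η`,
`0 ≤ k ≤ 2 * n`, are `η`-close, or both beyond the grid on the same side. -/
theorem close_or_outside_of_same_cell {v v' c η : ℝ} {n : ℕ} (hη : 0 < η)
    (h : ∀ k : Fin (2 * n + 1), c + ((k : ℕ) - n : ℝ) * η ≤ v ↔ c + ((k : ℕ) - n : ℝ) * η ≤ v') :
    |v - v'| ≤ η ∨ (c + n * η ≤ v ∧ c + n * η ≤ v') ∨ (v < c - n * η ∧ v' < c - n * η) := by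
  have hlast := h ⟨2 * n, by omega⟩
  have hfirst := h ⟨0, by omega⟩
  push_cast at hlast hfirst
  have e1 : c + (2 * n - n : ℝ) * η = c + n * η := by ring
  have e2 : c + (0 - n : ℝ) * η = c - n * η := by ring
  rw [e1] at hlast
  rw [e2] at hfirst
  by_cases h1 : c + n * η ≤ v
  · exact Or.inr (Or.inl ⟨h1, hlast.1 h1⟩)
  by_cases h2 : v < c - n * η
  · exact Or.inr (Or.inr ⟨h2, not_le.1 fun h3 => absurd (hfirst.2 h3) (not_le.2 h2)⟩)
  left
  push Not at h1 h2
  set j := ⌊(v - (c - n * η)) / η⌋₊ with hj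
  have hnn : 0 ≤ (v - (c - n * η)) / η := div_nonneg (by linarith) hη.le
  have hj1 : (j : ℝ) * η ≤ v - (c - n * η) := by
    rw [← le_div_iff₀ hη]
    exact Nat.floor_le hnn
  have hj2 : v - (c - n * η) < ((j : ℝ) + 1) * η := by
    rw [← div_lt_iff₀ hη]
    exact Nat.lt_floor_add_one _
  have hjlt : j < 2 * n := by
    have : (j : ℝ) < 2 * n := by
      by_contra hcon
      push Not at hcon
      nlinarith
    exact_mod_cast this
  have hk := h ⟨j, by omega⟩
  have hk1 := h ⟨j + 1, by omega⟩
  push_cast at hk hk1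
  have h3 := hk.1 (by linarith)
  have h4 : ¬ (c + ((j : ℝ) + 1 - n) * η ≤ v') := fun h5 => by
    have := hk1.2 h5
    linarith
  push Not at h4
  rw [abs_le]
  constructor <;> linarith

/-- Two gates whose inputs lie in the same cell, with a common shift `u`, differ by at most
`2 * η * κ` once one of them is at most `κ`. The grid is centred at `log κ`, so that its size does
not depend on `κ`. -/
theorem abs_gate_sub_le {v v' u U η κ : ℝ} {n : ℕ} (hη : 0 < η) (hη1 : η ≤ 1) (hκ : 0 < κ)
    (hu : |u| ≤ U) (hn : U + Real.log (2 / η) ≤ n * η)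
    (h : ∀ k : Fin (2 * n + 1), Real.log κ + ((k : ℕ) - n : ℝ) * η ≤ v ↔
      Real.log κ + ((k : ℕ) - n : ℝ) * η ≤ v')
    (hgate : Real.sigmoid (v + u) ≤ κ) :
    |Real.sigmoid (v + u) - Real.sigmoid (v' + u)| ≤ 2 * η * κ := by
  rw [abs_le] at hu
  rcases close_or_outside_of_same_cell hη h with h1 | ⟨h1, h2⟩ | ⟨h1, h2⟩
  · refine (abs_sigmoid_sub_le_mul hη1 (by simpa using h1)).trans ?_
    exact mul_le_mul_of_nonneg_left hgate (by linarith)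
  -- above the grid both gates are within `η / (2 * κ)` of `1`, which excludes `κ < 1 / 2`
  · have hbound : ∀ x, Real.log κ + n * η ≤ x → 1 - Real.sigmoid (x + u) ≤ η / (2 * κ) := by
      intro x hx
      refine (one_sub_sigmoid_le_exp _).trans ?_
      have : -(x + u) ≤ Real.log (η / (2 * κ)) := by
        rw [Real.log_div hη.ne' (by positivity), Real.log_mul (by norm_num) hκ.ne']
        rw [Real.log_div (by norm_num) hη.ne'] at hn
        linarith
      calc Real.exp (-(x + u)) ≤ Real.exp (Real.log (η / (2 * κ))) := Real.exp_le_exp.2 this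
        _ = _ := Real.exp_log (by positivity)
    by_cases hκ2 : 1 / 2 ≤ κ
    · have h3 : η / (2 * κ) ≤ η := div_le_self hη.le (by linarith)
      have h4 := hbound v h1
      have h5 := hbound v' h2
      have h6 := Real.sigmoid_lt_one (v + u)
      have h7 := Real.sigmoid_lt_one (v' + u)
      have h8 : η ≤ 2 * η * κ := by nlinarith
      rw [abs_le]
      constructor <;> linarith
    · exfalso
      push Not at hκ2
      have hx : Real.log (2 * κ / η) ≤ v + u := by
        rw [Real.log_div (by positivity) hη.ne', Real.log_mul (by norm_num) hκ.ne']
        rw [Real.log_div (by norm_num) hη.ne'] at hn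
        linarith
      have h3 : Real.sigmoid (Real.log (2 * κ / η)) ≤ κ := (Real.sigmoid_le hx).trans hgate
      rw [Real.sigmoid_def, Real.exp_neg, Real.exp_log (by positivity),
        inv_le_iff_one_le_mul₀ (by positivity)] at h3
      have h4 : (1 + (2 * κ / η)⁻¹) * κ = κ + η / 2 := by
        field_simp
      nlinarith
  -- below the grid both gates are small multiples of `κ`
  · have hbound : ∀ x, x < Real.log κ - n * η → Real.sigmoid (x + u) ≤ η * κ / 2 := by
      intro x hx
      refine (sigmoid_le_exp _).trans ?_
      have : x + u ≤ Real.log (η * κ / 2) := by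
        rw [Real.log_div (by positivity) (by norm_num), Real.log_mul hη.ne' hκ.ne']
        rw [Real.log_div (by norm_num) hη.ne'] at hn
        linarith
      calc Real.exp (x + u) ≤ Real.exp (Real.log (η * κ / 2)) := Real.exp_le_exp.2 this
        _ = _ := Real.exp_log (by positivity)
    have h3 := hbound v h1
    have h4 := hbound v' h2
    have h5 := Real.sigmoid_pos (v + u)
    have h6 := Real.sigmoid_pos (v' + u)
    have h7 : 0 < η * κ := by positivity
    rw [abs_le]
    constructor <;> linarith

theorem one_sub_tanh_le {x η : ℝ} (hη : 0 < η) (hx : 1 / η ≤ x) : 1 - Real.tanh x ≤ η := by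
  have hx0 : 0 < x := lt_of_lt_of_le (by positivity) hx
  rw [tanh_eq_sigmoid]
  have h1 := one_sub_sigmoid_le_exp (2 * x)
  have h2 : Real.exp (-(2 * x)) ≤ 1 / (2 * x) := by
    rw [Real.exp_neg, ← one_div]
    apply one_div_le_one_div_of_le (by positivity)
    linarith [Real.add_one_le_exp (2 * x)]
  have h3 : 1 / (2 * x) ≤ η / 2 := by
    rw [div_le_iff₀ (by positivity)]
    rw [div_le_iff₀ hη] at hx
    linarith
  linarith

theorem abs_tanh_sub_le_of_le {x y η : ℝ} (hη : 0 < η) (hx : 1 / η ≤ x) (hy : 1 / η ≤ y) :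
    |Real.tanh x - Real.tanh y| ≤ η := by
  have h1 := one_sub_tanh_le hη hx
  have h2 := one_sub_tanh_le hη hy
  have h3 := Real.tanh_lt_one x
  have h4 := Real.tanh_lt_one y
  rw [abs_le]
  constructor <;> linarith

/-- Two candidate states whose inputs lie in the same cell, with a common shift `u`, are close
relative to `min 1 A`, after multiplication by a gate `r` for which `r * u` is bounded. -/
theorem gate_mul_abs_tanh_sub_le {v v' u r K η A : ℝ} {n : ℕ} (hη : 0 < η) (hη1 : η ≤ 1)
    (hA : 0 < A) (hK : 0 ≤ K) (hr1 : r ≤ 1) (hu : r * |u| ≤ K)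
    (hv : |v| ≤ A) (hv' : |v'| ≤ A) (hn : (K + 1) / η ≤ n * η)
    (h : ∀ k : Fin (2 * n + 1), 0 + ((k : ℕ) - n : ℝ) * (η * min 1 A) ≤ v ↔
      0 + ((k : ℕ) - n : ℝ) * (η * min 1 A) ≤ v') :
    r * |Real.tanh (v + u) - Real.tanh (v' + u)| ≤ 2 * η * min 1 A := by
  have ha : 0 < min 1 A := lt_min one_pos hA
  rw [abs_le] at hv hv'
  rcases close_or_outside_of_same_cell (mul_pos hη ha) h with h1 | hout
  · have h2 := (abs_tanh_sub_le (v + u) (v' + u)).trans (by simpa using h1)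
    have h3 := mul_le_mul hr1 h2 (abs_nonneg _) zero_le_one
    have := mul_pos hη ha
    linarith
  rcases le_or_gt A 1 with hA1 | hA1
  · rw [min_eq_right hA1] at hout ⊢
    have h1 : A ≤ n * (η * A) := by
      have h2 : 1 ≤ n * η := by
        refine le_trans ?_ hn
        rw [le_div_iff₀ hη]
        linarith
      nlinarith
    have : v = v' := by
      rcases hout with ⟨h2, h3⟩ | ⟨h2, h3⟩ <;> linarith
    rw [this, sub_self, abs_zero, mul_zero]
    positivity
  · rw [min_eq_left hA1.le] at hout ⊢
    rw [mul_one] at hout ⊢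
    rcases le_or_gt r η with hr | hr
    · have h2 : |Real.tanh (v + u) - Real.tanh (v' + u)| ≤ 2 := by
        have h3 := abs_lt.1 (Real.abs_tanh_lt_one (v + u))
        have h4 := abs_lt.1 (Real.abs_tanh_lt_one (v' + u))
        rw [abs_le]
        constructor <;> linarith
      have := mul_le_mul hr h2 (abs_nonneg _) hη.le
      linarith
    · have hu' : |u| ≤ K / η := by
        rw [le_div_iff₀ hη]
        nlinarith [abs_nonneg u]
      rw [abs_le] at hu'
      have e : (K + 1) / η = K / η + 1 / η := by ring
      have h2 : |Real.tanh (v + u) - Real.tanh (v' + u)| ≤ η := by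
        rcases hout with ⟨h2, h3⟩ | ⟨h2, h3⟩
        · exact abs_tanh_sub_le_of_le hη (by linarith) (by linarith)
        · have := abs_tanh_sub_le_of_le (x := -(v' + u)) (y := -(v + u)) hη (by linarith)
            (by linarith)
          rw [Real.tanh_neg, Real.tanh_neg] at this
          convert this using 2
          ring
      have := mul_le_mul hr1 h2 (abs_nonneg _) zero_le_one
      linarith

/-! ### Euclidean norms of vectors and matrices -/

/-- The Euclidean norm on `Fin n → ℝ`, whose own norm is the sup norm. -/
noncomputable def l2 {n : ℕ} (v : Fin n → ℝ) : ℝ := ‖(WithLp.toLp 2 v : EuclideanSpace ℝ (Fin n))‖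

theorem l2_nonneg {n : ℕ} (v : Fin n → ℝ) : 0 ≤ l2 v := norm_nonneg _

theorem l2_zero {n : ℕ} : l2 (0 : Fin n → ℝ) = 0 := by simp [l2]

theorem l2_sq {n : ℕ} (v : Fin n → ℝ) : l2 v ^ 2 = ∑ i, v i ^ 2 := by
  simp [l2, EuclideanSpace.norm_sq_eq]

theorem l2_add_le {n : ℕ} (u v : Fin n → ℝ) : l2 (u + v) ≤ l2 u + l2 v := by
  simpa [l2] using norm_add_le (WithLp.toLp 2 u : EuclideanSpace ℝ (Fin n)) (WithLp.toLp 2 v)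

theorem l2_sub_le {n : ℕ} (u v : Fin n → ℝ) : l2 (u - v) ≤ l2 u + l2 v := by
  simpa [l2] using norm_sub_le (WithLp.toLp 2 u : EuclideanSpace ℝ (Fin n)) (WithLp.toLp 2 v)

theorem abs_le_l2 {n : ℕ} (v : Fin n → ℝ) (i : Fin n) : |v i| ≤ l2 v := by
  simpa [l2] using PiLp.norm_apply_le (WithLp.toLp 2 v : EuclideanSpace ℝ (Fin n)) i

theorem l2_le_of_abs_le {n : ℕ} {u v : Fin n → ℝ} {c : ℝ} (hc : 0 ≤ c)
    (h : ∀ i, |v i| ≤ c * |u i|) : l2 v ≤ c * l2 u := by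
  refine le_of_sq_le_sq ?_ (mul_nonneg hc (l2_nonneg u))
  rw [mul_pow, l2_sq, l2_sq, Finset.mul_sum]
  refine Finset.sum_le_sum fun i _ => ?_
  rw [← sq_abs (v i), ← sq_abs (u i), ← mul_pow]
  exact pow_le_pow_left₀ (abs_nonneg _) (h i) 2

theorem l2_mul_le {n : ℕ} {r v : Fin n → ℝ} {c : ℝ} (hc : 0 ≤ c) (h : ∀ i, |r i| ≤ c) :
    l2 (r * v) ≤ c * l2 v :=
  l2_le_of_abs_le hc fun i => by
    rw [Pi.mul_apply, abs_mul]
    exact mul_le_mul_of_nonneg_right (h i) (abs_nonneg _)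

theorem l2_le_mul_sqrt {n : ℕ} {v : Fin n → ℝ} {c : ℝ} (hc : 0 ≤ c) (h : ∀ i, |v i| ≤ c) :
    l2 v ≤ c * √n := by
  refine le_of_sq_le_sq ?_ (by positivity)
  rw [mul_pow, l2_sq, Real.sq_sqrt (Nat.cast_nonneg n)]
  calc ∑ i, v i ^ 2 ≤ ∑ _i : Fin n, c ^ 2 := by
        refine Finset.sum_le_sum fun i _ => ?_
        rw [← sq_abs (v i)]
        exact pow_le_pow_left₀ (abs_nonneg _) (h i) 2
    _ = c ^ 2 * n := by
        rw [Finset.sum_const, Finset.card_univ, Fintype.card_fin, nsmul_eq_mul, mul_comm]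

theorem specNorm_nonneg {p q : ℕ} (A : Matrix (Fin p) (Fin q) ℝ) : 0 ≤ specNorm A :=
  letI := Matrix.instL2OpNormedAddCommGroup (m := Fin p) (n := Fin q) (𝕜 := ℝ)
  norm_nonneg A

theorem l2_mulVec_le {p q : ℕ} (A : Matrix (Fin p) (Fin q) ℝ) (v : Fin q → ℝ) :
    l2 (A *ᵥ v) ≤ specNorm A * l2 v :=
  Matrix.l2_opNorm_mulVec A (WithLp.toLp 2 v)

theorem abs_entry_le_specNorm {p q : ℕ} (A : Matrix (Fin p) (Fin q) ℝ) (i : Fin p) (j : Fin q) :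
    |A i j| ≤ specNorm A := by
  have h1 := abs_le_l2 (A *ᵥ Pi.single j 1) i
  have h2 := l2_mulVec_le A (Pi.single j 1)
  have h3 : l2 (Pi.single j 1 : Fin q → ℝ) = 1 := by simp [l2]
  rw [h3, mul_one] at h2
  rw [Matrix.mulVec_single_one] at h1 h2
  exact h1.trans h2

/-- The Frobenius bound for a matrix with small entries. -/
theorem l2_mulVec_le_of_entry_le {p q : ℕ} {A : Matrix (Fin p) (Fin q) ℝ} {c : ℝ} (hc : 0 ≤ c)
    (h : ∀ i j, |A i j| ≤ c) (v : Fin q → ℝ) : l2 (A *ᵥ v) ≤ c * √q * √p * l2 v := by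
  have h1 : ∀ i, |(A *ᵥ v) i| ≤ c * √q * l2 v := by
    intro i
    have h2 : l2 (A i) ≤ c * √q := l2_le_mul_sqrt hc (h i)
    have h3 : |(A *ᵥ v) i| ≤ l2 (A i) * l2 v := by
      have := abs_real_inner_le_norm (WithLp.toLp 2 v : EuclideanSpace ℝ (Fin q))
        (WithLp.toLp 2 (A i))
      rw [mul_comm]
      simpa [l2, Matrix.mulVec, PiLp.inner_apply, dotProduct] using this
    exact h3.trans (mul_le_mul_of_nonneg_right h2 (l2_nonneg v))
  refine (l2_le_mul_sqrt (mul_nonneg (by positivity) (l2_nonneg v)) h1).trans (le_of_eq ?_)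
  ring

/-! ### Perturbation of one step of the network -/

variable {dx dh dy K T : ℕ}

theorem gateAt_pos (w : Weights dx dh dy) (x : EuclideanSpace ℝ (Fin dx)) (h : Fin dh → ℝ)
    (i : Fin dh) : 0 < w.gateAt x h i := Real.sigmoid_pos _

theorem gateAt_lt_one (w : Weights dx dh dy) (x : EuclideanSpace ℝ (Fin dx)) (h : Fin dh → ℝ)
    (i : Fin dh) : w.gateAt x h i < 1 := Real.sigmoid_lt_one _

/-- The states of a step, measured in the constants of a class of networks: the gate is at most
`κ` and obeys the bound `β`, the previous state lies in the unit cube and in the ball of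
radius `H`. -/
structure StepBounds (w : Weights dx dh dy) (B : NormBounds) (β κ H : ℝ)
    (x : EuclideanSpace ℝ (Fin dx)) (h : Fin dh → ℝ) : Prop where
  gate_le : ∀ i, w.gateAt x h i ≤ κ
  gate_bound : ‖1 - w.gateAt x h‖ + B.Uh * ‖w.gateAt x h‖ ^ 2 ≤ β
  abs_le : ∀ i, |h i| ≤ 1
  l2_le : l2 h ≤ H

/-- The coordinates of `W_r x` and of `W_h x` lie on the same side of each threshold for both
networks. The grid for `W_r x` is centred at `log κ` and has mesh `η`, that for `W_h x` is centred
at `0` and has mesh `η * min 1 A`. -/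
structure SameCells (w w' : Weights dx dh dy) (κ η A : ℝ) (n : ℕ)
    (x : EuclideanSpace ℝ (Fin dx)) : Prop where
  Wr : ∀ (i : Fin dh) (k : Fin (2 * n + 1)),
    Real.log κ + ((k : ℕ) - n : ℝ) * η ≤ (w.Wr *ᵥ x.ofLp) i ↔
      Real.log κ + ((k : ℕ) - n : ℝ) * η ≤ (w'.Wr *ᵥ x.ofLp) i
  Wh : ∀ (i : Fin dh) (k : Fin (2 * n + 1)),
    0 + ((k : ℕ) - n : ℝ) * (η * min 1 A) ≤ (w.Wh *ᵥ x.ofLp) i ↔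
      0 + ((k : ℕ) - n : ℝ) * (η * min 1 A) ≤ (w'.Wh *ᵥ x.ofLp) i

/-- The matrices `U_r`, `U_h` and `V` of two networks are `η`-close relative to their bounds. -/
structure CloseMatrices (w w' : Weights dx dh dy) (B : NormBounds) (η : ℝ) : Prop where
  Ur : ∀ v, l2 ((w.Ur - w'.Ur) *ᵥ v) ≤ η * B.Ur * l2 v
  Uh : ∀ v, l2 ((w.Uh - w'.Uh) *ᵥ v) ≤ η * B.Uh * l2 v
  V : ∀ v, l2 ((w.V - w'.V) *ᵥ v) ≤ η * B.V * l2 v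

theorem l2_ofLp (x : EuclideanSpace ℝ (Fin dx)) : l2 x.ofLp = ‖x‖ := rfl

section BoundedBy

variable {w w' : Weights dx dh dy} {B : NormBounds}

theorem Weights.BoundedBy.Ur_nonneg (hw : w.BoundedBy B) : 0 ≤ B.Ur :=
  (specNorm_nonneg _).trans hw.Ur_le

theorem Weights.BoundedBy.Uh_nonneg (hw : w.BoundedBy B) : 0 ≤ B.Uh :=
  (specNorm_nonneg _).trans hw.Uh_le

theorem Weights.BoundedBy.Wh_nonneg (hw : w.BoundedBy B) : 0 ≤ B.Wh :=
  (specNorm_nonneg _).trans hw.Wh_le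

theorem Weights.BoundedBy.V_nonneg (hw : w.BoundedBy B) : 0 ≤ B.V :=
  (specNorm_nonneg _).trans hw.V_le

theorem Weights.BoundedBy.l2_Ur (hw : w.BoundedBy B) (v : Fin dh → ℝ) :
    l2 (w.Ur *ᵥ v) ≤ B.Ur * l2 v :=
  (l2_mulVec_le _ _).trans (mul_le_mul_of_nonneg_right hw.Ur_le (l2_nonneg v))

theorem Weights.BoundedBy.l2_Uh (hw : w.BoundedBy B) (v : Fin dh → ℝ) :
    l2 (w.Uh *ᵥ v) ≤ B.Uh * l2 v :=
  (l2_mulVec_le _ _).trans (mul_le_mul_of_nonneg_right hw.Uh_le (l2_nonneg v))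

theorem Weights.BoundedBy.l2_V (hw : w.BoundedBy B) (v : Fin dh → ℝ) :
    l2 (w.V *ᵥ v) ≤ B.V * l2 v :=
  (l2_mulVec_le _ _).trans (mul_le_mul_of_nonneg_right hw.V_le (l2_nonneg v))

theorem Weights.BoundedBy.l2_Wh (hw : w.BoundedBy B) {Bx : ℝ} {x : EuclideanSpace ℝ (Fin dx)}
    (hx : ‖x‖ ≤ Bx) : l2 (w.Wh *ᵥ x.ofLp) ≤ B.Wh * Bx :=
  (l2_mulVec_le _ _).trans
    (mul_le_mul hw.Wh_le (by rwa [l2_ofLp]) (l2_nonneg _) hw.Wh_nonneg)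

end BoundedBy

theorem l2_candidateAt_le_sqrt (w : Weights dx dh dy) (x : EuclideanSpace ℝ (Fin dx))
    (r h : Fin dh → ℝ) : l2 (w.candidateAt x r h) ≤ √dh := by
  have := l2_le_mul_sqrt (v := w.candidateAt x r h) zero_le_one
    fun i => (Real.abs_tanh_lt_one ((w.Wh *ᵥ x.ofLp + w.Uh *ᵥ (r * h)) i)).le
  rwa [one_mul] at this

theorem l2_candidateAt_le {w : Weights dx dh dy} {B : NormBounds} (hw : w.BoundedBy B) {Bx c : ℝ}
    {x : EuclideanSpace ℝ (Fin dx)} (hx : ‖x‖ ≤ Bx) {r : Fin dh → ℝ} (hc : 0 ≤ c)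
    (hr : ∀ i, |r i| ≤ c) (h : Fin dh → ℝ) :
    l2 (w.candidateAt x r h) ≤ B.Wh * Bx + B.Uh * (c * l2 h) := by
  have h1 : l2 (w.candidateAt x r h) ≤ 1 * l2 (w.Wh *ᵥ x.ofLp + w.Uh *ᵥ (r * h)) :=
    l2_le_of_abs_le zero_le_one fun i => by
      rw [one_mul]
      exact abs_tanh_le _
  rw [one_mul] at h1
  refine h1.trans ((l2_add_le _ _).trans (add_le_add (hw.l2_Wh hx) ((hw.l2_Uh _).trans ?_)))
  exact mul_le_mul_of_nonneg_left (l2_mul_le hc hr) hw.Uh_nonneg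

section Step

variable {w w' : Weights dx dh dy} {B : NormBounds} {Bx β κ η H Hj G s : ℝ} {n : ℕ}
  {x : EuclideanSpace ℝ (Fin dx)} {h h' : Fin dh → ℝ}

/-- The part of the difference of two gates that is due to `W_r`. -/
theorem abs_gate_sub_Wr_le (hw : w.BoundedBy B) (hb : StepBounds w B β κ Hj x h)
    (hcell : SameCells w w' κ η (B.Wh * Bx) n x) (hη : 0 < η) (hη1 : η ≤ 1) (hκ : 0 < κ)
    (hn : B.Ur * Hj + Real.log (2 / η) ≤ n * η) (i : Fin dh) :
    |w.gateAt x h i - Real.sigmoid ((w'.Wr *ᵥ x.ofLp + w.Ur *ᵥ h) i)| ≤ 2 * η * κ := by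
  refine abs_gate_sub_le (n := n) hη hη1 hκ ((abs_le_l2 _ i).trans (hw.l2_Ur h))
    (le_trans ?_ hn) (hcell.Wr i) (hb.gate_le i)
  have := mul_le_mul_of_nonneg_left hb.l2_le hw.Ur_nonneg
  linarith

/-- The part of the difference of two gates that is due to `U_r` and to the previous state. -/
theorem l2_gate_sub_Ur_le (hw' : w'.BoundedBy B) (hl2 : l2 h ≤ Hj) (hmat : CloseMatrices w w' B η)
    (hη : 0 < η) :
    l2 ((fun i => Real.sigmoid ((w'.Wr *ᵥ x.ofLp + w.Ur *ᵥ h) i)) - w'.gateAt x h') ≤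
      η * B.Ur * Hj + B.Ur * l2 (h - h') := by
  have h1 : l2 ((fun i => Real.sigmoid ((w'.Wr *ᵥ x.ofLp + w.Ur *ᵥ h) i)) - w'.gateAt x h') ≤
      1 * l2 ((w.Ur - w'.Ur) *ᵥ h + w'.Ur *ᵥ (h - h')) := by
    refine l2_le_of_abs_le zero_le_one fun i => ?_
    rw [one_mul]
    refine (abs_sigmoid_sub_le _ _).trans ?_
    have e : (w'.Wr *ᵥ x.ofLp + w.Ur *ᵥ h) i - (w'.Wr *ᵥ x.ofLp + w'.Ur *ᵥ h') i =
        ((w.Ur - w'.Ur) *ᵥ h + w'.Ur *ᵥ (h - h')) i := by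
      simp only [Matrix.sub_mulVec, Matrix.mulVec_sub, Pi.add_apply, Pi.sub_apply]
      ring
    rw [e]
    have := abs_nonneg (((w.Ur - w'.Ur) *ᵥ h + w'.Ur *ᵥ (h - h')) i)
    linarith
  rw [one_mul] at h1
  refine h1.trans ((l2_add_le _ _).trans (add_le_add ((hmat.Ur h).trans ?_) (hw'.l2_Ur _)))
  exact mul_le_mul_of_nonneg_left hl2 (mul_nonneg hη.le hw'.Ur_nonneg)

/-- The part of the difference of two candidate states that is due to `W_h`. -/
theorem l2_gate_mul_candidate_sub_Wh_le (hw : w.BoundedBy B) (hw' : w'.BoundedBy B)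
    (hx : ‖x‖ ≤ Bx) (hb' : StepBounds w' B β κ Hj x h')
    (hcell : SameCells w w' κ η (B.Wh * Bx) n x) (hη : 0 < η) (hη1 : η ≤ 1) (hκ : 0 < κ)
    (hA : 0 < B.Wh * Bx) (hκβ : B.Uh * κ ^ 2 ≤ β) (hβ : 0 ≤ β) (hn : (β * Hj + 1) / η ≤ n * η) :
    l2 (w'.gateAt x h' * ((fun i => Real.tanh ((w.Wh *ᵥ x.ofLp +
        w'.Uh *ᵥ (w'.gateAt x h' * h')) i)) - w'.candidateAt x (w'.gateAt x h') h')) ≤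
      2 * η * min 1 (B.Wh * Bx) * √dh := by
  have hHj : 0 ≤ Hj := (l2_nonneg _).trans hb'.l2_le
  refine l2_le_mul_sqrt (mul_nonneg (by positivity) (le_min zero_le_one hA.le)) fun i => ?_
  rw [Pi.mul_apply, abs_mul, abs_of_pos (gateAt_pos _ _ _ _)]
  refine gate_mul_abs_tanh_sub_le (K := β * Hj) (n := n) hη hη1 hA (mul_nonneg hβ hHj)
    (gateAt_lt_one _ _ _ _).le ?_ ((abs_le_l2 _ i).trans (hw.l2_Wh hx))
    ((abs_le_l2 _ i).trans (hw'.l2_Wh hx)) hn (hcell.Wh i)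
  have h1 : |(w'.Uh *ᵥ (w'.gateAt x h' * h')) i| ≤ B.Uh * (κ * Hj) := by
    refine (abs_le_l2 _ i).trans ((hw'.l2_Uh _).trans ?_)
    refine mul_le_mul_of_nonneg_left ?_ hw'.Uh_nonneg
    refine (l2_mul_le hκ.le fun i => ?_).trans (mul_le_mul_of_nonneg_left hb'.l2_le hκ.le)
    rw [abs_of_pos (gateAt_pos _ _ _ _)]
    exact hb'.gate_le i
  calc w'.gateAt x h' i * |(w'.Uh *ᵥ (w'.gateAt x h' * h')) i| ≤ κ * (B.Uh * (κ * Hj)) :=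
        mul_le_mul (hb'.gate_le i) h1 (abs_nonneg _) hκ.le
    _ = B.Uh * κ ^ 2 * Hj := by ring
    _ ≤ β * Hj := mul_le_mul_of_nonneg_right hκβ hHj

/-- One step multiplies the distance of the states of two networks by at most
`θ = β + 2 * B.Ur + B.Ur * B.Uh`, up to an error proportional to the radius `H` of the states.
The hypothesis `hG` bounds the size `Hj` of the present states, which is `0` in the first step. -/
theorem l2_step_sub_step_le (hw : w.BoundedBy B) (hw' : w'.BoundedBy B) (hx : ‖x‖ ≤ Bx)
    (hb : StepBounds w B β κ Hj x h) (hb' : StepBounds w' B β κ Hj x h')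
    (hcell : SameCells w w' κ η (B.Wh * Bx) n x) (hmat : CloseMatrices w w' B η)
    (hη : 0 < η) (hη1 : η ≤ 1) (hκ : 0 < κ) (hκ1 : κ ≤ 1) (hκβ : B.Uh * κ ^ 2 ≤ β)
    (hA : 0 < B.Wh * Bx) (hn : B.Ur * Hj + Real.log (2 / η) ≤ n * η)
    (hn' : (β * Hj + 1) / η ≤ n * η) (hHj : Hj ≤ H)
    (hG : (β + 2 * B.Ur + B.Ur * B.Uh) * Hj ≤ G * H) (hs : √dh ≤ s)
    (hH1 : min 1 (B.Wh * Bx) ≤ H) (hHs : min s (B.Wh * Bx) ≤ H) :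
    l2 (w.step x h - w'.step x h') ≤
      (β + 2 * B.Ur + B.Ur * B.Uh) * l2 (h - h') + η * (H * (4 + 6 * G + 2 * s)) := by
  have hβ : 0 ≤ β := (mul_nonneg hw.Uh_nonneg (sq_nonneg κ)).trans hκβ
  have hHj0 : 0 ≤ Hj := (l2_nonneg _).trans hb.l2_le
  have hH0 : 0 ≤ H := hHj0.trans hHj
  have hUr := hw.Ur_nonneg
  have hUh := hw.Uh_nonneg
  have hβHj : β * Hj ≤ G * H := by
    refine le_trans ?_ hG
    have := mul_nonneg hUr hHj0
    have := mul_nonneg (mul_nonneg hUr hUh) hHj0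
    linarith
  set r := w.gateAt x h with hr
  set r' := w'.gateAt x h' with hr'
  set t := w.candidateAt x r h with ht
  set t' := w'.candidateAt x r' h' with ht'
  set r₁ : Fin dh → ℝ := fun i => Real.sigmoid ((w'.Wr *ᵥ x.ofLp + w.Ur *ᵥ h) i) with hr₁
  set t₁ : Fin dh → ℝ := fun i => Real.tanh ((w.Wh *ᵥ x.ofLp + w'.Uh *ᵥ (r' * h')) i) with ht₁
  set Δ := l2 (h - h') with hΔ
  have hΔ0 : 0 ≤ Δ := l2_nonneg _
  have hrκ : ∀ i, |r i| ≤ κ := fun i => by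
    rw [abs_of_pos (gateAt_pos _ _ _ _)]
    exact hb.gate_le i
  have hr'κ : ‖r'‖ ≤ κ := (pi_norm_le_iff_of_nonneg hκ.le).2 fun i => by
    rw [Real.norm_eq_abs, abs_of_pos (gateAt_pos _ _ _ _)]
    exact hb'.gate_le i
  have hr'0 : 0 ≤ ‖r'‖ := norm_nonneg _
  have hr'n : ∀ i, |r' i| ≤ ‖r'‖ := fun i => norm_le_pi_norm r' i
  -- the gates
  have hp : ∀ i, |(r - r₁) i| ≤ 2 * η * κ := fun i =>
    abs_gate_sub_Wr_le hw hb hcell hη hη1 hκ hn i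
  have hq : l2 (r₁ - r') ≤ η * B.Ur * Hj + B.Ur * Δ :=
    l2_gate_sub_Ur_le hw' hb.l2_le hmat hη
  have hq0 := l2_nonneg (r₁ - r')
  have hηκ : 0 ≤ 2 * η * κ := by positivity
  -- the candidate state is small relative to the gate
  have htκ : κ * l2 t ≤ H + G * H := by
    have h1 : l2 t ≤ s := (l2_candidateAt_le_sqrt w x r h).trans hs
    have h2 : l2 t ≤ B.Wh * Bx + B.Uh * (κ * l2 h) := l2_candidateAt_le hw hx hκ.le hrκ h
    have h3 : 0 ≤ l2 t := l2_nonneg t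
    have h4 : κ * l2 t ≤ l2 t := mul_le_of_le_one_left h3 hκ1
    have hGH : 0 ≤ G * H := (mul_nonneg hβ hHj0).trans hβHj
    rcases min_choice s (B.Wh * Bx) with hmin | hmin
    · rw [hmin] at hHs
      linarith
    · rw [hmin] at hHs
      have h5 := mul_le_mul_of_nonneg_left h2 hκ.le
      have h6 : κ * (B.Wh * Bx) ≤ B.Wh * Bx := mul_le_of_le_one_left hA.le hκ1
      have h7 : B.Uh * κ ^ 2 * l2 h ≤ β * Hj := mul_le_mul hκβ hb.l2_le (l2_nonneg h) hβ
      have h8 : κ * (B.Wh * Bx + B.Uh * (κ * l2 h)) = κ * (B.Wh * Bx) + B.Uh * κ ^ 2 * l2 h := by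
        ring
      linarith
  -- decomposition of the difference
  have hdec : w.step x h - w'.step x h' =
      ((1 - r') * (h - h') + ((r - r₁) * (t - h) + (r₁ - r') * (t - h))) +
        (r' * (t - t₁) + r' * (t₁ - t')) := by
    simp only [Weights.step, ← hr, ← hr', ← ht, ← ht']
    ring
  have e1 : l2 ((1 - r') * (h - h')) ≤ ‖1 - r'‖ * Δ :=
    l2_mul_le (norm_nonneg _) fun i => norm_le_pi_norm (1 - r') i
  have e2 : l2 ((r - r₁) * (t - h)) ≤ 2 * η * (2 * H + G * H) := by
    have h1 : κ * l2 h ≤ H := by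
      have := mul_le_of_le_one_left (l2_nonneg h) hκ1
      linarith [hb.l2_le]
    calc l2 ((r - r₁) * (t - h)) ≤ 2 * η * κ * l2 (t - h) := l2_mul_le hηκ hp
      _ ≤ 2 * η * κ * (l2 t + l2 h) := mul_le_mul_of_nonneg_left (l2_sub_le _ _) hηκ
      _ = 2 * η * (κ * l2 t + κ * l2 h) := by ring
      _ ≤ _ := mul_le_mul_of_nonneg_left (by linarith) (by linarith)
  have e3 : l2 ((r₁ - r') * (t - h)) ≤ 2 * (η * B.Ur * Hj + B.Ur * Δ) := by
    rw [mul_comm (r₁ - r')]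
    refine (l2_mul_le (c := 2) (by norm_num) fun i => ?_).trans
      (mul_le_mul_of_nonneg_left hq (by norm_num))
    have h1 : |t i| < 1 := Real.abs_tanh_lt_one _
    have h2 := hb.abs_le i
    rw [abs_lt] at h1
    rw [abs_le] at h2
    rw [Pi.sub_apply, abs_le]
    constructor <;> linarith [h1.1, h1.2, h2.1, h2.2]
  have e4 : l2 (r' * (t₁ - t')) ≤ 2 * η * (H * s) := by
    refine (l2_gate_mul_candidate_sub_Wh_le hw hw' hx hb' hcell hη hη1 hκ hA hκβ hβ hn').trans ?_
    rw [mul_assoc]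
    refine mul_le_mul_of_nonneg_left ?_ (by linarith)
    exact mul_le_mul hH1 hs (Real.sqrt_nonneg _) hH0
  have e5 : l2 (r' * (t - t₁)) ≤
      3 * η * (G * H) + B.Uh * (η * B.Ur * Hj + B.Ur * Δ) + B.Uh * ‖r'‖ ^ 2 * Δ := by
    have h1 : l2 (t - t₁) ≤ 1 * l2 ((w.Uh - w'.Uh) *ᵥ (r * h) + (w'.Uh *ᵥ ((r - r₁) * h) +
        (w'.Uh *ᵥ ((r₁ - r') * h) + w'.Uh *ᵥ (r' * (h - h'))))) := by
      refine l2_le_of_abs_le zero_le_one fun i => ?_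
      rw [one_mul]
      refine (abs_tanh_sub_le _ _).trans (le_of_eq ?_)
      congr 1
      simp only [sub_mul, mul_sub, Matrix.sub_mulVec, Matrix.mulVec_sub, Pi.add_apply,
        Pi.sub_apply]
      ring
    have h2 : l2 ((w.Uh - w'.Uh) *ᵥ (r * h)) ≤ η * B.Uh * (κ * Hj) := by
      refine (hmat.Uh _).trans (mul_le_mul_of_nonneg_left ?_ (mul_nonneg hη.le hUh))
      exact (l2_mul_le hκ.le hrκ).trans (mul_le_mul_of_nonneg_left hb.l2_le hκ.le)
    have h3 : l2 (w'.Uh *ᵥ ((r - r₁) * h)) ≤ B.Uh * (2 * η * κ * Hj) := by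
      refine (hw'.l2_Uh _).trans (mul_le_mul_of_nonneg_left ?_ hUh)
      exact (l2_mul_le hηκ hp).trans (mul_le_mul_of_nonneg_left hb.l2_le hηκ)
    have h4 : l2 (w'.Uh *ᵥ ((r₁ - r') * h)) ≤ B.Uh * (η * B.Ur * Hj + B.Ur * Δ) := by
      refine (hw'.l2_Uh _).trans (mul_le_mul_of_nonneg_left ?_ hUh)
      rw [mul_comm]
      refine (l2_mul_le zero_le_one hb.abs_le).trans ?_
      linarith
    have h5 : l2 (w'.Uh *ᵥ (r' * (h - h'))) ≤ B.Uh * (‖r'‖ * Δ) := by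
      refine (hw'.l2_Uh _).trans (mul_le_mul_of_nonneg_left ?_ hUh)
      exact l2_mul_le hr'0 hr'n
    have h6 : l2 (t - t₁) ≤ η * B.Uh * (κ * Hj) + (B.Uh * (2 * η * κ * Hj) +
        (B.Uh * (η * B.Ur * Hj + B.Ur * Δ) + B.Uh * (‖r'‖ * Δ))) := by
      rw [one_mul] at h1
      refine h1.trans ((l2_add_le _ _).trans (add_le_add h2 ?_))
      exact (l2_add_le _ _).trans (add_le_add h3 ((l2_add_le _ _).trans (add_le_add h4 h5)))
    refine (l2_mul_le hr'0 hr'n).trans ((mul_le_mul_of_nonneg_left h6 hr'0).trans ?_)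
    have h7 : ‖r'‖ * (η * B.Uh * (κ * Hj) + B.Uh * (2 * η * κ * Hj)) ≤ 3 * η * (G * H) := by
      have h8 : 0 ≤ η * B.Uh * (κ * Hj) + B.Uh * (2 * η * κ * Hj) := by positivity
      calc ‖r'‖ * (η * B.Uh * (κ * Hj) + B.Uh * (2 * η * κ * Hj))
          ≤ κ * (η * B.Uh * (κ * Hj) + B.Uh * (2 * η * κ * Hj)) :=
            mul_le_mul_of_nonneg_right hr'κ h8
        _ = 3 * η * (B.Uh * κ ^ 2 * Hj) := by ring
        _ ≤ 3 * η * (G * H) := by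
            refine mul_le_mul_of_nonneg_left ?_ (by linarith)
            exact (mul_le_mul_of_nonneg_right hκβ hHj0).trans hβHj
    have h9 : ‖r'‖ * (B.Uh * (η * B.Ur * Hj + B.Ur * Δ)) ≤
        B.Uh * (η * B.Ur * Hj + B.Ur * Δ) :=
      mul_le_of_le_one_left (by positivity) (hr'κ.trans hκ1)
    have h10 : ‖r'‖ * (B.Uh * (‖r'‖ * Δ)) = B.Uh * ‖r'‖ ^ 2 * Δ := by ring
    linarith
  have htot := (l2_add_le _ _).trans (add_le_add
    ((l2_add_le ((1 - r') * (h - h')) _).trans (add_le_add e1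
      ((l2_add_le _ _).trans (add_le_add e2 e3))))
    ((l2_add_le _ _).trans (add_le_add e5 e4)))
  rw [hdec]
  refine htot.trans ?_
  have h1 : (‖1 - r'‖ + B.Uh * ‖r'‖ ^ 2) * Δ ≤ β * Δ :=
    mul_le_mul_of_nonneg_right hb'.gate_bound hΔ0
  have h2 : η * (2 * B.Ur * Hj + B.Ur * B.Uh * Hj) ≤ η * (G * H) := by
    refine mul_le_mul_of_nonneg_left ?_ hη.le
    have := mul_nonneg hβ hHj0
    linarith
  linarith

end Step

/-! ### Hidden states along a sequence -/

theorem geomRatio_eq_sum (a : ℝ) (t : ℕ) : geomRatio a t = ∑ i ∈ Finset.range t, a ^ i := by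
  unfold geomRatio
  split_ifs with h
  · simp [h]
  · exact (geom_sum_eq h t).symm

theorem geomRatio_mono_left {a b : ℝ} (ha : 0 ≤ a) (hab : a ≤ b) (t : ℕ) :
    geomRatio a t ≤ geomRatio b t := by
  rw [geomRatio_eq_sum, geomRatio_eq_sum]
  exact Finset.sum_le_sum fun i _ => pow_le_pow_left₀ ha hab i

theorem geomRatio_mono_right {a : ℝ} (ha : 0 ≤ a) {s t : ℕ} (hst : s ≤ t) :
    geomRatio a s ≤ geomRatio a t := by
  rw [geomRatio_eq_sum, geomRatio_eq_sum]
  exact Finset.sum_le_sum_of_subset_of_nonneg (Finset.range_mono hst)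
    fun i _ _ => pow_nonneg ha i

theorem geomRatio_zero (a : ℝ) : geomRatio a 0 = 0 := by simp [geomRatio_eq_sum]

theorem geomRatio_one (a : ℝ) : geomRatio a 1 = 1 := by simp [geomRatio_eq_sum]

theorem geomRatio_succ (a : ℝ) (t : ℕ) : geomRatio a (t + 1) = 1 + a * geomRatio a t := by
  rw [geomRatio_eq_sum, geomRatio_eq_sum, Finset.sum_range_succ', Finset.mul_sum]
  simp only [pow_succ', pow_zero]
  ring

theorem geomRatio_nonneg {a : ℝ} (ha : 0 ≤ a) (t : ℕ) : 0 ≤ geomRatio a t := by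
  rw [geomRatio_eq_sum]
  exact Finset.sum_nonneg fun i _ => pow_nonneg ha i

theorem one_le_geomRatio {a : ℝ} (ha : 0 ≤ a) {t : ℕ} (ht : 0 < t) : 1 ≤ geomRatio a t := by
  rw [← geomRatio_one a]
  exact geomRatio_mono_right ha ht

theorem le_geomRatio {a : ℝ} (ha : 0 ≤ a) {t : ℕ} (ht : 1 < t) : a ≤ geomRatio a t := by
  have h := geomRatio_mono_right ha ht
  rw [Nat.succ_eq_add_one, geomRatio_succ, geomRatio_one] at h
  linarith

theorem continuous_geomRatio (t : ℕ) : Continuous fun a => geomRatio a t := by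
  simp only [geomRatio_eq_sum]
  fun_prop

/-- Few steps suffice for the contraction factor `a ^ L` to fall below `ε`: as long as
`ε < a ^ i`, the geometric sum grows by `ε`. So `L` is bounded without reference to `t`. -/
theorem exists_window {a ε : ℝ} (ha : 0 ≤ a) (t : ℕ) :
    ∃ L ≤ t, (L = t ∨ a ^ L ≤ ε) ∧ (L : ℝ) * ε ≤ geomRatio a t := by
  classical
  by_cases h : ∃ L, L ≤ t ∧ a ^ L ≤ ε
  · refine ⟨Nat.find h, (Nat.find_spec h).1, Or.inr (Nat.find_spec h).2, ?_⟩
    refine le_trans ?_ (geomRatio_mono_right ha (Nat.find_spec h).1)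
    rw [geomRatio_eq_sum, ← nsmul_eq_mul, ← Finset.card_range (Nat.find h), ← Finset.sum_const,
      Finset.card_range]
    refine Finset.sum_le_sum fun i hi => ?_
    have h1 := Nat.find_min h (Finset.mem_range.1 hi)
    by_contra hcon
    exact h1 ⟨((Finset.mem_range.1 hi).le.trans (Nat.find_spec h).1), (not_le.1 hcon).le⟩
  · refine ⟨t, le_rfl, Or.inl rfl, ?_⟩
    rw [geomRatio_eq_sum, ← nsmul_eq_mul]
    nth_rw 1 [← Finset.card_range t]
    rw [← Finset.sum_const]
    refine Finset.sum_le_sum fun i hi => ?_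
    by_contra hcon
    exact h ⟨i, (Finset.mem_range.1 hi).le, (not_le.1 hcon).le⟩

theorem le_of_affine_recursion {a : ℕ → ℝ} {θ e : ℝ} (hθ : 0 ≤ θ) (j L : ℕ)
    (h : ∀ i < L, a (j + i + 1) ≤ θ * a (j + i) + e) :
    a (j + L) ≤ θ ^ L * a j + e * geomRatio θ L := by
  induction L with
  | zero => simp [geomRatio_zero]
  | succ L ih =>
    have h1 := h L (Nat.lt_succ_self L)
    have h2 := mul_le_mul_of_nonneg_left (ih fun i hi => h i (hi.trans (Nat.lt_succ_self L))) hθ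
    rw [geomRatio_succ, pow_succ', ← add_assoc]
    linarith

theorem abs_step_le_one (w : Weights dx dh dy) (x : EuclideanSpace ℝ (Fin dx)) {h : Fin dh → ℝ}
    (hh : ∀ i, |h i| ≤ 1) (i : Fin dh) : |w.step x h i| ≤ 1 := by
  have h0 := gateAt_pos w x h i
  have h1 := gateAt_lt_one w x h i
  have h2 : |w.candidateAt x (w.gateAt x h) h i| < 1 := Real.abs_tanh_lt_one _
  have h3 := hh i
  rw [abs_lt] at h2
  rw [abs_le] at h3
  simp only [Weights.step, Pi.add_apply, Pi.mul_apply, Pi.sub_apply, Pi.one_apply]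
  rw [abs_le]
  constructor <;> nlinarith

theorem abs_hidden_le_one (w : Weights dx dh dy) (x : ℕ → EuclideanSpace ℝ (Fin dx)) (j : ℕ)
    (i : Fin dh) : |w.hidden x j i| ≤ 1 := by
  induction j generalizing i with
  | zero => simp [Weights.hidden]
  | succ j ih => exact abs_step_le_one w _ ih i

theorem l2_hidden_le_sqrt (w : Weights dx dh dy) (x : ℕ → EuclideanSpace ℝ (Fin dx)) (j : ℕ) :
    l2 (w.hidden x j) ≤ √dh := by
  simpa using l2_le_mul_sqrt zero_le_one (abs_hidden_le_one w x j)

theorem l2_step_le {w : Weights dx dh dy} {B : NormBounds} (hw : w.BoundedBy B) {Bx β : ℝ}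
    {x : EuclideanSpace ℝ (Fin dx)} (hx : ‖x‖ ≤ Bx) {h : Fin dh → ℝ}
    (hg : ‖1 - w.gateAt x h‖ + B.Uh * ‖w.gateAt x h‖ ^ 2 ≤ β) :
    l2 (w.step x h) ≤ B.Wh * Bx + β * l2 h := by
  set r := w.gateAt x h
  have hr : ∀ i, |r i| ≤ ‖r‖ := fun i => norm_le_pi_norm r i
  have hr1 : ‖r‖ ≤ 1 := (pi_norm_le_iff_of_nonneg zero_le_one).2 fun i => by
    rw [Real.norm_eq_abs, abs_of_pos (gateAt_pos _ _ _ _)]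
    exact (gateAt_lt_one _ _ _ _).le
  have hA : 0 ≤ B.Wh * Bx := mul_nonneg hw.Wh_nonneg ((norm_nonneg _).trans hx)
  have h1 : l2 ((1 - r) * h) ≤ ‖1 - r‖ * l2 h :=
    l2_mul_le (norm_nonneg _) fun i => norm_le_pi_norm (1 - r) i
  have h2 : l2 (r * w.candidateAt x r h) ≤ ‖r‖ * (B.Wh * Bx + B.Uh * (‖r‖ * l2 h)) :=
    (l2_mul_le (norm_nonneg r) hr).trans
      (mul_le_mul_of_nonneg_left (l2_candidateAt_le hw hx (norm_nonneg r) hr h) (norm_nonneg r))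
  have h3 : ‖r‖ * (B.Wh * Bx) ≤ B.Wh * Bx := mul_le_of_le_one_left hA hr1
  have h4 := mul_le_mul_of_nonneg_right hg (l2_nonneg h)
  have h5 := l2_add_le ((1 - r) * h) (r * w.candidateAt x r h)
  have h6 : ‖r‖ * (B.Wh * Bx + B.Uh * (‖r‖ * l2 h)) =
    ‖r‖ * (B.Wh * Bx) + B.Uh * ‖r‖ ^ 2 * l2 h := by ring
  change l2 ((1 - r) * h + r * w.candidateAt x r h) ≤ _
  linarith

/-- The inputs up to time `t` are bounded by `Bx`, and the gates of `w` by `β`. -/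
structure TrajBounds (w : Weights dx dh dy) (B : NormBounds) (Bx β : ℝ) (t : ℕ)
    (x : ℕ → EuclideanSpace ℝ (Fin dx)) : Prop where
  input_le : ∀ j < t, ‖x j‖ ≤ Bx
  gate_bound : ∀ j < t, ‖1 - w.gate x j‖ + B.Uh * ‖w.gate x j‖ ^ 2 ≤ β

theorem l2_hidden_le_geomRatio {w : Weights dx dh dy} {B : NormBounds} (hw : w.BoundedBy B)
    {Bx β : ℝ} (hβ : 0 ≤ β) {t : ℕ} {x : ℕ → EuclideanSpace ℝ (Fin dx)}
    (ht : TrajBounds w B Bx β t x) (j : ℕ) (hj : j ≤ t) :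
    l2 (w.hidden x j) ≤ B.Wh * Bx * geomRatio β j := by
  induction j with
  | zero => simp [Weights.hidden, geomRatio_zero, l2_zero]
  | succ j ih =>
    have h1 : l2 (w.hidden x (j + 1)) ≤ B.Wh * Bx + β * l2 (w.hidden x j) :=
      l2_step_le hw (ht.input_le j hj) (ht.gate_bound j hj)
    have h2 := mul_le_mul_of_nonneg_left (ih (by omega)) hβ
    rw [geomRatio_succ]
    linarith

/-- A cap `κ` for gates `r` with `b * r ^ 2 ≤ β`. -/
theorem exists_gate_cap {b β : ℝ} (hβ : 0 < β) :
    ∃ κ, 0 < κ ∧ κ ≤ 1 ∧ b * κ ^ 2 ≤ β ∧ ∀ r, 0 < r → r < 1 → b * r ^ 2 ≤ β → r ≤ κ := by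
  rcases le_or_gt b β with h | h
  · exact ⟨1, one_pos, le_rfl, by simpa using h, fun r _ h1 _ => h1.le⟩
  · have hb : 0 < b := hβ.trans h
    have hsq : b * √(β / b) ^ 2 = β := by
      rw [Real.sq_sqrt (by positivity)]
      field_simp
    refine ⟨√(β / b), Real.sqrt_pos.2 (by positivity), ?_, hsq.le, fun r _ _ hr => ?_⟩
    · rw [Real.sqrt_le_one]
      exact (div_le_one hb).2 h.le
    · apply Real.le_sqrt_of_sq_le
      rw [le_div_iff₀ hb]
      linarith

theorem TrajBounds.gate_le {w : Weights dx dh dy} {B : NormBounds} (hw : w.BoundedBy B)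
    {Bx β κ : ℝ} {t : ℕ} {x : ℕ → EuclideanSpace ℝ (Fin dx)} (ht : TrajBounds w B Bx β t x)
    (hκ : ∀ r, 0 < r → r < 1 → B.Uh * r ^ 2 ≤ β → r ≤ κ) (j : ℕ) (hj : j < t) (i : Fin dh) :
    w.gate x j i ≤ κ := by
  have h0 : 0 < w.gate x j i := gateAt_pos _ _ _ _
  refine hκ _ h0 (gateAt_lt_one _ _ _ _) ?_
  have h1 := ht.gate_bound j hj
  have h2 : w.gate x j i ≤ ‖w.gate x j‖ := (le_abs_self _).trans (norm_le_pi_norm (w.gate x j) i)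
  have h3 := mul_le_mul_of_nonneg_left (pow_le_pow_left₀ h0.le h2 2) hw.Uh_nonneg
  have h4 := norm_nonneg (1 - w.gate x j)
  linarith

/-- Two networks with the same cells during the last `L` steps and close matrices have close
states at time `t`. The earlier steps are forgotten: they enter only through `θ ^ L`. -/
theorem l2_hidden_sub_le {w w' : Weights dx dh dy} {B : NormBounds} {Bx β κ η s ε : ℝ} {n t L : ℕ}
    {x : ℕ → EuclideanSpace ℝ (Fin dx)} (hw : w.BoundedBy B) (hw' : w'.BoundedBy B)
    (ht : TrajBounds w B Bx β t x) (ht' : TrajBounds w' B Bx β t x) (ht0 : 0 < t)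
    (hβ : 0 ≤ β) (hκ : 0 < κ) (hκ1 : κ ≤ 1) (hκβ : B.Uh * κ ^ 2 ≤ β)
    (hcap : ∀ r, 0 < r → r < 1 → B.Uh * r ^ 2 ≤ β → r ≤ κ)
    (hA : 0 < B.Wh * Bx) (hη : 0 < η) (hη1 : η ≤ 1) (hs1 : 1 ≤ s) (hs : √dh ≤ s)
    (hn : (geomRatio (β + 2 * B.Ur + B.Ur * B.Uh) t * s + 1) / η ≤ n * η)
    (hL : L ≤ t) (hLε : L = t ∨ (β + 2 * B.Ur + B.Ur * B.Uh) ^ L ≤ ε) (hε : 0 ≤ ε)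
    (hcell : ∀ j, t - L ≤ j → j < t → SameCells w w' κ η (B.Wh * Bx) n (x j))
    (hmat : CloseMatrices w w' B η) :
    l2 (w.hidden x t - w'.hidden x t) ≤ min s (B.Wh * Bx * geomRatio β t) *
      (2 * ε + η * ((4 + 6 * geomRatio (β + 2 * B.Ur + B.Ur * B.Uh) t + 2 * s) *
        geomRatio (β + 2 * B.Ur + B.Ur * B.Uh) t)) := by
  set θ := β + 2 * B.Ur + B.Ur * B.Uh with hθdef
  set G := geomRatio θ t with hGdef
  set H := min s (B.Wh * Bx * geomRatio β t) with hHdef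
  have hUr := hw.Ur_nonneg
  have hUh := hw.Uh_nonneg
  have hUU := mul_nonneg hUr hUh
  have hθ : 0 ≤ θ := by positivity
  have hg1 : 1 ≤ geomRatio β t := one_le_geomRatio hβ ht0
  have hG1 : 1 ≤ G := one_le_geomRatio hθ ht0
  have hAg : B.Wh * Bx ≤ B.Wh * Bx * geomRatio β t := le_mul_of_one_le_right hA.le hg1
  have hH0 : 0 ≤ H := le_min (by linarith) (by linarith)
  have hHs : H ≤ s := min_le_left _ _
  have hstate : ∀ v : Weights dx dh dy, v.BoundedBy B → TrajBounds v B Bx β t x →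
      ∀ j ≤ t, l2 (v.hidden x j) ≤ H := fun v hv hvt j hj =>
    le_min ((l2_hidden_le_sqrt v x j).trans hs)
      ((l2_hidden_le_geomRatio hv hβ hvt j hj).trans
        (mul_le_mul_of_nonneg_left (geomRatio_mono_right hβ hj) hA.le))
  -- the grid exceeds what both activation functions need
  have hlog : Real.log (2 / η) ≤ 1 / η := by
    have h1 : Real.log (1 / η) ≤ 1 / η - 1 := Real.log_le_sub_one_of_pos (by positivity)
    have h2 : Real.log (2 / η) = Real.log 2 + Real.log (1 / η) := by
      rw [← Real.log_mul (by norm_num) (by positivity)]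
      congr 1
      ring
    have := Real.log_two_lt_d9
    linarith
  have hn2 : G * s + Real.log (2 / η) ≤ n * η := by
    refine le_trans ?_ hn
    rw [add_div]
    have h1 : G * s ≤ G * s / η := by
      rw [le_div_iff₀ hη]
      exact mul_le_of_le_one_right (by positivity) hη1
    linarith
  have hrec : ∀ i < L, l2 (w.hidden x (t - L + i + 1) - w'.hidden x (t - L + i + 1)) ≤
      θ * l2 (w.hidden x (t - L + i) - w'.hidden x (t - L + i)) +
        η * (H * (4 + 6 * G + 2 * s)) := by
    intro i hi
    set j := t - L + i with hj
    have hjt : j < t := by omega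
    -- the bound of the states, which vanish at time `0`
    set Hj : ℝ := if j = 0 then 0 else H with hHj
    have hHj0 : 0 ≤ Hj := by
      rw [hHj]
      split_ifs
      · exact le_rfl
      · exact hH0
    have hHjH : Hj ≤ H := by
      rw [hHj]
      split_ifs
      · exact hH0
      · exact le_rfl
    have hstatej : ∀ v : Weights dx dh dy, v.BoundedBy B → TrajBounds v B Bx β t x →
        l2 (v.hidden x j) ≤ Hj := by
      intro v hv hvt
      rw [hHj]
      split_ifs with h0
      · simp [h0, Weights.hidden, l2_zero]
      · exact hstate v hv hvt j hjt.le
    have hGj : θ * Hj ≤ G * H := by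
      rw [hHj]
      split_ifs with h0
      · rw [mul_zero]
        positivity
      · exact mul_le_mul_of_nonneg_right (le_geomRatio hθ (by omega)) hH0
    have hGs : G * H ≤ G * s := mul_le_mul_of_nonneg_left hHs (by linarith)
    have hUrHj : B.Ur * Hj ≤ G * s := by
      have := mul_nonneg hβ hHj0
      have := mul_nonneg hUr hHj0
      have := mul_nonneg hUU hHj0
      have : θ * Hj = β * Hj + 2 * (B.Ur * Hj) + B.Ur * B.Uh * Hj := by ring
      linarith
    have hβHj : β * Hj ≤ G * s := by
      have := mul_nonneg hUr hHj0
      have := mul_nonneg hUU hHj0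
      have : θ * Hj = β * Hj + 2 * (B.Ur * Hj) + B.Ur * B.Uh * Hj := by ring
      linarith
    exact l2_step_sub_step_le (κ := κ) (Hj := Hj) (n := n) hw hw' (ht.input_le j hjt)
      ⟨ht.gate_le hw hcap j hjt, ht.gate_bound j hjt, abs_hidden_le_one w x j, hstatej w hw ht⟩
      ⟨ht'.gate_le hw' hcap j hjt, ht'.gate_bound j hjt, abs_hidden_le_one w' x j,
        hstatej w' hw' ht'⟩
      (hcell j (by omega) hjt) hmat hη hη1 hκ hκ1 hκβ hA (by linarith)
      (le_trans (div_le_div_of_nonneg_right (by linarith) hη.le) hn) hHjH hGj hs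
      (min_le_min hs1 hAg) (min_le_min le_rfl hAg)
  have hfin := le_of_affine_recursion (a := fun j => l2 (w.hidden x j - w'.hidden x j)) hθ
    (t - L) L hrec
  rw [Nat.sub_add_cancel hL] at hfin
  have hinit : θ ^ L * l2 (w.hidden x (t - L) - w'.hidden x (t - L)) ≤ 2 * ε * H := by
    rcases hLε with rfl | h
    · simp only [Nat.sub_self, Weights.hidden, sub_self, l2_zero, mul_zero]
      positivity
    · have h1 : l2 (w.hidden x (t - L) - w'.hidden x (t - L)) ≤ 2 * H := by
        have := l2_sub_le (w.hidden x (t - L)) (w'.hidden x (t - L))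
        have := hstate w hw ht (t - L) (Nat.sub_le _ _)
        have := hstate w' hw' ht' (t - L) (Nat.sub_le _ _)
        linarith
      have := mul_le_mul h h1 (l2_nonneg _) hε
      linarith
  have herr : η * (H * (4 + 6 * G + 2 * s)) * geomRatio θ L ≤
      η * (H * (4 + 6 * G + 2 * s)) * G :=
    mul_le_mul_of_nonneg_left (geomRatio_mono_right hθ hL) (by positivity)
  calc l2 (w.hidden x t - w'.hidden x t)
      ≤ 2 * ε * H + η * (H * (4 + 6 * G + 2 * s)) * G := by linarith
    _ = _ := by ring

/-! ### Patterns of a network on finitely many sequences -/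

section Pattern

variable {J : Type} [Fintype J]

/-- The thresholds `c + (k - n) * η`, one for each sequence, each of the last `L` steps and each
grid point `k`. -/
def gridThreshold (J : Type) (L n : ℕ) (c η : ℝ) : J × Fin L × Fin (2 * n + 1) → ℝ :=
  fun p => c + ((p.2.2 : ℕ) - n : ℝ) * η

/-- The inputs at the steps `t - L, …, t - 1`, repeated for each grid point. -/
def windowInput (x : J → ℕ → EuclideanSpace ℝ (Fin dx)) (t L n : ℕ) :
    J × Fin L × Fin (2 * n + 1) → Fin dx → ℝ :=
  fun p => (x p.1 (t - L + p.2.1)).ofLp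

/-- The pattern of a network: the cells of all coordinates of `W_r x` and `W_h x`, and the rounded
entries of `U_r`, `U_h` and `V`. -/
noncomputable def weightPattern (x : J → ℕ → EuclideanSpace ℝ (Fin dx)) (B : NormBounds)
    (κ η A : ℝ) (t L n n' : ℕ) (w : Weights dx dh dy) :
    ((Fin dh → Finset (J × Fin L × Fin (2 * n + 1))) ×
      (Fin dh → Finset (J × Fin L × Fin (2 * n + 1)))) ×
    ((Fin dh → Fin dh → ℤ) × (Fin dh → Fin dh → ℤ) × (Fin dy → Fin dh → ℤ)) :=
  ((fun i => halfPattern (windowInput x t L n) (gridThreshold J L n (Real.log κ) η) (w.Wr i),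
    fun i => halfPattern (windowInput x t L n) (gridThreshold J L n 0 (η * min 1 A)) (w.Wh i)),
   (fun i j => ⌊w.Ur i j / B.Ur * n'⌋, fun i j => ⌊w.Uh i j / B.Uh * n'⌋,
    fun i j => ⌊w.V i j / B.V * n'⌋))

theorem rangeCardLE_weightPattern {Θ : Type*} (wt : Θ → Weights dx dh dy) {B : NormBounds}
    (hwt : ∀ θ, (wt θ).BoundedBy B) (x : J → ℕ → EuclideanSpace ℝ (Fin dx)) (κ η A : ℝ)
    (t L n n' : ℕ) :
    RangeCardLE (fun θ => weightPattern x B κ η A t L n n' (wt θ))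
      ((((Fintype.card J * (L * (2 * n + 1)) + 1) ^ (dx + 1)) ^ dh *
        ((Fintype.card J * (L * (2 * n + 1)) + 1) ^ (dx + 1)) ^ dh) *
      (((2 * n' + 1) ^ dh) ^ dh * (((2 * n' + 1) ^ dh) ^ dh * ((2 * n' + 1) ^ dh) ^ dy))) := by
  have hhalf : ∀ (c : J × Fin L × Fin (2 * n + 1) → ℝ) (g : Θ → Fin dh → Fin dx → ℝ),
      RangeCardLE (fun θ (i : Fin dh) => halfPattern (windowInput x t L n) c (g θ i))
        (((Fintype.card J * (L * (2 * n + 1)) + 1) ^ (dx + 1)) ^ dh) := by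
    intro c g
    have h := RangeCardLE.pi fun i : Fin dh =>
      (rangeCardLE_halfPattern (windowInput x t L n) c).comp fun θ : Θ => g θ i
    simpa [Fintype.card_prod] using h
  have hfloor : ∀ (p : ℕ) (b : ℝ) (g : Θ → Fin p → Fin dh → ℝ), (∀ θ i j, |g θ i j| ≤ b) →
      RangeCardLE (fun θ i j => ⌊g θ i j / b * n'⌋) (((2 * n' + 1) ^ dh) ^ p) := by
    intro p b g hg
    have h := RangeCardLE.pi fun i : Fin p => RangeCardLE.pi fun j : Fin dh =>
      rangeCardLE_floor (fun θ => g θ i j) b n' fun θ => hg θ i j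
    simpa using h
  refine RangeCardLE.prodMk (RangeCardLE.prodMk (hhalf _ _) (hhalf _ _))
    (RangeCardLE.prodMk (hfloor _ _ _ ?_) (RangeCardLE.prodMk (hfloor _ _ _ ?_) (hfloor _ _ _ ?_)))
  · exact fun θ i j => (abs_entry_le_specNorm _ i j).trans (hwt θ).Ur_le
  · exact fun θ i j => (abs_entry_le_specNorm _ i j).trans (hwt θ).Uh_le
  · exact fun θ i j => (abs_entry_le_specNorm _ i j).trans (hwt θ).V_le

variable {w w' : Weights dx dh dy} {B : NormBounds} {κ η A : ℝ} {t L n n' : ℕ}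
  {x : J → ℕ → EuclideanSpace ℝ (Fin dx)}

theorem sameCells_of_weightPattern_eq
    (h : weightPattern x B κ η A t L n n' w = weightPattern x B κ η A t L n n' w') (b : J) (j : ℕ)
    (hj : t - L ≤ j) (hjt : j < t) : SameCells w w' κ η A n (x b j) := by
  obtain ⟨⟨h1, h2⟩, -⟩ := Prod.ext_iff.1 h |>.imp_left Prod.ext_iff.1
  have key : ∀ {c e : ℝ} {u u' : Fin dx → ℝ},
      halfPattern (windowInput x t L n) (gridThreshold J L n c e) u =
        halfPattern (windowInput x t L n) (gridThreshold J L n c e) u' →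
      ∀ k : Fin (2 * n + 1), c + ((k : ℕ) - n : ℝ) * e ≤ u ⬝ᵥ (x b j).ofLp ↔
        c + ((k : ℕ) - n : ℝ) * e ≤ u' ⬝ᵥ (x b j).ofLp := by
    intro c e u u' huu k
    have hp := Finset.ext_iff.1 huu (b, ⟨j - (t - L), by omega⟩, k)
    rw [mem_halfPattern, mem_halfPattern] at hp
    have hj' : t - L + (j - (t - L)) = j := by omega
    simpa only [gridThreshold, windowInput, hj'] using hp
  exact ⟨fun i k => key (congrFun h1 i) k, fun i k => key (congrFun h2 i) k⟩

theorem closeMatrices_of_weightPattern_eq {d : ℕ} (hw : w.BoundedBy B) (hw' : w'.BoundedBy B)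
    (hη : 0 < η) (hn' : d / η ≤ n') (hd : dh ≤ d) (hdy : dy ≤ d) (hn0 : 0 < n')
    (h : weightPattern x B κ η A t L n n' w = weightPattern x B κ η A t L n n' w') :
    CloseMatrices w w' B η := by
  obtain ⟨-, h2⟩ := Prod.ext_iff.1 h
  obtain ⟨h3, h4⟩ := Prod.ext_iff.1 h2
  obtain ⟨h5, h6⟩ := Prod.ext_iff.1 h4
  have hn0' : (0 : ℝ) < n' := by exact_mod_cast hn0
  have key : ∀ {p : ℕ} {b : ℝ} {M M' : Matrix (Fin p) (Fin dh) ℝ}, p ≤ d → specNorm M ≤ b →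
      specNorm M' ≤ b →
      ((fun i j => ⌊M i j / b * n'⌋) = fun i j => ⌊M' i j / b * n'⌋) →
      ∀ v, l2 ((M - M') *ᵥ v) ≤ η * b * l2 v := by
    intro p b M M' hp hM hM' hfl v
    have hb : 0 ≤ b := (specNorm_nonneg M).trans hM
    refine (l2_mulVec_le_of_entry_le (c := b / n') (by positivity) (fun i j => ?_) v).trans ?_
    · exact abs_sub_le_of_floor_eq hn0 ((abs_entry_le_specNorm M i j).trans hM)
        ((abs_entry_le_specNorm M' i j).trans hM') (congrFun (congrFun hfl i) j)
    · refine mul_le_mul_of_nonneg_right ?_ (l2_nonneg v)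
      have h7 : √(dh : ℝ) * √(p : ℝ) ≤ d := by
        rw [← Real.sqrt_mul (Nat.cast_nonneg _)]
        apply Real.sqrt_le_iff.2 ⟨Nat.cast_nonneg _, ?_⟩
        rw [sq]
        have : (dh : ℝ) ≤ d := by exact_mod_cast hd
        have : (p : ℝ) ≤ d := by exact_mod_cast hp
        gcongr
      have h8 : (d : ℝ) / n' ≤ η := by
        rw [div_le_iff₀ hn0']
        rw [div_le_iff₀ hη] at hn'
        linarith
      calc b / n' * √dh * √p = b / n' * (√dh * √p) := by ring
        _ ≤ b / n' * d := mul_le_mul_of_nonneg_left h7 (by positivity)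
        _ = d / n' * b := by ring
        _ ≤ η * b := mul_le_mul_of_nonneg_right h8 hb
  exact ⟨key hd hw.Ur_le hw'.Ur_le h3, key hd hw.Uh_le hw'.Uh_le h5, key hdy hw.V_le hw'.V_le h6⟩

end Pattern

/-! ### Outputs, margins and losses -/

section Output

variable {σy : ℝ → ℝ} {ρ : ℝ≥0}

theorem abs_output_sub_le (hσ : LipschitzWith ρ σy) {w w' : Weights dx dh dy} {B : NormBounds}
    (hw' : w'.BoundedBy B) {η : ℝ}
    (hmat : CloseMatrices w w' B η) (x : ℕ → EuclideanSpace ℝ (Fin dx)) (t : ℕ) (i : Fin dy) :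
    |w.output σy x t i - w'.output σy x t i| ≤
      ρ * (η * B.V * l2 (w.hidden x t) + B.V * l2 (w.hidden x t - w'.hidden x t)) := by
  have h1 : |w.output σy x t i - w'.output σy x t i| ≤
      ρ * |(w.V *ᵥ w.hidden x t) i - (w'.V *ᵥ w'.hidden x t) i| := by
    simpa [Real.dist_eq, Weights.output] using
      hσ.dist_le_mul ((w.V *ᵥ w.hidden x t) i) ((w'.V *ᵥ w'.hidden x t) i)
  refine h1.trans (mul_le_mul_of_nonneg_left ?_ ρ.2)
  have e : (w.V *ᵥ w.hidden x t) i - (w'.V *ᵥ w'.hidden x t) i =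
      ((w.V - w'.V) *ᵥ w.hidden x t + w'.V *ᵥ (w.hidden x t - w'.hidden x t)) i := by
    simp only [Matrix.sub_mulVec, Matrix.mulVec_sub, Pi.add_apply, Pi.sub_apply]
    ring
  rw [e]
  exact (abs_le_l2 _ i).trans ((l2_add_le _ _).trans (add_le_add (hmat.V _) (hw'.l2_V _)))

theorem abs_output_le (hσ : LipschitzWith ρ σy) (hσ0 : σy 0 = 0) {w : Weights dx dh dy}
    {B : NormBounds} (hw : w.BoundedBy B) (x : ℕ → EuclideanSpace ℝ (Fin dx)) (t : ℕ)
    (i : Fin dy) : |w.output σy x t i| ≤ ρ * (B.V * l2 (w.hidden x t)) := by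
  have h1 : |w.output σy x t i| ≤ ρ * |(w.V *ᵥ w.hidden x t) i| := by
    simpa [Real.dist_eq, hσ0, Weights.output] using hσ.dist_le_mul ((w.V *ᵥ w.hidden x t) i) 0
  exact h1.trans (mul_le_mul_of_nonneg_left ((abs_le_l2 _ i).trans (hw.l2_V _)) ρ.2)

theorem nonempty_ne (hK : 2 ≤ K) (z : Fin K) : Nonempty {j : Fin K // j ≠ z} := by
  have : Nontrivial (Fin K) := Fin.nontrivial_iff_two_le.2 hK
  obtain ⟨j, hj⟩ := exists_ne z
  exact ⟨⟨j, hj⟩⟩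

theorem abs_margin_sub_le (hK : 2 ≤ K) {y y' : Fin K → ℝ} {c : ℝ} (h : ∀ j, |y j - y' j| ≤ c)
    (z : Fin K) : |margin y z - margin y' z| ≤ 2 * c := by
  have := nonempty_ne hK z
  have key : ∀ {u u' : Fin K → ℝ}, (∀ j, |u j - u' j| ≤ c) →
      (⨆ j : {j : Fin K // j ≠ z}, u j) ≤ (⨆ j : {j : Fin K // j ≠ z}, u' j) + c := by
    intro u u' hu
    refine ciSup_le fun j => ?_
    have h1 := le_ciSup (Set.finite_range fun j : {j : Fin K // j ≠ z} => u' j).bddAbove j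
    have h2 := (abs_le.1 (hu j)).2
    linarith
  have h1 := key h
  have h2 := key (u := y') (u' := y) fun j => by
    rw [abs_sub_comm]
    exact h j
  have h3 := abs_le.1 (h z)
  unfold margin
  rw [abs_le]
  constructor <;> linarith [h3.1, h3.2]

theorem margin_zero (hK : 2 ≤ K) (z : Fin K) : margin (fun _ => 0) z = 0 := by
  have := nonempty_ne hK z
  simp [margin]

theorem abs_margin_le (hK : 2 ≤ K) {y : Fin K → ℝ} {c : ℝ} (h : ∀ j, |y j| ≤ c) (z : Fin K) :
    |margin y z| ≤ 2 * c := by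
  have := abs_margin_sub_le hK (y := y) (y' := fun _ => 0) (by simpa using h) z
  rwa [margin_zero hK, sub_zero] at this

theorem margin_nonpos_of_argmax_ne {y : Fin K → ℝ} {z k : Fin K} (hk : k ≠ z)
    (hmax : ∀ j, y j ≤ y k) : margin y z ≤ 0 := by
  have h1 := le_ciSup (Set.finite_range fun j : {j : Fin K // j ≠ z} => y j).bddAbove ⟨k, hk⟩
  have h2 := hmax z
  unfold margin
  simp only at h1
  linarith

/-- The number `1 - u`, clamped to `[0, 1]`: the ramp loss at the rescaled margin `u`. -/
noncomputable def clampLoss (u : ℝ) : ℝ := max 0 (min 1 (1 - u))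

theorem clampLoss_mem (u : ℝ) : clampLoss u ∈ Set.Icc (0 : ℝ) 1 :=
  ⟨le_max_left _ _, max_le zero_le_one (min_le_left _ _)⟩

theorem clampLoss_of_nonpos {u : ℝ} (hu : u ≤ 0) : clampLoss u = 1 := by
  rw [clampLoss, min_eq_left (by linarith), max_eq_right zero_le_one]

theorem abs_clampLoss_sub_le (u v : ℝ) : |clampLoss u - clampLoss v| ≤ |u - v| := by
  unfold clampLoss
  refine (abs_max_sub_max_le_max _ _ _ _).trans ?_
  rw [sub_self, abs_zero, max_eq_right (abs_nonneg _)]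
  refine (abs_min_sub_min_le_max _ _ _ _).trans ?_
  rw [sub_self, abs_zero, max_eq_right (abs_nonneg _), abs_sub_comm u v]
  exact le_of_eq (by congr 1; ring)

theorem continuous_clampLoss : Continuous clampLoss := by
  unfold clampLoss
  fun_prop

/-- For margins at most `1`, the loss is linear in a scale `q ∈ [0, 1]`. -/
theorem clampLoss_mul {q u : ℝ} (hq : 0 ≤ q) (hq1 : q ≤ 1) (hu : u ≤ 1) :
    clampLoss (q * u) = 1 - q * (1 - clampLoss u) := by
  rcases le_or_gt u 0 with h | h
  · rw [clampLoss_of_nonpos h, clampLoss_of_nonpos (mul_nonpos_of_nonneg_of_nonpos hq h)]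
    ring
  · have h1 : q * u ≤ 1 := by nlinarith
    have h2 : 0 ≤ q * u := by positivity
    unfold clampLoss
    rw [min_eq_right (by linarith), min_eq_right (by linarith), max_eq_right (by linarith),
      max_eq_right (by linarith)]
    ring

theorem rampLoss_neg_eq_clampLoss {γ : ℝ} (hγ : 0 < γ) (u : ℝ) :
    rampLoss γ (-u) = clampLoss (u / γ) := by
  unfold rampLoss
  rcases lt_or_ge u 0 with h | h
  · have h1 : 0 < -u := by linarith
    rw [if_pos h1, if_neg (by intro h2; linarith [h2.2]),
      clampLoss_of_nonpos (div_nonpos_of_nonpos_of_nonneg h.le hγ.le), add_zero]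
  · have h1 : ¬ 0 < -u := by linarith
    rw [if_neg h1, zero_add, clampLoss]
    have h2 : 0 ≤ u / γ := by positivity
    rw [min_eq_right (by linarith)]
    split_ifs with h3
    · have h4 : u / γ ≤ 1 := (div_le_one hγ).2 (by linarith [h3.1])
      rw [max_eq_right (by linarith)]
      ring
    · have h4 : 1 ≤ u / γ := (one_le_div hγ).2 (by
        by_contra h5
        exact h3 ⟨by linarith, by linarith⟩)
      rw [max_eq_left (by linarith)]

end Output

/-! ### Patterns of a class of networks -/

/-- The ramp loss of the network `p.1` at margin scale `D / p.2`. -/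
noncomputable def marginLoss (σy : ℝ → ℝ) (D : ℝ) (τ : Fin T) (p : Weights dx dh K × ℝ)
    (s : Sequence dx K T) : ℝ :=
  clampLoss (p.2 * (margin (p.1.output σy (inputs s) (τ + 1)) (s τ).2 / D))

/-- The networks that obey the norm bounds `B`, and the gate bound `β` on all sequences of `Z₀`,
with a scale in `[1, Q]`. -/
def netClass (B : NormBounds) (Z₀ : Set (Sequence dx K T)) (Bx β : ℝ) (τ : Fin T) (Q : ℝ) :
    Set (Weights dx dh K × ℝ) :=
  {p | p.1.BoundedBy B ∧ (∀ s ∈ Z₀, TrajBounds p.1 B Bx β (τ + 1) (inputs s)) ∧ 1 ≤ p.2 ∧ p.2 ≤ Q}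

theorem pow_pow_le_pow {a X : ℝ} {k e f E : ℕ} (ha : 0 ≤ a) (hX : 1 ≤ X) (h : a ≤ X ^ k)
    (hE : e * f ≤ E) : (a ^ e) ^ f ≤ X ^ (k * E) := by
  rw [← pow_mul]
  calc a ^ (e * f) ≤ (X ^ k) ^ (e * f) := pow_le_pow_left₀ ha h _
    _ = X ^ (k * (e * f)) := (pow_mul _ _ _).symm
    _ ≤ _ := pow_le_pow_right₀ hX (Nat.mul_le_mul_left k hE)

/-- The logarithm of the number of patterns is of the order of `d ^ 2`, the number of weights,
times the logarithm of `X = G ^ 2 * d ^ 2 * m`. -/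
theorem pattern_count_le {d m L n n' : ℕ} {G X : ℝ} (hd2 : 2 ≤ d) (hm : 0 < m) (hG : 1 ≤ G)
    (hX : X = G ^ 2 * d ^ 2 * m) (hL : (L : ℝ) ≤ G * m) (hn : (n : ℝ) ≤ X ^ 7 + 1)
    (hn' : (n' : ℝ) ≤ X ^ 4 + 1) (hdx : dx ≤ d) (hdh : dh ≤ d) (hK : K ≤ d) :
    (((((m * 2 * (L * (2 * n + 1)) + 1) ^ (dx + 1)) ^ dh *
        ((m * 2 * (L * (2 * n + 1)) + 1) ^ (dx + 1)) ^ dh) *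
      (((2 * n' + 1) ^ dh) ^ dh * (((2 * n' + 1) ^ dh) ^ dh * ((2 * n' + 1) ^ dh) ^ K)) *
      (2 * m + 1) : ℕ) : ℝ) ≤ X ^ (52 * d ^ 2) := by
  have hd2' : (2 : ℝ) ≤ d := by exact_mod_cast hd2
  have hm' : (1 : ℝ) ≤ m := by exact_mod_cast hm
  have hd4 : (4 : ℝ) ≤ (d : ℝ) ^ 2 := by nlinarith
  have hGX : (d : ℝ) ^ 2 * m * G ≤ X := by
    rw [hX]
    have h1 : G ≤ G ^ 2 := by nlinarith
    have h2 : 0 ≤ (d : ℝ) ^ 2 * m := by positivity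
    nlinarith
  have hmX : 4 * (m : ℝ) ≤ X := by
    have h1 : (4 : ℝ) * m ≤ d ^ 2 * m := by nlinarith
    have h2 : (d : ℝ) ^ 2 * m ≤ d ^ 2 * m * G := le_mul_of_one_le_right (by positivity) hG
    linarith
  have hX4 : 4 ≤ X := by linarith
  have hX1 : 1 ≤ X := by linarith
  have hLX : (L : ℝ) ≤ X := by
    have h1 : G * m ≤ d ^ 2 * m * G := by
      have : 0 ≤ G * m := by positivity
      nlinarith
    linarith
  have hX7 : 1 ≤ X ^ 7 := one_le_pow₀ hX1
  have hX42 : 1 ≤ X ^ 4 := one_le_pow₀ hX1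
  have hP : ((m : ℝ) * 2 * (L * (2 * n + 1)) + 1) ≤ X ^ 11 := by
    have h1 : (2 * n + 1 : ℝ) ≤ 5 * X ^ 7 := by linarith
    have h2 : (m : ℝ) * 2 ≤ X := by linarith
    have h3 : (L : ℝ) * (2 * n + 1) ≤ X * (5 * X ^ 7) :=
      mul_le_mul hLX h1 (by positivity) (by positivity)
    have h4 : (m : ℝ) * 2 * (L * (2 * n + 1)) ≤ X * (X * (5 * X ^ 7)) :=
      mul_le_mul h2 h3 (by positivity) (by positivity)
    have h5 : X * (X * (5 * X ^ 7)) = 5 * X ^ 9 := by ring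
    have h6 : 1 ≤ X ^ 9 := one_le_pow₀ hX1
    have h7 : X ^ 11 = X ^ 2 * X ^ 9 := by ring
    have h8 : 16 ≤ X ^ 2 := by nlinarith
    nlinarith
  have hQ : (2 * n' + 1 : ℝ) ≤ X ^ 6 := by
    have h7 : X ^ 6 = X ^ 2 * X ^ 4 := by ring
    have h8 : 16 ≤ X ^ 2 := by nlinarith
    nlinarith
  have hR : (2 * m + 1 : ℝ) ≤ X := by linarith
  push_cast
  have hrow := pow_pow_le_pow (a := (m : ℝ) * 2 * (L * (2 * n + 1)) + 1) (e := dx + 1) (f := dh)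
    (E := (d + 1) * d) (by positivity) hX1 hP (Nat.mul_le_mul (by omega) hdh)
  have hsq := pow_pow_le_pow (a := 2 * (n' : ℝ) + 1) (e := dh) (f := dh)
    (E := d * d) (by positivity) hX1 hQ (Nat.mul_le_mul hdh hdh)
  have hsq' := pow_pow_le_pow (a := 2 * (n' : ℝ) + 1) (e := dh) (f := K)
    (E := d * d) (by positivity) hX1 hQ (Nat.mul_le_mul hdh hK)
  have hexp : 11 * ((d + 1) * d) + 11 * ((d + 1) * d) +
      (6 * (d * d) + (6 * (d * d) + 6 * (d * d))) + 1 ≤ 52 * d ^ 2 := by nlinarith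
  refine le_trans ?_ (pow_le_pow_right₀ hX1 hexp)
  refine (mul_le_mul (mul_le_mul (mul_le_mul hrow hrow (by positivity) (by positivity))
    (mul_le_mul hsq (mul_le_mul hsq hsq' (by positivity) (by positivity)) (by positivity)
      (by positivity)) (by positivity) (by positivity)) hR (by positivity) (by positivity)).trans
    (le_of_eq ?_)
  ring

section Loss

variable {σy : ℝ → ℝ} {ρ : ℝ≥0}

/-- Two networks with close matrices and close states have close losses. The bound `D` is that of
the margins, so only relative errors matter. -/
theorem abs_marginLoss_sub_le (hσ : LipschitzWith ρ σy) (hσ0 : σy 0 = 0) (hK : 2 ≤ K)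
    {p p' : Weights dx dh K × ℝ} {B : NormBounds} {D H η : ℝ} {τ : Fin T} {m : ℕ} (hm : 0 < m)
    {s : Sequence dx K T} (hw : p.1.BoundedBy B) (hw' : p'.1.BoundedBy B)
    (hmat : CloseMatrices p.1 p'.1 B η) (hη : η ≤ 1 / m) (hD : D = 2 * (ρ * (B.V * H)))
    (hD0 : 0 < D) (hh : l2 (p.1.hidden (inputs s) (τ + 1)) ≤ H)
    (hh' : l2 (p'.1.hidden (inputs s) (τ + 1)) ≤ H)
    (hhh : l2 (p.1.hidden (inputs s) (τ + 1) - p'.1.hidden (inputs s) (τ + 1)) ≤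
      H * (3 * (1 / m)))
    (hq0 : 0 ≤ p.2) (hqm : p.2 ≤ √m) (hq0' : 0 ≤ p'.2) (hqm' : p'.2 ≤ √m)
    (hq : ⌊p.2 / √m * m⌋ = ⌊p'.2 / √m * m⌋) :
    |marginLoss σy D τ p s - marginLoss σy D τ p' s| ≤ 5 / √m := by
  have hm0 : (0 : ℝ) < m := by exact_mod_cast hm
  have hV := hw.V_nonneg
  have hρ : (0 : ℝ) ≤ ρ := ρ.2
  have hout : ∀ i, |p.1.output σy (inputs s) (τ + 1) i - p'.1.output σy (inputs s) (τ + 1) i| ≤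
      2 * D / m := by
    intro i
    refine (abs_output_sub_le hσ hw' hmat _ _ i).trans ?_
    have h1 : η * B.V * l2 (p.1.hidden (inputs s) (τ + 1)) ≤ 1 / m * B.V * H :=
      mul_le_mul (mul_le_mul_of_nonneg_right hη hV) hh (l2_nonneg _) (by positivity)
    have h2 := mul_le_mul_of_nonneg_left hhh hV
    refine (mul_le_mul_of_nonneg_left (add_le_add h1 h2) hρ).trans (le_of_eq ?_)
    rw [hD]
    ring
  have hmar := abs_margin_sub_le hK hout (s τ).2
  have hmar' : |margin (p'.1.output σy (inputs s) (τ + 1)) (s τ).2| ≤ D := by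
    have := abs_margin_le hK (c := ρ * (B.V * H)) (fun i =>
      (abs_output_le hσ hσ0 hw' (inputs s) (τ + 1) i).trans
        (mul_le_mul_of_nonneg_left (mul_le_mul_of_nonneg_left hh' hV) hρ)) (s τ).2
    rwa [← hD] at this
  have hqq := abs_sub_le_of_floor_eq (b := √(m : ℝ)) hm
    (by rwa [abs_of_nonneg hq0]) (by rwa [abs_of_nonneg hq0']) hq
  unfold marginLoss
  set M := margin (p.1.output σy (inputs s) (τ + 1)) (s τ).2
  set M' := margin (p'.1.output σy (inputs s) (τ + 1)) (s τ).2
  refine (abs_clampLoss_sub_le _ _).trans ?_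
  have e : p.2 * (M / D) - p'.2 * (M' / D) =
      p.2 * ((M - M') / D) + (p.2 - p'.2) * (M' / D) := by ring
  rw [e]
  refine (abs_add_le _ _).trans ?_
  rw [abs_mul, abs_mul, abs_div, abs_div, abs_of_pos hD0, abs_of_nonneg hq0]
  have h1 : |M - M'| / D ≤ 4 / m := by
    rw [div_le_iff₀ hD0]
    refine hmar.trans (le_of_eq ?_)
    ring
  have h2 : |M'| / D ≤ 1 := (div_le_one hD0).2 hmar'
  have hmm : √(m : ℝ) * √m = m := Real.mul_self_sqrt hm0.le
  have hs0 : 0 < √(m : ℝ) := Real.sqrt_pos.2 hm0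
  have h3 : √(m : ℝ) / m = 1 / √m := by
    rw [div_eq_div_iff hm0.ne' hs0.ne', one_mul, hmm]
  have h4 : p.2 * (|M - M'| / D) ≤ √m * (4 / m) :=
    mul_le_mul hqm h1 (by positivity) hs0.le
  have h5 : |p.2 - p'.2| * (|M'| / D) ≤ √m / m * 1 :=
    mul_le_mul hqq h2 (by positivity) (by positivity)
  calc p.2 * (|M - M'| / D) + |p.2 - p'.2| * (|M'| / D)
      ≤ √m * (4 / m) + √m / m * 1 := add_le_add h4 h5
    _ = 5 * (√m / m) := by ring
    _ = 5 / √m := by rw [h3, mul_one_div]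

/-- The mesh `1 / X ^ 3` compensates the growth of errors along the sequence. -/
theorem mesh_bounds {d m : ℕ} {G X : ℝ} (hd2 : (2 : ℝ) ≤ d) (hm1 : (1 : ℝ) ≤ m) (hG1 : 1 ≤ G)
    (hX : X = G ^ 2 * d ^ 2 * m) :
    G * d * d ≤ X ∧ 4 ≤ X ∧ 1 / X ^ 3 * ((4 + 6 * G + 2 * √d) * G) ≤ 1 / m ∧
      1 / X ^ 3 ≤ 1 / (m : ℝ) := by
  have hm0 : (0 : ℝ) < m := by linarith
  have hsdd : √(d : ℝ) ≤ d := Real.sqrt_le_self_iff.2 (Or.inr (by linarith))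
  have hGG : G ≤ G ^ 2 := by nlinarith
  have h2 : G * d * d ≤ X := by
    rw [hX]
    have h : G * d * d ≤ G ^ 2 * d * d := by gcongr
    have h' : G ^ 2 * d * d ≤ G ^ 2 * d * d * m := le_mul_of_one_le_right (by positivity) hm1
    linarith
  have hGd : (d : ℝ) ≤ G * d := le_mul_of_one_le_left (by linarith) hG1
  have hGd' : G * 2 ≤ G * d := mul_le_mul_of_nonneg_left hd2 (by linarith)
  have h3 : 4 ≤ X := by nlinarith
  have hX0 : 0 < X := by linarith
  have h4 : G ^ 2 * d * m ≤ X := by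
    rw [hX]
    have : G ^ 2 * m * d * 1 ≤ G ^ 2 * m * d * d :=
      mul_le_mul_of_nonneg_left (by linarith) (by positivity)
    linarith
  have h5 : (4 + 6 * G + 2 * √d) * G ≤ 12 * G ^ 2 * d := by
    have h6 : 4 + 6 * G + 2 * √d ≤ 12 * (G * d) := by linarith
    have := mul_le_mul_of_nonneg_right h6 (by linarith : 0 ≤ G)
    linarith
  have h7 : 12 * X ≤ X ^ 3 := by
    have : 12 ≤ X ^ 2 := by nlinarith
    have := mul_le_mul_of_nonneg_right this hX0.le
    linarith [pow_succ X 2]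
  have h8 : 1 / X ^ 3 * ((4 + 6 * G + 2 * √d) * G) ≤ 1 / m := by
    rw [one_div_mul_eq_div, div_le_div_iff₀ (by positivity) hm0, one_mul]
    have h9 := mul_le_mul_of_nonneg_right h5 hm0.le
    linarith
  refine ⟨h2, h3, h8, le_trans ?_ h8⟩
  have h10 : 1 ≤ (4 + 6 * G + 2 * √d) * G := by
    have := Real.sqrt_nonneg (d : ℝ)
    exact one_le_mul_of_one_le_of_one_le (by linarith) hG1
  exact le_mul_of_one_le_right (by positivity) h10

/-- The class of networks with gate bound `β` has few patterns at scale `5 / √m`. -/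
theorem hasPatterns_marginLoss (hσ : LipschitzWith ρ σy) (hσ0 : σy 0 = 0) (hK : 2 ≤ K)
    {B : NormBounds} {Z₀ : Set (Sequence dx K T)} {Bx β D : ℝ} {τ : Fin T} {d m : ℕ} (hm : 0 < m)
    (hdx : dx ≤ d) (hdh : dh ≤ d) (hKd : K ≤ d) (hβ : 0 < β) (hUr : 0 ≤ B.Ur) (hUh : 0 ≤ B.Uh)
    (hA : 0 < B.Wh * Bx)
    (hD : D = 2 * (ρ * (B.V * min √d (B.Wh * Bx * geomRatio β (τ + 1))))) (hD0 : 0 < D)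
    {X : ℝ} (hX : X = geomRatio (β + 2 * B.Ur + B.Ur * B.Uh) (τ + 1) ^ 2 * d ^ 2 * m) :
    HasPatterns (fun (p : netClass (dh := dh) B Z₀ Bx β τ √m) => marginLoss σy D τ p.1) Z₀ m
      ⌊X ^ (52 * d ^ 2)⌋₊ (5 / √m) := by
  intro ω hω
  set t := (τ : ℕ) + 1 with ht
  set θ := β + 2 * B.Ur + B.Ur * B.Uh with hθ
  set G := geomRatio θ t with hG
  set H := min √d (B.Wh * Bx * geomRatio β t) with hH
  have hθ0 : 0 ≤ θ := by positivity
  have hG1 : 1 ≤ G := one_le_geomRatio hθ0 (Nat.succ_pos _)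
  have hm1 : (1 : ℝ) ≤ m := by exact_mod_cast hm
  have hm0 : (0 : ℝ) < m := by linarith
  have hd2 : (2 : ℝ) ≤ d := by exact_mod_cast hK.trans hKd
  have hsd1 : 1 ≤ √(d : ℝ) := Real.one_le_sqrt.2 (by linarith)
  have hsdd : √(d : ℝ) ≤ d := Real.sqrt_le_self_iff.2 (Or.inr (by linarith))
  have hsm1 : 1 ≤ √(m : ℝ) := Real.one_le_sqrt.2 hm1
  obtain ⟨hX1, hX4, hηm, hηle⟩ := mesh_bounds hd2 hm1 hG1 hX
  have hX0 : 0 < X := by linarith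
  -- the mesh, and the grids it requires
  set η : ℝ := 1 / X ^ 3 with hη
  have hη0 : 0 < η := by positivity
  have hη1 : η ≤ 1 := by
    rw [hη, div_le_one (by positivity)]
    exact one_le_pow₀ (by linarith)
  obtain ⟨κ, hκ0, hκ1, hκβ, hcap⟩ := exists_gate_cap (b := B.Uh) hβ
  obtain ⟨L, hLt, hLε, hLG⟩ := exists_window (ε := 1 / (m : ℝ)) hθ0 t
  have hLm : (L : ℝ) ≤ G * m := by
    rwa [mul_one_div, div_le_iff₀ hm0] at hLG
  set n := ⌈X ^ 7⌉₊ with hn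
  set n' := ⌈X ^ 4⌉₊ with hn'
  have hn0 : 0 < n' := Nat.ceil_pos.2 (by positivity)
  have hgrid : (G * √d + 1) / η ≤ n * η := by
    have h1 : X ^ 7 ≤ n := Nat.le_ceil _
    have h2 : G * √d + 1 ≤ X := by
      have : G * √d ≤ G * d := by gcongr
      have : 1 ≤ G * d := by nlinarith
      nlinarith
    have h3 : X ^ 7 * η ≤ n * η := mul_le_mul_of_nonneg_right h1 hη0.le
    refine le_trans ?_ h3
    rw [hη, div_div_eq_mul_div, div_one]
    have h4 : X ^ 7 * (1 / X ^ 3) = X * X ^ 3 := by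
      field_simp
    rw [h4]
    gcongr
  have hround : (d : ℝ) / η ≤ n' := by
    refine le_trans ?_ (Nat.le_ceil _)
    rw [hη, div_div_eq_mul_div, div_one]
    have : (d : ℝ) ≤ X := by nlinarith
    calc (d : ℝ) * X ^ 3 ≤ X * X ^ 3 := by gcongr
      _ = X ^ 4 := by ring
  -- the pattern
  let z : Fin m × Bool → Sequence dx K T := fun b => if b.2 then (ω b.1).2 else (ω b.1).1
  have hz : ∀ b, z b ∈ Z₀ := by
    rintro ⟨i, b⟩
    cases b
    · exact (hω i).1
    · exact (hω i).2
  let π : netClass (dh := dh) B Z₀ Bx β τ √m → _ := fun p =>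
    (weightPattern (fun b => inputs (z b)) B κ η (B.Wh * Bx) t L n n' p.1.1,
      ⌊p.1.2 / √m * m⌋)
  have hπ : RangeCardLE π _ := RangeCardLE.prodMk
    (rangeCardLE_weightPattern (fun p : netClass (dh := dh) B Z₀ Bx β τ √m => p.1.1)
      (fun p => p.2.1) (fun b => inputs (z b)) κ η (B.Wh * Bx) t L n n')
    (rangeCardLE_floor (fun p : netClass (dh := dh) B Z₀ Bx β τ √m => p.1.2) √m m fun p => by
      rw [abs_of_nonneg (by linarith [p.2.2.2.1])]
      exact p.2.2.2.2)
  obtain ⟨F, hF, hmem⟩ := hπ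
  refine ⟨_, π, F, hF.trans (Nat.le_floor ?_), hmem, ?_⟩
  · rw [Fintype.card_prod, Fintype.card_fin, Fintype.card_bool]
    exact pattern_count_le (by exact_mod_cast hd2) hm hG1 hX hLm
      (Nat.ceil_lt_add_one (by positivity)).le (Nat.ceil_lt_add_one (by positivity)).le hdx hdh hKd
  · intro p p' hpp
    obtain ⟨hpat, hq⟩ := Prod.ext_iff.1 hpp
    have hclose : ∀ b, |marginLoss σy D τ p.1 (z b) - marginLoss σy D τ p'.1 (z b)| ≤ 5 / √m := by
      intro b
      have hw := p.2.1
      have hw' := p'.2.1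
      have hmat := closeMatrices_of_weightPattern_eq (d := d) hw hw' hη0 hround hdh hKd hn0 hpat
      have hhid := l2_hidden_sub_le (s := √d) (ε := 1 / (m : ℝ)) (x := inputs (z b)) hw hw'
        (p.2.2.1 _ (hz b)) (p'.2.2.1 _ (hz b)) (Nat.succ_pos _) hβ.le hκ0 hκ1 hκβ hcap hA hη0
        hη1 hsd1 (Real.sqrt_le_sqrt (by exact_mod_cast hdh)) hgrid hLt hLε (by positivity)
        (fun j hj hjt => sameCells_of_weightPattern_eq hpat b j hj hjt) hmat
      have hHn : l2 (p.1.1.hidden (inputs (z b)) t) ≤ H :=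
        le_min ((l2_hidden_le_sqrt _ _ _).trans (Real.sqrt_le_sqrt (by exact_mod_cast hdh)))
          (l2_hidden_le_geomRatio hw hβ.le (p.2.2.1 _ (hz b)) _ le_rfl)
      have hHn' : l2 (p'.1.1.hidden (inputs (z b)) t) ≤ H :=
        le_min ((l2_hidden_le_sqrt _ _ _).trans (Real.sqrt_le_sqrt (by exact_mod_cast hdh)))
          (l2_hidden_le_geomRatio hw' hβ.le (p'.2.2.1 _ (hz b)) _ le_rfl)
      have hH0 : 0 ≤ H := (l2_nonneg _).trans hHn
      have hhid' : l2 (p.1.1.hidden (inputs (z b)) t - p'.1.1.hidden (inputs (z b)) t) ≤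
          H * (3 * (1 / m)) := by
        refine hhid.trans (mul_le_mul_of_nonneg_left ?_ hH0)
        linarith
      exact abs_marginLoss_sub_le hσ hσ0 hK hm hw hw' hmat hηle hD hD0 hHn hHn' hhid'
        (by linarith [p.2.2.2.1]) p.2.2.2.2 (by linarith [p'.2.2.2.1]) p'.2.2.2.2 hq
    exact fun i => ⟨hclose (i, false), hclose (i, true)⟩

end Loss

/-! ### Continuity and measurability -/

/-- The entries of all weight matrices. -/
def Weights.entries (w : Weights dx dh dy) :
    (Fin dh → Fin dx → ℝ) × (Fin dh → Fin dx → ℝ) × (Fin dh → Fin dh → ℝ) ×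
      (Fin dh → Fin dh → ℝ) × (Fin dy → Fin dh → ℝ) :=
  (w.Wr, w.Wh, w.Ur, w.Uh, w.V)

/-- Weights carry the topology of entrywise convergence. -/
instance : TopologicalSpace (Weights dx dh dy) :=
  TopologicalSpace.induced Weights.entries inferInstance

instance : SecondCountableTopology (Weights dx dh dy) :=
  TopologicalSpace.secondCountableTopology_induced _ _ Weights.entries

section Continuity

variable {Ω : Type*} [TopologicalSpace Ω] {W : Ω → Weights dx dh dy}

theorem continuous_entries (hW : Continuous W) : Continuous fun ω => (W ω).entries :=
  continuous_induced_dom.comp hW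

theorem continuous_Wr (hW : Continuous W) : Continuous fun ω => (W ω).Wr :=
  (continuous_entries hW).fst

theorem continuous_Wh (hW : Continuous W) : Continuous fun ω => (W ω).Wh :=
  (continuous_entries hW).snd.fst

theorem continuous_Ur (hW : Continuous W) : Continuous fun ω => (W ω).Ur :=
  (continuous_entries hW).snd.snd.fst

theorem continuous_Uh (hW : Continuous W) : Continuous fun ω => (W ω).Uh :=
  (continuous_entries hW).snd.snd.snd.fst

theorem continuous_V (hW : Continuous W) : Continuous fun ω => (W ω).V :=
  (continuous_entries hW).snd.snd.snd.snd

theorem continuous_tanh : Continuous Real.tanh := by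
  have : Real.tanh = fun x => 2 * Real.sigmoid (2 * x) - 1 := funext tanh_eq_sigmoid
  rw [this]
  have := continuous_sigmoid
  fun_prop

theorem continuous_gateAt (hW : Continuous W) {x : Ω → EuclideanSpace ℝ (Fin dx)}
    (hx : Continuous x) {h : Ω → Fin dh → ℝ} (hh : Continuous h) :
    Continuous fun ω => (W ω).gateAt (x ω) (h ω) := by
  refine continuous_pi fun i => continuous_sigmoid.comp ?_
  have h1 : Continuous fun ω => (W ω).Wr *ᵥ (x ω).ofLp :=
    (continuous_Wr hW).matrix_mulVec ((PiLp.continuous_ofLp 2 _).comp hx)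
  have h2 : Continuous fun ω => (W ω).Ur *ᵥ h ω := (continuous_Ur hW).matrix_mulVec hh
  exact (continuous_apply i).comp (h1.add h2)

theorem continuous_step (hW : Continuous W) {x : Ω → EuclideanSpace ℝ (Fin dx)}
    (hx : Continuous x) {h : Ω → Fin dh → ℝ} (hh : Continuous h) :
    Continuous fun ω => (W ω).step (x ω) (h ω) := by
  have hg := continuous_gateAt hW hx hh
  have hc : Continuous fun ω => (W ω).candidateAt (x ω) ((W ω).gateAt (x ω) (h ω)) (h ω) := by
    refine continuous_pi fun i => continuous_tanh.comp ?_
    have h1 : Continuous fun ω => (W ω).Wh *ᵥ (x ω).ofLp :=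
      (continuous_Wh hW).matrix_mulVec ((PiLp.continuous_ofLp 2 _).comp hx)
    have h2 : Continuous fun ω => (W ω).Uh *ᵥ ((W ω).gateAt (x ω) (h ω) * h ω) :=
      (continuous_Uh hW).matrix_mulVec (hg.mul hh)
    exact (continuous_apply i).comp (h1.add h2)
  exact ((continuous_const.sub hg).mul hh).add (hg.mul hc)

theorem continuous_hidden (hW : Continuous W) {x : Ω → ℕ → EuclideanSpace ℝ (Fin dx)}
    (hx : ∀ j, Continuous fun ω => x ω j) (t : ℕ) :
    Continuous fun ω => (W ω).hidden (x ω) t := by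
  induction t with
  | zero => exact continuous_const
  | succ t ih => exact continuous_step hW (hx t) ih

theorem continuous_output {σy : ℝ → ℝ} (hσ : Continuous σy) (hW : Continuous W)
    {x : Ω → ℕ → EuclideanSpace ℝ (Fin dx)} (hx : ∀ j, Continuous fun ω => x ω j) (t : ℕ) :
    Continuous fun ω => (W ω).output σy (x ω) t := by
  have h : Continuous fun ω => (W ω).V *ᵥ (W ω).hidden (x ω) t :=
    (continuous_V hW).matrix_mulVec (continuous_hidden hW hx t)
  exact continuous_pi fun i => hσ.comp ((continuous_apply i).comp h)

end Continuity

theorem continuous_inputs (j : ℕ) : Continuous fun s : Sequence dx K T => inputs s j := by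
  unfold inputs
  by_cases h : j < T
  · simp only [h, dif_pos]
    fun_prop
  · simp only [h, dif_neg, not_false_eq_true]
    exact continuous_const

theorem continuous_margin (hK : 2 ≤ K) :
    Continuous fun p : (Fin K → ℝ) × Fin K => margin p.1 p.2 := by
  rw [continuous_prod_of_discrete_right]
  intro z
  refine (LipschitzWith.of_dist_le_mul (K := 2) fun y y' => ?_).continuous
  rw [Real.dist_eq]
  exact abs_margin_sub_le hK (fun j => by
    rw [← Real.dist_eq]
    exact dist_le_pi_dist y y' j) z

theorem continuous_marginLoss (hK : 2 ≤ K) {σy : ℝ → ℝ} (hσ : Continuous σy) (D : ℝ)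
    (τ : Fin T) : Continuous fun ω : (Weights dx dh K × ℝ) × Sequence dx K T =>
      marginLoss σy D τ ω.1 ω.2 := by
  unfold marginLoss
  refine continuous_clampLoss.comp (continuous_fst.snd.mul (Continuous.div_const ?_ D))
  have h1 : Continuous fun ω : (Weights dx dh K × ℝ) × Sequence dx K T =>
      ω.1.1.output σy (inputs ω.2) (τ + 1) :=
    continuous_output hσ continuous_fst.fst (fun j => (continuous_inputs j).comp continuous_snd) _
  have h2 : Continuous fun ω : (Weights dx dh K × ℝ) × Sequence dx K T => (ω.2 τ).2 :=
    ((continuous_apply τ).comp continuous_snd).snd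
  exact (continuous_margin hK).comp (h1.prodMk h2)

/-- A gate bound that holds almost surely holds on the support of the law of the sequence: it is a
closed condition. -/
theorem GateBound.on_support {μ : Measure (Sequence dx K T)} {w : Weights dx dh K} {b β : ℝ}
    {t : ℕ} (h : GateBound μ w b t β) {s : Sequence dx K T} (hs : s ∈ μ.support) (j : ℕ)
    (hj : j < t) : ‖1 - w.gate (inputs s) j‖ + b * ‖w.gate (inputs s) j‖ ^ 2 ≤ β := by
  have hg : Continuous fun s : Sequence dx K T => w.gate (inputs s) j :=
    continuous_gateAt continuous_const (continuous_inputs j)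
      (continuous_hidden continuous_const continuous_inputs j)
  have hclosed : IsClosed {s : Sequence dx K T |
      ‖1 - w.gate (inputs s) j‖ + b * ‖w.gate (inputs s) j‖ ^ 2 ≤ β} :=
    isClosed_le (by fun_prop) continuous_const
  refine Measure.support_subset_of_isClosed hclosed ?_ hs
  filter_upwards [h] with s hs using hs j hj

/-- The sequences in the support of the law whose inputs obey the bound `Bx`. -/
def goodSequences (μ : Measure (Sequence dx K T)) (Bx : ℝ) : Set (Sequence dx K T) :=
  μ.support ∩ {s | ∀ j, ‖(s j).1‖ ≤ Bx}

theorem ae_mem_goodSequences {μ : Measure (Sequence dx K T)} {Bx : ℝ}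
    (hx : ∀ᵐ s ∂μ, ∀ j : Fin T, ‖(s j).1‖ ≤ Bx) : ∀ᵐ s ∂μ, s ∈ goodSequences μ Bx := by
  filter_upwards [hx, Measure.support_mem_ae] with s h1 h2 using ⟨h2, h1⟩

theorem GateBound.trajBounds {μ : Measure (Sequence dx K T)} {w : Weights dx dh K}
    {B : NormBounds} {Bx β : ℝ} {τ : Fin T} (h : GateBound μ w B.Uh (τ + 1) β)
    {s : Sequence dx K T} (hs : s ∈ goodSequences μ Bx) :
    TrajBounds w B Bx β (τ + 1) (inputs s) := by
  refine ⟨fun j hj => ?_, fun j hj => h.on_support hs.1 j hj⟩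
  have hjT : j < T := by omega
  simp only [inputs, hjT, dif_pos]
  exact hs.2 _

/-- The deviation inequality for the networks with a given gate bound. -/
theorem class_deviation {σy : ℝ → ℝ} {ρ : ℝ≥0} (hσ : LipschitzWith ρ σy) (hσ0 : σy 0 = 0)
    (hK : 2 ≤ K) {B : NormBounds} (μ : Measure (Sequence dx K T)) [IsProbabilityMeasure μ]
    {Bx β D : ℝ} (hx : ∀ᵐ s ∂μ, ∀ j : Fin T, ‖(s j).1‖ ≤ Bx) {τ : Fin T} {d m : ℕ} (hm : 0 < m)
    (hdx : dx ≤ d) (hdh : dh ≤ d) (hKd : K ≤ d) (hβ : 0 < β) (hUr : 0 ≤ B.Ur) (hUh : 0 ≤ B.Uh)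
    (hA : 0 < B.Wh * Bx)
    (hD : D = 2 * (ρ * (B.V * min √d (B.Wh * Bx * geomRatio β (τ + 1))))) (hD0 : 0 < D)
    {X : ℝ} (hX : X = geomRatio (β + 2 * B.Ur + B.Ur * B.Uh) (τ + 1) ^ 2 * d ^ 2 * m)
    {v : ℝ} (hv : 0 ≤ v) :
    Measure.pi (fun _ : Fin m => μ)
      {S | ∃ p ∈ netClass (dh := dh) B (goodSequences μ Bx) Bx β τ √m,
        ∑ i, marginLoss σy D τ p (S i) + (√m + m * (v + 2 * (5 / √m))) <
          m * ∫ s, marginLoss σy D τ p s ∂μ} ≤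
      ENNReal.ofReal (2 * (X ^ (52 * d ^ 2) * Real.exp (-(m * v ^ 2 / 2)))) := by
  have hcont := continuous_marginLoss (dx := dx) (dh := dh) hK hσ.continuous D τ
  have hX0 : 0 ≤ X := by
    rw [hX]
    positivity
  have h := uniform_deviation hm μ
    (hasPatterns_marginLoss hσ hσ0 hK hm hdx hdh hKd hβ hUr hUh hA hD hD0 hX)
    (fun p s => clampLoss_mem _)
    (fun p => (hcont.comp (continuous_const.prodMk continuous_id)).measurable)
    (fun s => hcont.comp (continuous_subtype_val.prodMk continuous_const))
    (ae_mem_goodSequences hx) v hv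
  have hset : {S : Fin m → Sequence dx K T |
      ∃ p ∈ netClass (dh := dh) B (goodSequences μ Bx) Bx β τ √m,
        ∑ i, marginLoss σy D τ p (S i) + (√m + m * (v + 2 * (5 / √m))) <
          m * ∫ s, marginLoss σy D τ p s ∂μ} =
      {S | ∃ p : netClass (dh := dh) B (goodSequences μ Bx) Bx β τ √m,
        ∑ i, marginLoss σy D τ p.1 (S i) + (√m + m * (v + 2 * (5 / √m))) <
          m * ∫ s, marginLoss σy D τ p.1 s ∂μ} := by
    ext S
    simp only [Set.mem_ofPred_eq, Subtype.exists, exists_prop]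
  rw [hset]
  refine h.trans (ENNReal.ofReal_le_ofReal ?_)
  have := Nat.floor_le (pow_nonneg hX0 (52 * d ^ 2))
  gcongr

/-! ### Union over the gate bounds -/

/-- The margin bound of the networks with gate bound `b`: twice the bound of their outputs. -/
noncomputable def classMargin (ρ : ℝ≥0) (B : NormBounds) (Bx : ℝ) (d t : ℕ) (b : ℝ) : ℝ :=
  2 * (ρ * (B.V * min √d (B.Wh * Bx * geomRatio b t)))

/-- The number `G ^ 2 * d ^ 2 * m`, in which the number of patterns is polynomial. -/
noncomputable def classSize (B : NormBounds) (d m t : ℕ) (b : ℝ) : ℝ :=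
  geomRatio (b + 2 * B.Ur + B.Ur * B.Uh) t ^ 2 * d ^ 2 * m

/-- The deviation at confidence `δ * 2 ^ (-k)`. The first summand alone depends on `δ`, and its
constant `2` is below the `9 / 2` of the term `3 * √(log (2 / δ) / (2 * m))`. -/
noncomputable def classSlack (δ X : ℝ) (d m k : ℕ) : ℝ :=
  √(2 * Real.log (2 / δ) / m) + √(2 * (52 * d ^ 2 * Real.log X + k * Real.log 2) / m)

theorem classSlack_nonneg (δ X : ℝ) (d m k : ℕ) : 0 ≤ classSlack δ X d m k :=
  add_nonneg (Real.sqrt_nonneg _) (Real.sqrt_nonneg _)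

theorem tail_classSlack_le {δ X : ℝ} {d m k : ℕ} (hδ0 : 0 < δ) (hδ1 : δ < 1) (hX : 1 ≤ X)
    (hm : 0 < m) :
    2 * (X ^ (52 * d ^ 2) * Real.exp (-(m * classSlack δ X d m k ^ 2 / 2))) ≤
      δ * (1 / 2) ^ k := by
  have hm0 : (0 : ℝ) < m := by exact_mod_cast hm
  have hlogδ : 0 ≤ Real.log (2 / δ) := Real.log_nonneg ((one_le_div hδ0).2 (by linarith))
  have hlogX : 0 ≤ Real.log X := Real.log_nonneg hX
  have hlog2 : 0 ≤ Real.log 2 := Real.log_nonneg (by norm_num)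
  set a := 2 * Real.log (2 / δ) / m with ha
  set c := 2 * (52 * d ^ 2 * Real.log X + k * Real.log 2) / m with hc
  have ha0 : 0 ≤ a := by positivity
  have hc0 : 0 ≤ c := by positivity
  have hsq : a + c ≤ classSlack δ X d m k ^ 2 := by
    have h1 : classSlack δ X d m k = √a + √c := rfl
    rw [h1, add_sq, Real.sq_sqrt ha0, Real.sq_sqrt hc0]
    have := mul_nonneg (Real.sqrt_nonneg a) (Real.sqrt_nonneg c)
    linarith
  have hle : Real.log (2 / δ) + (52 * d ^ 2 * Real.log X + k * Real.log 2) ≤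
      m * classSlack δ X d m k ^ 2 / 2 := by
    have h1 := mul_le_mul_of_nonneg_left hsq hm0.le
    have h2 : m * (a + c) =
        2 * (Real.log (2 / δ) + (52 * d ^ 2 * Real.log X + k * Real.log 2)) := by
      rw [ha, hc]
      field_simp
    linarith
  have hX0 : 0 < X := by linarith
  have hexp : Real.exp (Real.log (2 / δ) + (52 * d ^ 2 * Real.log X + k * Real.log 2)) =
      2 / δ * (X ^ (52 * d ^ 2) * 2 ^ k) := by
    rw [Real.exp_add, Real.exp_add, Real.exp_log (by positivity)]
    have h1 : (52 * (d : ℝ) ^ 2) * Real.log X = ((52 * d ^ 2 : ℕ) : ℝ) * Real.log X := by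
      push_cast
      ring
    rw [h1, Real.exp_nat_mul, Real.exp_nat_mul, Real.exp_log hX0, Real.exp_log (by norm_num)]
  have h3 : Real.exp (-(m * classSlack δ X d m k ^ 2 / 2)) ≤
      (2 / δ * (X ^ (52 * d ^ 2) * 2 ^ k))⁻¹ := by
    rw [← hexp, ← Real.exp_neg]
    exact Real.exp_le_exp.2 (neg_le_neg hle)
  have h4 : 0 < X ^ (52 * d ^ 2) := by positivity
  calc 2 * (X ^ (52 * d ^ 2) * Real.exp (-(m * classSlack δ X d m k ^ 2 / 2)))
      ≤ 2 * (X ^ (52 * d ^ 2) * (2 / δ * (X ^ (52 * d ^ 2) * 2 ^ k))⁻¹) := by gcongr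
    _ = δ * (1 / 2) ^ k := by
      rw [one_div, inv_pow]
      field_simp

/-- The gate bounds `b` whose geometric sums are at most `exp p` and `exp n`. Since the gates lie
in `(0, 1)`, bounds above `1 + B.Uh` are of no use. -/
def admissibleBounds (B : NormBounds) (t p n : ℕ) : Set ℝ :=
  {b | b ∈ Set.Icc 0 (1 + B.Uh) ∧ geomRatio b t ≤ Real.exp p ∧
    geomRatio (b + 2 * B.Ur + B.Ur * B.Uh) t ≤ Real.exp n}

theorem isCompact_admissibleBounds (B : NormBounds) (t p n : ℕ) :
    IsCompact (admissibleBounds B t p n) := by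
  have h1 := continuous_geomRatio t
  have h2 : Continuous fun b => geomRatio (b + 2 * B.Ur + B.Ur * B.Uh) t :=
    h1.comp (by fun_prop)
  exact isCompact_Icc.inter_right
    ((isClosed_le h1 continuous_const).inter (isClosed_le h2 continuous_const))

/-- The samples for which the deviation inequality fails in the class number `(p, n)`. A single
gate bound represents the class: the greatest admissible one. -/
def badSamples (dh : ℕ) (σy : ℝ → ℝ) (ρ : ℝ≥0) (B : NormBounds) (μ : Measure (Sequence dx K T))
    (Bx : ℝ) (τ : Fin T) (d m : ℕ) (δ : ℝ) (p n : ℕ) : Set (Fin m → Sequence dx K T) :=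
  {S | ∃ b, IsGreatest (admissibleBounds B (τ + 1) p n) b ∧ 0 < b ∧
    ∃ x ∈ netClass (dh := dh) B (goodSequences μ Bx) Bx b τ √m,
      ∑ i, marginLoss σy (classMargin ρ B Bx d (τ + 1) b) τ x (S i) +
        (√m + m * (classSlack δ (classSize B d m (τ + 1) b) d m (p + n + 2) + 2 * (5 / √m))) <
          m * ∫ s, marginLoss σy (classMargin ρ B Bx d (τ + 1) b) τ x s ∂μ}

theorem classMargin_pos {ρ : ℝ≥0} {B : NormBounds} {Bx b : ℝ} {d t : ℕ} (hρ : 0 < ρ)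
    (hV : 0 < B.V) (hA : 0 < B.Wh * Bx) (hd : 0 < d) (hb : 0 ≤ b) (ht : 0 < t) :
    0 < classMargin ρ B Bx d t b := by
  have h1 : 0 < geomRatio b t := by linarith [one_le_geomRatio hb ht]
  have h2 : 0 < min √(d : ℝ) (B.Wh * Bx * geomRatio b t) :=
    lt_min (Real.sqrt_pos.2 (by exact_mod_cast hd)) (by positivity)
  have h3 : (0 : ℝ) < ρ := hρ
  unfold classMargin
  positivity

theorem one_le_classSize {B : NormBounds} {d m t : ℕ} {b : ℝ} (hd : 0 < d) (hm : 0 < m)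
    (ht : 0 < t) (hθ : 0 ≤ b + 2 * B.Ur + B.Ur * B.Uh) : 1 ≤ classSize B d m t b := by
  have h1 : 1 ≤ geomRatio (b + 2 * B.Ur + B.Ur * B.Uh) t := one_le_geomRatio hθ ht
  have h2 : (1 : ℝ) ≤ d := by exact_mod_cast hd
  have h3 : (1 : ℝ) ≤ m := by exact_mod_cast hm
  exact one_le_mul_of_one_le_of_one_le
    (one_le_mul_of_one_le_of_one_le (one_le_pow₀ h1) (one_le_pow₀ h2)) h3

section Union

variable {σy : ℝ → ℝ} {ρ : ℝ≥0} {B : NormBounds} {μ : Measure (Sequence dx K T)}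
  [IsProbabilityMeasure μ] {Bx : ℝ} {τ : Fin T} {d m : ℕ} {δ : ℝ}

theorem measure_badSamples_le (hσ : LipschitzWith ρ σy) (hσ0 : σy 0 = 0) (hK : 2 ≤ K)
    (hx : ∀ᵐ s ∂μ, ∀ j : Fin T, ‖(s j).1‖ ≤ Bx) (hm : 0 < m)
    (hdx : dx ≤ d) (hdh : dh ≤ d) (hKd : K ≤ d) (hUr : 0 ≤ B.Ur) (hUh : 0 ≤ B.Uh)
    (hρ : 0 < ρ) (hV : 0 < B.V) (hA : 0 < B.Wh * Bx) (hδ0 : 0 < δ) (hδ1 : δ < 1) (p n : ℕ) :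
    Measure.pi (fun _ : Fin m => μ) (badSamples dh σy ρ B μ Bx τ d m δ p n) ≤
      ENNReal.ofReal (δ * (1 / 2) ^ (p + n + 2)) := by
  by_cases h : ∃ b, IsGreatest (admissibleBounds B (τ + 1) p n) b ∧ 0 < b
  · obtain ⟨b, hb, hb0⟩ := h
    have hd : 0 < d := by omega
    have hD0 := classMargin_pos hρ hV hA hd hb0.le (Nat.succ_pos τ)
    have hX1 : 1 ≤ classSize B d m (τ + 1) b :=
      one_le_classSize hd hm (Nat.succ_pos _) (by positivity)
    refine le_trans (measure_mono ?_) ((class_deviation hσ hσ0 hK μ hx hm hdx hdh hKd hb0 hUr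
      hUh hA rfl hD0 rfl (classSlack_nonneg δ (classSize B d m (τ + 1) b) d m (p + n + 2))).trans
        (ENNReal.ofReal_le_ofReal (tail_classSlack_le hδ0 hδ1 hX1 hm)))
    rintro S ⟨b', hb', -, x, hx, hS⟩
    obtain rfl := hb'.unique hb
    exact ⟨x, hx, hS⟩
  · have : badSamples dh σy ρ B μ Bx τ d m δ p n = ∅ := by
      refine Set.eq_empty_of_forall_notMem ?_
      rintro S ⟨b, hb, hb0, -⟩
      exact h ⟨b, hb, hb0⟩
    rw [this, measure_empty]
    exact zero_le

theorem measure_iUnion_badSamples_le (hσ : LipschitzWith ρ σy) (hσ0 : σy 0 = 0) (hK : 2 ≤ K)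
    (hx : ∀ᵐ s ∂μ, ∀ j : Fin T, ‖(s j).1‖ ≤ Bx) (hm : 0 < m)
    (hdx : dx ≤ d) (hdh : dh ≤ d) (hKd : K ≤ d) (hUr : 0 ≤ B.Ur) (hUh : 0 ≤ B.Uh)
    (hρ : 0 < ρ) (hV : 0 < B.V) (hA : 0 < B.Wh * Bx) (hδ0 : 0 < δ) (hδ1 : δ < 1) :
    Measure.pi (fun _ : Fin m => μ)
      (⋃ k : ℕ × ℕ, badSamples dh σy ρ B μ Bx τ d m δ k.1 k.2) ≤ ENNReal.ofReal δ := by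
  have h1 : ∀ k : ℕ × ℕ, ENNReal.ofReal (δ * (1 / 2) ^ (k.1 + k.2 + 2)) =
      ENNReal.ofReal δ * ((2 : ℝ≥0∞)⁻¹ ^ (k.1 + 1) * (2 : ℝ≥0∞)⁻¹ ^ (k.2 + 1)) := by
    intro k
    rw [ENNReal.ofReal_mul hδ0.le, ENNReal.ofReal_pow (by norm_num), one_div,
      ENNReal.ofReal_inv_of_pos (by norm_num), ENNReal.ofReal_ofNat, ← pow_add]
    congr 2
    ring
  have h2 : ∑' n : ℕ, (2 : ℝ≥0∞)⁻¹ ^ (n + 1) = 1 := by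
    rw [ENNReal.tsum_geometric_add_one, ENNReal.one_sub_inv_two, inv_inv,
      ENNReal.inv_mul_cancel (by norm_num) (by norm_num)]
  have h3 : ∑' k : ℕ × ℕ, ENNReal.ofReal (δ * (1 / 2) ^ (k.1 + k.2 + 2)) =
      ENNReal.ofReal δ := by
    simp only [h1]
    rw [ENNReal.tsum_mul_left, ENNReal.tsum_prod
      (f := fun a b : ℕ => (2 : ℝ≥0∞)⁻¹ ^ (a + 1) * (2 : ℝ≥0∞)⁻¹ ^ (b + 1))]
    simp only [ENNReal.tsum_mul_left, h2, mul_one]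
  have h4 : ∀ k : ℕ × ℕ, Measure.pi (fun _ : Fin m => μ)
      (badSamples dh σy ρ B μ Bx τ d m δ k.1 k.2) ≤
        ENNReal.ofReal (δ * (1 / 2) ^ (k.1 + k.2 + 2)) := fun k =>
    measure_badSamples_le hσ hσ0 hK hx hm hdx hdh hKd hUr hUh hρ hV hA hδ0 hδ1 k.1 k.2
  rw [← h3]
  exact (measure_iUnion_le _).trans (ENNReal.tsum_le_tsum h4)

end Union

/-! ### From the deviation to the margin bound -/

theorem margin_measurable (hK : 2 ≤ K) {σy : ℝ → ℝ} (hσ : Continuous σy)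
    (w : Weights dx dh K) (τ : Fin T) : Measurable fun s : Sequence dx K T =>
      margin (w.output σy (inputs s) (τ + 1)) (s τ).2 := by
  have h1 : Continuous fun s : Sequence dx K T => w.output σy (inputs s) (τ + 1) :=
    continuous_output hσ continuous_const continuous_inputs _
  have h2 : Continuous fun s : Sequence dx K T => (s τ).2 := (continuous_apply τ).snd
  exact ((continuous_margin hK).comp (h1.prodMk h2)).measurable

theorem integrable_marginLoss (hK : 2 ≤ K) {σy : ℝ → ℝ} (hσ : Continuous σy)
    (μ : Measure (Sequence dx K T)) [IsProbabilityMeasure μ] (D : ℝ) (τ : Fin T)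
    (x : Weights dx dh K × ℝ) : Integrable (marginLoss σy D τ x) μ := by
  have hmeas : Measurable (marginLoss σy D τ x) :=
    continuous_clampLoss.measurable.comp
      (((margin_measurable hK hσ x.1 τ).div_const D).const_mul x.2)
  refine Integrable.of_bound hmeas.aestronglyMeasurable 1 (ae_of_all _ fun s => ?_)
  have := clampLoss_mem (x.2 * (margin (x.1.output σy (inputs s) (τ + 1)) (s τ).2 / D))
  rw [Real.norm_eq_abs, marginLoss, abs_of_nonneg this.1]
  exact this.2

theorem errProb_le_integral (hK : 2 ≤ K) {σy : ℝ → ℝ} (hσ : Continuous σy)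
    (μ : Measure (Sequence dx K T)) [IsProbabilityMeasure μ] {φ : (Fin K → ℝ) → Fin K}
    (hφ : ∀ (y : Fin K → ℝ) (j : Fin K), y j ≤ y (φ y)) {D q : ℝ} (hD : 0 < D) (hq : 0 ≤ q)
    (τ : Fin T) (w : Weights dx dh K) :
    errProb μ φ w σy τ ≤ ∫ s, marginLoss σy D τ (w, q) s ∂μ := by
  set A : Set (Sequence dx K T) := {s | margin (w.output σy (inputs s) (τ + 1)) (s τ).2 ≤ 0}
  have hA : MeasurableSet A := measurableSet_le (margin_measurable hK hσ w τ) measurable_const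
  calc errProb μ φ w σy τ ≤ μ.real A :=
        measureReal_mono fun s hs => margin_nonpos_of_argmax_ne hs (hφ _)
    _ = ∫ s, A.indicator 1 s ∂μ := (integral_indicator_one hA).symm
    _ ≤ ∫ s, marginLoss σy D τ (w, q) s ∂μ := by
        refine integral_mono ((integrable_const (1 : ℝ)).indicator hA)
          (integrable_marginLoss hK hσ μ D τ _) fun s => ?_
        by_cases hs : s ∈ A
        · rw [Set.indicator_of_mem hs, marginLoss, clampLoss_of_nonpos]
          · rfl
          · exact mul_nonpos_of_nonneg_of_nonpos hq (div_nonpos_of_nonpos_of_nonneg hs hD.le)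
        · rw [Set.indicator_of_notMem hs]
          exact (clampLoss_mem _).1

theorem errProb_le_one (μ : Measure (Sequence dx K T)) [IsProbabilityMeasure μ]
    (φ : (Fin K → ℝ) → Fin K) (w : Weights dx dh K) (σy : ℝ → ℝ) (τ : Fin T) :
    errProb μ φ w σy τ ≤ 1 := measureReal_le_one

theorem empRisk_eq {m : ℕ} (w : Weights dx dh K) (σy : ℝ → ℝ) {γ D : ℝ} (hγ : 0 < γ)
    (hD : 0 < D) (τ : Fin T) (S : Fin m → Sequence dx K T) :
    empRisk w σy γ τ S = 1 / m * ∑ i, marginLoss σy D τ (w, D / γ) (S i) := by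
  unfold empRisk
  congr 1
  refine Finset.sum_congr rfl fun i _ => ?_
  rw [rampLoss_neg_eq_clampLoss hγ, marginLoss]
  congr 1
  field_simp

/-- The complexity term as margin ratio times rate. -/
theorem complexity_eq (d : ℕ) (ρ : ℝ≥0) (B : NormBounds) (Bx β γ : ℝ) (t m : ℕ) :
    complexity d ρ B Bx β γ t m = classMargin ρ B Bx d t β / 2 / γ *
      (d * √(Real.log (geomRatio (β + 2 * B.Ur + B.Ur * B.Uh) t * d * √m)) / √m) := by
  unfold complexity classMargin
  rw [div_mul_div_comm, mul_comm γ]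
  congr 1
  ring

theorem classMargin_mono {ρ : ℝ≥0} {B : NormBounds} {Bx b b' : ℝ} {d t : ℕ}
    (hV : 0 ≤ B.V) (hA : 0 ≤ B.Wh * Bx) (hb : 0 ≤ b) (hbb : b ≤ b') :
    classMargin ρ B Bx d t b ≤ classMargin ρ B Bx d t b' := by
  have h1 := geomRatio_mono_left hb hbb t
  have h2 : (0 : ℝ) ≤ ρ := ρ.2
  unfold classMargin
  gcongr

theorem classMargin_nonneg {ρ : ℝ≥0} {B : NormBounds} {Bx b : ℝ} {d t : ℕ}
    (hV : 0 ≤ B.V) (hA : 0 ≤ B.Wh * Bx) (hb : 0 ≤ b) : 0 ≤ classMargin ρ B Bx d t b := by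
  have h1 := geomRatio_nonneg hb t
  have h2 : (0 : ℝ) ≤ ρ := ρ.2
  have h3 : 0 ≤ min √(d : ℝ) (B.Wh * Bx * geomRatio b t) :=
    le_min (Real.sqrt_nonneg _) (mul_nonneg hA h1)
  unfold classMargin
  positivity

theorem complexity_nonneg {ρ : ℝ≥0} {B : NormBounds} {Bx b γ : ℝ} {d t m : ℕ}
    (hV : 0 ≤ B.V) (hA : 0 ≤ B.Wh * Bx) (hb : 0 ≤ b) (hγ : 0 < γ) :
    0 ≤ complexity d ρ B Bx b γ t m := by
  rw [complexity_eq]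
  have := classMargin_nonneg (ρ := ρ) (d := d) (t := t) hV hA hb
  positivity

theorem complexity_mono {ρ : ℝ≥0} {B : NormBounds} {Bx b b' γ : ℝ} {d t m : ℕ}
    (hV : 0 ≤ B.V) (hA : 0 ≤ B.Wh * Bx) (hUr : 0 ≤ B.Ur) (hUh : 0 ≤ B.Uh) (hb : 0 ≤ b)
    (hbb : b ≤ b') (hγ : 0 < γ) (hd : 0 < d) (hm : 0 < m) (ht : 0 < t) :
    complexity d ρ B Bx b γ t m ≤ complexity d ρ B Bx b' γ t m := by
  rw [complexity_eq, complexity_eq]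
  have h1 := classMargin_mono (ρ := ρ) (d := d) (t := t) hV hA hb hbb
  have h2 := classMargin_nonneg (ρ := ρ) (d := d) (t := t) hV hA (hb.trans hbb)
  have hUU := mul_nonneg hUr hUh
  have h3 : geomRatio (b + 2 * B.Ur + B.Ur * B.Uh) t ≤
      geomRatio (b' + 2 * B.Ur + B.Ur * B.Uh) t :=
    geomRatio_mono_left (by positivity) (by linarith) t
  have h4 : 0 < geomRatio (b + 2 * B.Ur + B.Ur * B.Uh) t := by
    linarith [one_le_geomRatio (by positivity : 0 ≤ b + 2 * B.Ur + B.Ur * B.Uh) ht]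
  have h5 : (0 : ℝ) < d := by exact_mod_cast hd
  have h6 : (0 : ℝ) < √m := Real.sqrt_pos.2 (by exact_mod_cast hm)
  gcongr

/-- The rate `d * √Λ / √m` absorbs all the terms of the deviation that do not depend on `δ`. -/
theorem slack_le_rate {δ G G₁ X Λ : ℝ} {d m p n : ℕ} (hd : 2 ≤ d) (hm : 0 < m) (hG₁ : 1 ≤ G₁)
    (hG0 : 0 < G) (hG : G ≤ Real.exp 1 * G₁) (hpn : p ≤ n) (hn : (n : ℝ) ≤ Real.log G₁ + 1)
    (hX : X = G ^ 2 * d ^ 2 * m) (hΛ : Λ = Real.log (G₁ * d * √m)) :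
    11 / √m + classSlack δ X d m (p + n + 2) ≤
      √(2 * Real.log (2 / δ) / m) + 30 * (d * √Λ / √m) ∧ 1 ≤ d * √Λ := by
  have hd2 : (2 : ℝ) ≤ d := by exact_mod_cast hd
  have hm1 : (1 : ℝ) ≤ m := by exact_mod_cast hm
  have hm0 : (0 : ℝ) < m := by linarith
  have hsm1 : 1 ≤ √(m : ℝ) := Real.one_le_sqrt.2 hm1
  have hsm0 : 0 < √(m : ℝ) := by linarith
  have hlogd : Real.log 2 ≤ Real.log d := Real.log_le_log (by norm_num) hd2
  have hlogG : 0 ≤ Real.log G₁ := Real.log_nonneg hG₁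
  have hlogm : 0 ≤ Real.log √(m : ℝ) := Real.log_nonneg hsm1
  have hΛsum : Λ = Real.log G₁ + Real.log d + Real.log √(m : ℝ) := by
    rw [hΛ, Real.log_mul (by positivity) (by positivity), Real.log_mul (by positivity)
      (by positivity)]
  have hl2 := Real.log_two_gt_d9
  have hl2' := Real.log_two_lt_d9
  have hΛ69 : 0.69 ≤ Λ := by linarith
  have hsΛ : 0.8 ≤ √Λ := Real.le_sqrt_of_sq_le (by norm_num; linarith)
  have hdΛ : 1.6 ≤ d * √Λ := by nlinarith
  refine ⟨?_, by linarith⟩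
  have hlogX : Real.log X ≤ 2 * (Λ + 1) := by
    have h1 : X = (G * d * √m) ^ 2 := by
      rw [hX, mul_pow, mul_pow, Real.sq_sqrt hm0.le]
    have h2 : Real.log G ≤ Real.log G₁ + 1 := by
      have := Real.log_le_log hG0 hG
      rw [Real.log_mul (Real.exp_pos _).ne' (by positivity), Real.log_exp] at this
      linarith
    rw [h1, Real.log_pow, Real.log_mul (by positivity) (by positivity),
      Real.log_mul (by positivity) (by positivity)]
    push_cast
    linarith
  have hk : ((p + n + 2 : ℕ) : ℝ) * Real.log 2 ≤ 2 * (Λ + 2) := by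
    have h1 : ((p + n + 2 : ℕ) : ℝ) ≤ 2 * (Λ + 2) := by
      push_cast
      have : (p : ℝ) ≤ n := by exact_mod_cast hpn
      linarith
    have h2 : ((p + n + 2 : ℕ) : ℝ) * Real.log 2 ≤ ((p + n + 2 : ℕ) : ℝ) * 1 :=
      mul_le_mul_of_nonneg_left (by linarith) (Nat.cast_nonneg _)
    linarith
  have hd4 : (4 : ℝ) ≤ (d : ℝ) ^ 2 := by nlinarith
  have hmain : 2 * (52 * d ^ 2 * Real.log X + ((p + n + 2 : ℕ) : ℝ) * Real.log 2) ≤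
      (23 * (d * √Λ)) ^ 2 := by
    have h0 : (23 * (d * √Λ)) ^ 2 = 529 * (d ^ 2 * Λ) := by
      rw [mul_pow, mul_pow, Real.sq_sqrt (by linarith)]
      norm_num
    have h1 : Λ + 1 ≤ 2.45 * Λ := by linarith
    have h2 : 52 * (d : ℝ) ^ 2 * Real.log X ≤ 52 * d ^ 2 * (2 * (2.45 * Λ)) :=
      mul_le_mul_of_nonneg_left (by linarith) (by positivity)
    have h3 : 4 * Λ ≤ d ^ 2 * Λ := mul_le_mul_of_nonneg_right hd4 (by linarith)
    rw [h0]
    linarith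
  have hsqrt : √(2 * (52 * d ^ 2 * Real.log X + ((p + n + 2 : ℕ) : ℝ) * Real.log 2) / m) ≤
      23 * (d * √Λ) / √m := by
    rw [Real.sqrt_div' _ hm0.le]
    refine div_le_div_of_nonneg_right ?_ hsm0.le
    exact Real.sqrt_le_iff.2 ⟨by positivity, hmain⟩
  have h11 : 11 / √(m : ℝ) ≤ 7 * (d * √Λ) / √m :=
    div_le_div_of_nonneg_right (by linarith) hsm0.le
  have e : 30 * (d * √Λ / √m) = 23 * (d * √Λ) / √m + 7 * (d * √Λ) / √m := by ring
  unfold classSlack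
  linarith

theorem sqrt_confidence_le {a : ℝ} (ha : 0 ≤ a) (m : ℕ) :
    √(2 * a / m) ≤ 3 * √(a / (2 * m)) := by
  have h : (3 : ℝ) * √(a / (2 * m)) = √(9 * (a / (2 * m))) := by
    rw [Real.sqrt_mul (by norm_num)]
    congr 1
    rw [show (9 : ℝ) = 3 ^ 2 by norm_num, Real.sqrt_sq (by norm_num)]
  rw [h]
  apply Real.sqrt_le_sqrt
  have h1 : 0 ≤ a / m := by positivity
  have e1 : 2 * a / m = 2 * (a / m) := by ring
  have e2 : 9 * (a / (2 * m)) = 9 / 2 * (a / m) := by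
    rw [div_mul_eq_div_div, div_right_comm]
    ring
  rw [e1, e2]
  linarith

/-! ### The margin bound on good samples -/

theorem GateBound.mono {μ : Measure (Sequence dx K T)} {w : Weights dx dh K}
    {t : ℕ} {u β β' : ℝ} (h : GateBound μ w u t β) (hβ : β ≤ β') :
    GateBound μ w u t β' := by
  filter_upwards [h] with s hs j hj using (hs j hj).trans hβ

theorem GateBound.min_one_add {μ : Measure (Sequence dx K T)} {w : Weights dx dh K}
    {t : ℕ} {u β : ℝ} (hu : 0 ≤ u) (h : GateBound μ w u t β) :
    GateBound μ w u t (min β (1 + u)) := by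
  filter_upwards [h] with s hs j hj
  refine le_min (hs j hj) ?_
  have h0 : ∀ i, 0 < w.gate (inputs s) j i := fun i => gateAt_pos _ _ _ _
  have h1 : ∀ i, w.gate (inputs s) j i < 1 := fun i => gateAt_lt_one _ _ _ _
  have hr : ‖w.gate (inputs s) j‖ ≤ 1 := (pi_norm_le_iff_of_nonneg zero_le_one).2 fun i => by
    rw [Real.norm_eq_abs, abs_of_pos (h0 i)]
    exact (h1 i).le
  have hr' : ‖1 - w.gate (inputs s) j‖ ≤ 1 := (pi_norm_le_iff_of_nonneg zero_le_one).2 fun i => by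
    rw [Pi.sub_apply, Pi.one_apply, Real.norm_eq_abs, abs_of_pos (by linarith [h1 i])]
    linarith [h0 i]
  have h2 : u * ‖w.gate (inputs s) j‖ ^ 2 ≤ u :=
    mul_le_of_le_one_right hu (pow_le_one₀ (norm_nonneg _) hr)
  linarith

section Final

variable {σy : ℝ → ℝ} {ρ : ℝ≥0} {B : NormBounds} {μ : Measure (Sequence dx K T)}
  [IsProbabilityMeasure μ] {Bx : ℝ} {τ : Fin T} {d m : ℕ} {δ : ℝ} {w : Weights dx dh K}
  {φ : (Fin K → ℝ) → Fin K}

theorem GateBound.pos {t : ℕ} {u β : ℝ} (hu : 0 ≤ u) (hdh : 0 < dh) (ht : 0 < t)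
    (h : GateBound μ w u t β) : 0 < β := by
  obtain ⟨s, hs⟩ := h.exists
  have h1 := hs 0 ht
  have h2 := norm_le_pi_norm (1 - w.gate (inputs s) 0) ⟨0, hdh⟩
  have h3 : w.gate (inputs s) 0 ⟨0, hdh⟩ < 1 := gateAt_lt_one _ _ _ _
  rw [Pi.sub_apply, Pi.one_apply, Real.norm_eq_abs, abs_of_pos (by linarith)] at h2
  have h4 := mul_nonneg hu (sq_nonneg ‖w.gate (inputs s) 0‖)
  linarith

theorem margin_le_classMargin (hσ : LipschitzWith ρ σy) (hσ0 : σy 0 = 0) (hK : 2 ≤ K)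
    (hw : w.BoundedBy B) {b : ℝ} (hb : 0 ≤ b) (hdh : dh ≤ d) {s : Sequence dx K T}
    (ht : TrajBounds w B Bx b (τ + 1) (inputs s)) :
    margin (w.output σy (inputs s) (τ + 1)) (s τ).2 ≤ classMargin ρ B Bx d (τ + 1) b := by
  have hh : l2 (w.hidden (inputs s) (τ + 1)) ≤ min √d (B.Wh * Bx * geomRatio b (τ + 1)) :=
    le_min ((l2_hidden_le_sqrt _ _ _).trans (Real.sqrt_le_sqrt (by exact_mod_cast hdh)))
      (l2_hidden_le_geomRatio hw hb ht _ le_rfl)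
  refine (le_abs_self _).trans (abs_margin_le hK (fun i => ?_) _)
  exact (abs_output_le hσ hσ0 hw _ _ i).trans
    (mul_le_mul_of_nonneg_left (mul_le_mul_of_nonneg_left hh hw.V_nonneg) ρ.2)

/-- From the deviation at the scales `q ∈ [1, √m]` to all margins `γ = D / q`: for `q < 1` the loss
is linear in `q`, since no margin exceeds `D`, and for `q > √m` the right side exceeds `1`. -/
theorem errProb_le_of_deviation (hσ : LipschitzWith ρ σy) (hσ0 : σy 0 = 0) (hK : 2 ≤ K)
    (hφ : ∀ (y : Fin K → ℝ) (j : Fin K), y j ≤ y (φ y))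
    (hx : ∀ᵐ s ∂μ, ∀ j : Fin T, ‖(s j).1‖ ≤ Bx) (hm : 0 < m) (hdh : dh ≤ d)
    (hw : w.BoundedBy B) {b D γ E r : ℝ} (hb : 0 ≤ b) (hD : D = classMargin ρ B Bx d (τ + 1) b)
    (hD0 : 0 < D) (hγ : 0 < γ)
    (hgate : GateBound μ w B.Uh (τ + 1) b) (hE : 0 ≤ E) (hr : 1 / √m ≤ r)
    {S : Fin m → Sequence dx K T} (hS : ∀ i, S i ∈ goodSequences μ Bx)
    (hdev : ∀ x ∈ netClass (dh := dh) B (goodSequences μ Bx) Bx b τ √m,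
      ∫ s, marginLoss σy D τ x s ∂μ ≤ 1 / m * ∑ i, marginLoss σy D τ x (S i) + (E + 30 * r)) :
    errProb μ φ w σy τ ≤ empRisk w σy γ τ S + E + 30 * (D / γ * r) := by
  have hm0 : (0 : ℝ) < m := by exact_mod_cast hm
  have hsm0 : 0 < √(m : ℝ) := Real.sqrt_pos.2 hm0
  have hr0 : 0 < r := lt_of_lt_of_le (by positivity) hr
  have htraj : ∀ s ∈ goodSequences μ Bx, TrajBounds w B Bx b (τ + 1) (inputs s) :=
    fun s hs => hgate.trajBounds hs
  set q := D / γ with hq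
  have hq0 : 0 < q := by positivity
  have herr := errProb_le_integral hK hσ.continuous μ hφ hD0 hq0.le τ w
  rw [empRisk_eq w σy hγ hD0, ← hq]
  have hsm1 : 1 ≤ √(m : ℝ) := Real.one_le_sqrt.2 (by exact_mod_cast hm)
  rcases lt_or_ge q 1 with hq1 | hq1
  · have hlin : ∀ s ∈ goodSequences μ Bx, marginLoss σy D τ (w, q) s =
        1 - q * (1 - marginLoss σy D τ (w, 1) s) := by
      intro s hs
      have h1 : margin (w.output σy (inputs s) (τ + 1)) (s τ).2 / D ≤ 1 := by
        rw [div_le_one hD0, hD]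
        exact margin_le_classMargin hσ hσ0 hK hw hb hdh (htraj s hs)
      simp only [marginLoss]
      rw [clampLoss_mul hq0.le hq1.le h1, one_mul]
    have hint : ∫ s, marginLoss σy D τ (w, q) s ∂μ =
        1 - q * (1 - ∫ s, marginLoss σy D τ (w, 1) s ∂μ) := by
      have hI := integrable_marginLoss hK hσ.continuous μ D τ (w, 1)
      have h1 : ∫ s, marginLoss σy D τ (w, q) s ∂μ =
          ∫ s, (1 - q * (1 - marginLoss σy D τ (w, 1) s)) ∂μ := by
        refine integral_congr_ae ?_
        filter_upwards [ae_mem_goodSequences hx] with s hs using hlin s hs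
      have hI' : Integrable (fun s => q * (1 - marginLoss σy D τ (w, 1) s)) μ :=
        ((integrable_const (1 : ℝ)).sub hI).const_mul q
      rw [h1, integral_sub (integrable_const _) hI', integral_const_mul,
        integral_sub (integrable_const _) hI]
      simp
    have hsum : 1 / (m : ℝ) * ∑ i, marginLoss σy D τ (w, q) (S i) =
        1 - q * (1 - 1 / m * ∑ i, marginLoss σy D τ (w, 1) (S i)) := by
      simp only [fun i => hlin (S i) (hS i)]
      rw [Finset.sum_sub_distrib, ← Finset.mul_sum, Finset.sum_sub_distrib]
      simp only [Finset.sum_const, Finset.card_univ, Fintype.card_fin, nsmul_eq_mul, mul_one]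
      field_simp
    have h1 := hdev (w, 1) ⟨hw, htraj, le_rfl, hsm1⟩
    have h2 := mul_le_mul_of_nonneg_left h1 hq0.le
    have h3 : q * E ≤ E := mul_le_of_le_one_left hE hq1.le
    rw [hint] at herr
    rw [hsum]
    linarith
  · rcases le_or_gt q √m with hqm | hqm
    · have h1 := hdev (w, q) ⟨hw, htraj, hq1, hqm⟩
      have h2 : r ≤ q * r := le_mul_of_one_le_left hr0.le hq1
      linarith
    · have h1 := errProb_le_one μ φ w σy τ
      have h2 : 1 ≤ q * r := by
        have h3 := mul_le_mul hqm.le hr (by positivity) hq0.le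
        rwa [mul_one_div, div_self hsm0.ne'] at h3
      have h4 : 0 ≤ 1 / (m : ℝ) * ∑ i, marginLoss σy D τ (w, q) (S i) :=
        mul_nonneg (by positivity) (Finset.sum_nonneg fun i _ => (clampLoss_mem _).1)
      linarith

/-- A sample outside all the exceptional sets satisfies the margin bound. -/
theorem margin_bound_of_good_sample (hσ : LipschitzWith ρ σy) (hσ0 : σy 0 = 0) (hK : 2 ≤ K)
    (hφ : ∀ (y : Fin K → ℝ) (j : Fin K), y j ≤ y (φ y))
    (hx : ∀ᵐ s ∂μ, ∀ j : Fin T, ‖(s j).1‖ ≤ Bx) (hm : 0 < m) (hdh : dh ≤ d) (hKd : K ≤ d)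
    (hdh0 : 0 < dh) (hρ : 0 < ρ) (hV : 0 < B.V) (hA : 0 < B.Wh * Bx) (hδ0 : 0 < δ) (hδ1 : δ < 1)
    {S : Fin m → Sequence dx K T} (hS : ∀ i, S i ∈ goodSequences μ Bx)
    (hgood : ∀ p n, S ∉ badSamples dh σy ρ B μ Bx τ d m δ p n) {γ : ℝ} (hγ : 0 < γ)
    (hw : w.BoundedBy B) {β : ℝ} (hβ : GateBound μ w B.Uh (τ + 1) β) :
    errProb μ φ w σy τ ≤ empRisk w σy γ τ S + 3 * √(Real.log (2 / δ) / (2 * m)) +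
      200 * complexity d ρ B Bx β γ (τ + 1) m := by
  have hUr := hw.Ur_nonneg
  have hUh := hw.Uh_nonneg
  have hUU := mul_nonneg hUr hUh
  have hd : 2 ≤ d := hK.trans hKd
  have hm0 : (0 : ℝ) < m := by exact_mod_cast hm
  have hsm0 : 0 < √(m : ℝ) := Real.sqrt_pos.2 hm0
  set t := (τ : ℕ) + 1 with ht
  have ht0 : 0 < t := Nat.succ_pos _
  set b₁ := min β (1 + B.Uh) with hb₁
  have hgate₁ : GateBound μ w B.Uh t b₁ := hβ.min_one_add hUh
  have hb₁0 : 0 < b₁ := hgate₁.pos hUh hdh0 ht0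
  have hθ₁ : 0 ≤ b₁ + 2 * B.Ur + B.Ur * B.Uh := by positivity
  set g₁ := geomRatio b₁ t with hg₁
  set G₁ := geomRatio (b₁ + 2 * B.Ur + B.Ur * B.Uh) t with hG₁
  have hg₁1 : 1 ≤ g₁ := one_le_geomRatio hb₁0.le ht0
  have hgG : g₁ ≤ G₁ := geomRatio_mono_left hb₁0.le (by linarith) t
  have hG₁1 : 1 ≤ G₁ := hg₁1.trans hgG
  -- the class to which `b₁` belongs, and its representative `b`
  set p := ⌈Real.log g₁⌉₊ with hp
  set n := ⌈Real.log G₁⌉₊ with hn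
  have hpn : p ≤ n := Nat.ceil_le_ceil (Real.log_le_log (by linarith) hgG)
  have hp1 : (p : ℝ) ≤ Real.log g₁ + 1 := (Nat.ceil_lt_add_one (Real.log_nonneg hg₁1)).le
  have hn1 : (n : ℝ) ≤ Real.log G₁ + 1 := (Nat.ceil_lt_add_one (Real.log_nonneg hG₁1)).le
  have hadm : b₁ ∈ admissibleBounds B t p n := by
    refine ⟨⟨hb₁0.le, min_le_right _ _⟩, ?_, ?_⟩
    · rw [← Real.log_le_iff_le_exp (by linarith)]
      exact Nat.le_ceil _
    · rw [← Real.log_le_iff_le_exp (by linarith)]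
      exact Nat.le_ceil _
  obtain ⟨b, hb⟩ := (isCompact_admissibleBounds B t p n).exists_isGreatest ⟨b₁, hadm⟩
  have hbb : b₁ ≤ b := hb.2 hadm
  have hb0 : 0 < b := hb₁0.trans_le hbb
  have hg : geomRatio b t ≤ Real.exp 1 * g₁ := by
    refine hb.1.2.1.trans ?_
    calc Real.exp p ≤ Real.exp (1 + Real.log g₁) := Real.exp_le_exp.2 (by linarith)
      _ = Real.exp 1 * g₁ := by rw [Real.exp_add, Real.exp_log (by linarith)]
  have hG : geomRatio (b + 2 * B.Ur + B.Ur * B.Uh) t ≤ Real.exp 1 * G₁ := by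
    refine hb.1.2.2.trans ?_
    calc Real.exp n ≤ Real.exp (1 + Real.log G₁) := Real.exp_le_exp.2 (by linarith)
      _ = Real.exp 1 * G₁ := by rw [Real.exp_add, Real.exp_log (by linarith)]
  have hG0 : 0 < geomRatio (b + 2 * B.Ur + B.Ur * B.Uh) t :=
    lt_of_lt_of_le one_pos (one_le_geomRatio (by positivity) ht0)
  set D := classMargin ρ B Bx d t b with hD
  have hD0 : 0 < D := classMargin_pos hρ hV hA (by omega) hb0.le ht0
  have hD3 : D ≤ 3 * classMargin ρ B Bx d t b₁ := by
    have he3 : Real.exp 1 ≤ 3 := by linarith [Real.exp_one_lt_d9]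
    have h1 : min √(d : ℝ) (B.Wh * Bx * geomRatio b t) ≤ 3 * min √(d : ℝ) (B.Wh * Bx * g₁) := by
      rw [mul_min_of_nonneg _ _ (by norm_num)]
      refine min_le_min (by linarith [Real.sqrt_nonneg (d : ℝ)]) ?_
      have h2 : geomRatio b t ≤ 3 * g₁ :=
        hg.trans (mul_le_mul_of_nonneg_right he3 (by linarith))
      calc B.Wh * Bx * geomRatio b t ≤ B.Wh * Bx * (3 * g₁) :=
            mul_le_mul_of_nonneg_left h2 hA.le
        _ = _ := by ring
    calc D = 2 * (ρ * (B.V * min √(d : ℝ) (B.Wh * Bx * geomRatio b t))) := by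
          rw [hD]
          unfold classMargin
          ring
      _ ≤ 2 * (ρ * (B.V * (3 * min √(d : ℝ) (B.Wh * Bx * g₁)))) := by gcongr
      _ = 3 * classMargin ρ B Bx d t b₁ := by
          unfold classMargin
          ring
  set Λ := Real.log (G₁ * d * √m) with hΛ
  obtain ⟨hslack, hrate⟩ := slack_le_rate (δ := δ) hd hm hG₁1 hG0 hG hpn hn1 rfl hΛ
  set r := d * √Λ / √m with hr
  set E := √(2 * Real.log (2 / δ) / m) with hE
  have hr1 : 1 / √m ≤ r := div_le_div_of_nonneg_right hrate hsm0.le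
  have hdev : ∀ x ∈ netClass (dh := dh) B (goodSequences μ Bx) Bx b τ √m,
      ∫ s, marginLoss σy D τ x s ∂μ ≤
        1 / m * ∑ i, marginLoss σy D τ x (S i) + (E + 30 * r) := by
    intro x hx
    have h1 : m * ∫ s, marginLoss σy D τ x s ∂μ ≤ ∑ i, marginLoss σy D τ x (S i) +
        (√m + m * (classSlack δ (classSize B d m t b) d m (p + n + 2) + 2 * (5 / √m))) := by
      by_contra hcon
      exact hgood p n ⟨b, hb, hb0, x, hx, not_le.1 hcon⟩
    have h2 : ∫ s, marginLoss σy D τ x s ∂μ ≤ 1 / m * (∑ i, marginLoss σy D τ x (S i) +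
        (√m + m * (classSlack δ (classSize B d m t b) d m (p + n + 2) + 2 * (5 / √m)))) := by
      rw [one_div_mul_eq_div, le_div_iff₀ hm0, mul_comm]
      exact h1
    have h3 : 1 / (m : ℝ) * √m = 1 / √m := by
      rw [one_div_mul_eq_div, div_eq_div_iff hm0.ne' hsm0.ne', one_mul,
        Real.mul_self_sqrt hm0.le]
    have h4 : 1 / m * (∑ i, marginLoss σy D τ x (S i) +
        (√m + m * (classSlack δ (classSize B d m t b) d m (p + n + 2) + 2 * (5 / √m)))) =
        1 / m * ∑ i, marginLoss σy D τ x (S i) +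
          (11 / √m + classSlack δ (classSize B d m t b) d m (p + n + 2)) := by
      rw [mul_add, mul_add (1 / (m : ℝ)), h3, ← mul_assoc, one_div_mul_cancel hm0.ne']
      ring
    rw [h4] at h2
    exact h2.trans (add_le_add le_rfl hslack)
  have hfin := errProb_le_of_deviation hσ hσ0 hK hφ hx hm hdh hw hb0.le hD hD0 hγ
    (hgate₁.mono hbb) (Real.sqrt_nonneg _) hr1 hS hdev
  have hconf : E ≤ 3 * √(Real.log (2 / δ) / (2 * m)) :=
    sqrt_confidence_le (Real.log_nonneg ((one_le_div hδ0).2 (by linarith))) m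
  have hr0 : 0 ≤ r := le_trans (by positivity) hr1
  have hcomp : 30 * (D / γ * r) ≤ 200 * complexity d ρ B Bx b₁ γ t m := by
    rw [complexity_eq]
    have h1 : D / γ * r ≤ 3 * classMargin ρ B Bx d t b₁ / γ * r :=
      mul_le_mul_of_nonneg_right (div_le_div_of_nonneg_right hD3 hγ.le) hr0
    have h2 : 0 ≤ classMargin ρ B Bx d t b₁ / γ * r :=
      mul_nonneg (div_nonneg (classMargin_nonneg hV.le hA.le hb₁0.le) hγ.le) hr0
    have e1 : 3 * classMargin ρ B Bx d t b₁ / γ * r = 3 * (classMargin ρ B Bx d t b₁ / γ * r) := by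
      ring
    have e2 : 200 * (classMargin ρ B Bx d t b₁ / 2 / γ * r) =
        100 * (classMargin ρ B Bx d t b₁ / γ * r) := by ring
    change 30 * (D / γ * r) ≤ 200 * (classMargin ρ B Bx d t b₁ / 2 / γ * r)
    rw [e2]
    linarith
  have hmono := complexity_mono (ρ := ρ) (Bx := Bx) (b' := β) (γ := γ) (d := d) (m := m) (t := t)
    hV.le hA.le hUr hUh hb₁0.le (min_le_left _ _) hγ (by omega) hm ht0
  linarith

/-- In each of these cases the outputs and the margins vanish on the sample, so the ramp risk is
`1`. -/
theorem margin_bound_of_degenerate (hσ : LipschitzWith ρ σy) (hσ0 : σy 0 = 0) (hK : 2 ≤ K)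
    (hm : 0 < m) (hBx : 0 ≤ Bx) (hdeg : dh = 0 ∨ ρ = 0 ∨ B.V = 0 ∨ B.Wh * Bx = 0)
    {S : Fin m → Sequence dx K T} (hS : ∀ i, S i ∈ goodSequences μ Bx) {γ : ℝ} (hγ : 0 < γ)
    (hw : w.BoundedBy B) {β : ℝ} (hβ : GateBound μ w B.Uh (τ + 1) β) :
    errProb μ φ w σy τ ≤ empRisk w σy γ τ S + 3 * √(Real.log (2 / δ) / (2 * m)) +
      200 * complexity d ρ B Bx β γ (τ + 1) m := by
  have hβ0 : 0 ≤ β := by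
    obtain ⟨s, hs⟩ := hβ.exists
    exact (add_nonneg (norm_nonneg _) (mul_nonneg hw.Uh_nonneg (sq_nonneg _))).trans
      (hs 0 (Nat.succ_pos _))
  have hout : ∀ i, (w.output σy (inputs (S i)) (τ + 1)) = fun _ => 0 := by
    intro i
    have h1 := l2_hidden_le_sqrt w (inputs (S i)) (τ + 1)
    have h2 := l2_hidden_le_geomRatio hw hβ0 (hβ.trajBounds (hS i)) (τ + 1) le_rfl
    have h0 := l2_nonneg (w.hidden (inputs (S i)) (τ + 1))
    have hz : (ρ : ℝ) * (B.V * l2 (w.hidden (inputs (S i)) (τ + 1))) = 0 := by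
      rcases hdeg with h | h | h | h
      · subst h
        have : l2 (w.hidden (inputs (S i)) (τ + 1)) = 0 := le_antisymm (by simpa using h1) h0
        rw [this, mul_zero, mul_zero]
      · rw [h, NNReal.coe_zero, zero_mul]
      · rw [h, zero_mul, mul_zero]
      · rw [h, zero_mul] at h2
        rw [le_antisymm h2 h0, mul_zero, mul_zero]
    funext j
    have h3 := abs_output_le hσ hσ0 hw (inputs (S i)) (τ + 1) j
    rw [hz] at h3
    exact abs_nonpos_iff.1 h3
  have hm0 : (0 : ℝ) < m := by exact_mod_cast hm
  have hemp : empRisk w σy γ τ S = 1 := by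
    unfold empRisk
    simp only [hout, margin_zero hK]
    simp only [rampLoss_neg_eq_clampLoss hγ, zero_div, clampLoss_of_nonpos le_rfl,
      Finset.sum_const, Finset.card_univ, Fintype.card_fin, nsmul_eq_mul, mul_one]
    exact one_div_mul_cancel hm0.ne'
  have h1 := errProb_le_one μ φ w σy τ
  have h2 := complexity_nonneg (ρ := ρ) (d := d) (t := τ + 1) (m := m) hw.V_nonneg
    (mul_nonneg hw.Wh_nonneg hBx) hβ0 hγ
  have h3 : 0 ≤ √(Real.log (2 / δ) / (2 * m)) := Real.sqrt_nonneg _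
  rw [hemp]
  linarith

end Final

end MGU

theorem theorem4 :
    ∃ C : ℝ, 0 < C ∧
      ∀ (dx dh K T m : ℕ) (_hK : 2 ≤ K) (_hm : 0 < m)
        (B : MGU.NormBounds) (Bx : ℝ)
        (σy : ℝ → ℝ) (ρ : ℝ≥0) (_hσ : LipschitzWith ρ σy) (_hσ0 : σy 0 = 0)
        (φ : (Fin K → ℝ) → Fin K) (_hφ : ∀ (y : Fin K → ℝ) (j : Fin K), y j ≤ y (φ y))
        (μ : Measure (MGU.Sequence dx K T)) (_hμ : IsProbabilityMeasure μ)
        (_hx : ∀ᵐ s ∂μ, ∀ j : Fin T, ‖(s j).1‖ ≤ Bx)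
        (δ : ℝ) (_hδ0 : 0 < δ) (_hδ1 : δ < 1)
        (τ : Fin T),
        Measure.pi (fun _ : Fin m => μ)
          {S | ¬ ∀ γ : ℝ, 0 < γ → ∀ w : MGU.Weights dx dh K, w.BoundedBy B →
            ∀ β : ℝ, MGU.GateBound μ w B.Uh (τ + 1) β →
              MGU.errProb μ φ w σy τ ≤
                MGU.empRisk w σy γ τ S + 3 * √(Real.log (2 / δ) / (2 * m)) +
                  C * MGU.complexity (max dx (max K dh)) ρ B Bx β γ (τ + 1) m}
          ≤ ENNReal.ofReal δ := by
  refine ⟨200, by norm_num, ?_⟩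
  intro dx dh K T m hK hm B Bx σy ρ hσ hσ0 φ hφ μ hμ hx δ hδ0 hδ1 τ
  have hdx : dx ≤ max dx (max K dh) := le_max_left _ _
  have hKd : K ≤ max dx (max K dh) := (le_max_left _ _).trans (le_max_right _ _)
  have hdh : dh ≤ max dx (max K dh) := (le_max_right _ _).trans (le_max_right _ _)
  by_cases hne : ∃ w : MGU.Weights dx dh K, w.BoundedBy B
  swap
  · refine le_trans (le_of_eq ?_) zero_le
    convert measure_empty (μ := Measure.pi fun _ : Fin m => μ)
    refine Set.eq_empty_of_forall_notMem fun S hS => hS ?_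
    exact fun γ _ w hw => absurd ⟨w, hw⟩ hne
  obtain ⟨w₀, hw₀⟩ := hne
  have hBx : 0 ≤ Bx := by
    obtain ⟨s, hs⟩ := hx.exists
    exact (norm_nonneg _).trans (hs τ)
  have hae : ∀ᵐ S ∂(Measure.pi fun _ : Fin m => μ), ∀ i, S i ∈ MGU.goodSequences μ Bx := by
    rw [ae_all_iff]
    intro i
    exact (measurePreserving_eval (fun _ : Fin m => μ) i).quasiMeasurePreserving.ae
      (MGU.ae_mem_goodSequences hx)
  by_cases hdeg : dh = 0 ∨ ρ = 0 ∨ B.V = 0 ∨ B.Wh * Bx = 0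
  · refine le_trans (le_of_eq (measure_mono_null (fun S hS => ?_) hae)) zero_le
    intro hgood
    exact hS fun γ hγ w hw β hβ =>
      MGU.margin_bound_of_degenerate hσ hσ0 hK hm hBx hdeg hgood hγ hw hβ
  push Not at hdeg
  obtain ⟨hdh0, hρ, hV, hA⟩ := hdeg
  have hρ' : 0 < ρ := pos_iff_ne_zero.2 hρ
  have hV' : 0 < B.V := lt_of_le_of_ne hw₀.V_nonneg hV.symm
  have hA' : 0 < B.Wh * Bx := lt_of_le_of_ne (mul_nonneg hw₀.Wh_nonneg hBx) hA.symm
  have hunion := MGU.measure_iUnion_badSamples_le (dh := dh) (τ := τ) hσ hσ0 hK hx hm hdx hdh hKd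
    hw₀.Ur_nonneg hw₀.Uh_nonneg hρ' hV' hA' hδ0 hδ1
  refine le_trans (measure_mono_ae ?_) hunion
  filter_upwards [hae] with S hgood hS
  by_contra hcon
  have hnot : ∀ p n, S ∉ MGU.badSamples dh σy ρ B μ Bx τ (max dx (max K dh)) m δ p n :=
    fun p n hbad => hcon (Set.mem_iUnion.2 ⟨(p, n), hbad⟩)
  exact hS fun γ hγ w hw β hβ => MGU.margin_bound_of_good_sample hσ hσ0 hK hφ hx hm hdh hKd
    (Nat.pos_of_ne_zero hdh0) hρ' hV' hA' hδ0 hδ1 hgood hnot hγ hw hβ
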